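/- **Theorem.** Consider games played on finite directed graphs in which every vertex has an outgoing edge and belongs to Player $0$ or to Player $1$; a play is an infinite path $\rho=\rho_0\rho_1\cdots$, the owner of the current vertex choosing the next edge. Vertices are colored by $\Omega\colon V\to\mathbb N$. The request at position $k$ is *answered* if $\Omega(\rho_{k'})$ is even and $\Omega(\rho_{k'})\ge\Omega(\rho_k)$ for some $k'\ge k$. * In a *parity game*, Player $0$ wins $\rho$ iff all but finitely many requests are answered. * In a *bounded parity game with costs*, every edge is moreover an $\varepsilon$-edge (cost $0$) or an increment-edge (cost $1$). Let $\mathrm{Cor}(\rho,k)\in\mathbb N\cup\{\infty\}$ be the least cost of an infix $\rho_k\cdots\rho_{k'}$, $k'\ge k$, ending in an answer to the request at position $k$ ($\infty$ if there is none). Player $0$ wins $\rho$ iff $\limsup_{k\to\infty}\mathrm{Cor}(\rho,k)<\infty$ and there is no position $k$ whose request is not answered while $\rho_k\rho_{k+1}\cdots$ contains infinitely many increment-edges. *Solving* a game means computing the winning regions of both players together with uniform winning strategies: positional ones for parity games, and finite-state ones for bounded parity games with costs, given by an explicit memory structure (initialization, update and next-move functions) that has at most $k+1$ memory states, where $k$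 is the number of odd colors of the game. For a game, $n$, $m$ and $d$ denote the numbers of vertices, of edges and of colors that occur. Games are given by the lists of their owners, colors, edges and edge costs. Algorithms are programs for a random access machine with unit-cost operations (reading and writing of indirectly addressed cells that hold natural numbers, addition, truncated subtraction, halving, tests for zero). Let $T\colon\mathbb N^3\to\mathbb N$ be non-decreasing in each argument and at least linear in the size of the graph, i.e., $n+m=O(T(n,m,d))$. If there is an algorithm that solves every parity game in time at most $T(n,m,d)$, then there is an algorithm that solves every bounded parity game with costs in time $O(T(dn,dm,d+2))$. -/

import Mathlib

namespace CostGames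

/-! ### Arenas, plays, strategies, winning regions -/

/-- An arena with vertex set `V` (always finite below): a directed graph in which every vertex has
a successor, with the vertices partitioned by `owner` between Player 0 and Player 1. -/
structure Arena (V : Type*) where
  owner : V → Fin 2
  E : V → V → Prop
  total : ∀ v, ∃ v', E v v'

/-- `ρ` is a play of the arena, i.e. an infinite path. -/
def Arena.IsPlay {V : Type*} (A : Arena V) (ρ : ℕ → V) : Prop :=
  ∀ k, A.E (ρ k) (ρ (k + 1))

/-- Player `i` wins `ρ` in the game with winning set `Win` (for Player 0). -/
def WonBy {V : Type*} (Win : Set (ℕ → V)) (i : Fin 2) (ρ : ℕ → V) : Prop :=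
  ρ ∈ Win ↔ i = 0

/-- `σ` is a strategy for Player `i`. The value `σ w v` is the move after the history `w v`, where
`w` is a finite word and `v` the current vertex; only its values for `v` of owner `i` matter. -/
def Arena.IsStrategy {V : Type*} (A : Arena V) (i : Fin 2) (σ : List V → V → V) : Prop :=
  ∀ w v, A.owner v = i → A.E v (σ w v)

/-- The play `ρ` is consistent with the strategy `σ` of Player `i`. -/
def Arena.Consistent {V : Type*} (A : Arena V) (i : Fin 2) (σ : List V → V → V)
    (ρ : ℕ → V) : Prop :=
  ∀ k, A.owner (ρ k) = i → ρ (k + 1) = σ ((List.range k).map ρ) (ρ k)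

/-- `σ` is a winning strategy for Player `i` from the set `W` of vertices. -/
def Arena.IsWinningFrom {V : Type*} (A : Arena V) (Win : Set (ℕ → V)) (i : Fin 2)
    (σ : List V → V → V) (W : Set V) : Prop :=
  A.IsStrategy i σ ∧
    ∀ ρ, A.IsPlay ρ → ρ 0 ∈ W → A.Consistent i σ ρ → WonBy Win i ρ

/-- The winning region of Player `i`. -/
def Arena.winningRegion {V : Type*} (A : Arena V) (Win : Set (ℕ → V)) (i : Fin 2) : Set V :=
  {v | ∃ σ, A.IsWinningFrom Win i σ {v}}

/-- A memory structure with set of memory states `M`. -/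
structure MemoryStructure (V M : Type*) where
  init : V → M
  upd : M → V → M

/-- The memory state reached after the nonempty word `w v`. -/
def MemoryStructure.updPlus {V M : Type*} (𝓜 : MemoryStructure V M) : List V → V → M
  | [], v => 𝓜.init v
  | u :: w, v => (w ++ [v]).foldl 𝓜.upd (𝓜.init u)

/-- The finite-state strategy given by a memory structure and a next-move function. -/
def MemoryStructure.strategy {V M : Type*} (𝓜 : MemoryStructure V M) (nxt : V → M → V) :
    List V → V → V :=
  fun w v => nxt v (𝓜.updPlus w v)

/-- The positional strategy given by a choice of successors. -/
def positional {V : Type*} (nxt : V → V) : List V → V → V :=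
  fun _ v => nxt v

/-! ### Winning conditions -/

/-- Edge labels: `eps` for `ε`-edges, `inc` for increment-edges. -/
inductive EdgeCost where
  | eps
  | inc

/-- The contribution of an edge to the cost of a path. -/
def EdgeCost.toNat : EdgeCost → ℕ
  | eps => 0
  | inc => 1

/-- The set of colors that answer a request of color `c`. -/
def answers (c : ℕ) : Set ℕ := {c' | c ≤ c' ∧ Even c'}

/-- The cost of the infix `ρ k ⋯ ρ k'`. -/
def infixCost {V : Type*} (Cst : V → V → EdgeCost) (ρ : ℕ → V) (k k' : ℕ) : ℕ :=
  ∑ j ∈ Finset.Ico k k', (Cst (ρ j) (ρ (j + 1))).toNat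

/-- The cost of the infinite suffix of `ρ` from position `k` on. -/
noncomputable def suffixCost {V : Type*} (Cst : V → V → EdgeCost) (ρ : ℕ → V) (k : ℕ) : ℕ∞ :=
  ⨆ k' : ℕ, (infixCost Cst ρ k k' : ℕ∞)

/-- The cost-of-response at position `k`; it is `⊤` if there is no answer. -/
noncomputable def costOfResponse {V : Type*} (Ω : V → ℕ) (Cst : V → V → EdgeCost)
    (ρ : ℕ → V) (k : ℕ) : ℕ∞ :=
  sInf {c | ∃ k', k ≤ k' ∧ Ω (ρ k') ∈ answers (Ω (ρ k)) ∧ c = (infixCost Cst ρ k k' : ℕ∞)}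

/-- The request at position `k` is answered. -/
def Answered {V : Type*} (Ω : V → ℕ) (ρ : ℕ → V) (k : ℕ) : Prop :=
  ∃ k', k ≤ k' ∧ Ω (ρ k') ∈ answers (Ω (ρ k))

/-- The parity condition: all but finitely many requests are answered. -/
def parity {V : Type*} (Ω : V → ℕ) : Set (ℕ → V) :=
  {ρ | ∀ᶠ k in Filter.atTop, Answered Ω ρ k}

/-- The bounded cost-parity condition: the limit superior of the costs-of-response is finite, and
no request is unanswered with cost `∞`. -/
def bndCostParity {V : Type*} (Ω : V → ℕ) (Cst : V → V → EdgeCost) : Set (ℕ → V) :=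
  {ρ | Filter.limsup (costOfResponse Ω Cst ρ) Filter.atTop < ⊤ ∧
    ∀ k, ¬ (¬ Answered Ω ρ k ∧ suffixCost Cst ρ k = ⊤)}

/-! ### Games as inputs of algorithms: numbered vertices and a list of the edges -/

/-- A parity game with the `n` vertices `0, …, n - 1` and exactly `m` edges, which are listed
without repetition. -/
structure ParityGame (n m : ℕ) where
  owner : Fin n → Fin 2
  color : Fin n → ℕ
  edge : Fin m → Fin n × Fin n
  edge_injective : Function.Injective edge
  total : ∀ v, ∃ e, (edge e).1 = v

/-- A bounded parity game with costs with `n` vertices and `m` edges, each labelled by a cost. -/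
structure BndCostGame (n m : ℕ) extends ParityGame n m where
  cost : Fin m → EdgeCost

/-- The arena of a game. -/
def ParityGame.arena {n m : ℕ} (G : ParityGame n m) : Arena (Fin n) where
  owner := G.owner
  E v v' := ∃ e, G.edge e = (v, v')
  total v := by
    obtain ⟨e, he⟩ := G.total v
    exact ⟨(G.edge e).2, e, by rw [← he]⟩

/-- The number of colors that occur in a game. -/
def ParityGame.numColors {n m : ℕ} (G : ParityGame n m) : ℕ :=
  (Finset.univ.image G.color).card

/-- The number of odd colors that occur in a game. -/
def ParityGame.numOddColors {n m : ℕ} (G : ParityGame n m) : ℕ :=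
  ((Finset.univ.image G.color).filter Odd).card

open Classical in
/-- The cost function of a game, as a function on pairs of vertices; it agrees with the given
labels on the edges, and its values on other pairs play no role. -/
noncomputable def BndCostGame.Cst {n m : ℕ} (G : BndCostGame n m) (v v' : Fin n) : EdgeCost :=
  if h : ∃ e, G.edge e = (v, v') then G.cost h.choose else EdgeCost.eps

/-! ### The machine model: unit-cost programs over arrays of natural numbers

A program uses finitely many arrays, named by fixed numbers. Cells hold natural numbers and are
addressed by computed indices. The operations are reading a cell, addition, truncated subtraction
and halving, each at unit cost (so this is a random access machine with structured control flow).
Multiplication is not a primitive; halving makes it possible to tell even colors from odd colors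
in constantly many steps, however large they are. -/

/-- The memory: `s a i` is the content of cell `i` of array `a`. -/
abbrev Store := ℕ → ℕ → ℕ

/-- Expressions. -/
inductive Expr where
  | const (k : ℕ)
  | get (a : ℕ) (i : Expr)
  | add (x y : Expr)
  | sub (x y : Expr)
  | half (x : Expr)

/-- The value of an expression. -/
def Expr.eval (s : Store) : Expr → ℕ
  | const k => k
  | get a i => s a (i.eval s)
  | add x y => x.eval s + y.eval s
  | sub x y => x.eval s - y.eval s
  | half x => x.eval s / 2

/-- The number of steps for evaluating an expression. -/
def Expr.cost : Expr → ℕ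
  | const _ => 1
  | get _ i => i.cost + 1
  | add x y => x.cost + y.cost + 1
  | sub x y => x.cost + y.cost + 1
  | half x => x.cost + 1

/-- Programs. `assign a i e` writes the value of `e` into cell `i` of array `a`; a condition holds
if its value is not zero. -/
inductive Prog where
  | skip
  | assign (a : ℕ) (i e : Expr)
  | seq (p q : Prog)
  | ite (c : Expr) (p q : Prog)
  | loop (c : Expr) (p : Prog)

/-- Writing `x` into cell `i` of array `a`. -/
def Store.write (s : Store) (a i x : ℕ) : Store :=
  Function.update s a (Function.update (s a) i x)

/-- `Exec p s t s'`: started in memory `s`, the program `p` halts after exactly `t` steps in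
memory `s'`. -/
inductive Exec : Prog → Store → ℕ → Store → Prop where
  | skip (s : Store) : Exec Prog.skip s 1 s
  | assign (a : ℕ) (i e : Expr) (s : Store) :
      Exec (Prog.assign a i e) s (i.cost + e.cost + 1) (s.write a (i.eval s) (e.eval s))
  | seq {p q : Prog} {s s' s'' : Store} {t t' : ℕ} :
      Exec p s t s' → Exec q s' t' s'' → Exec (Prog.seq p q) s (t + t') s''
  | ite_true {c : Expr} {p q : Prog} {s s' : Store} {t : ℕ} :
      c.eval s ≠ 0 → Exec p s t s' → Exec (Prog.ite c p q) s (c.cost + t) s'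
  | ite_false {c : Expr} {p q : Prog} {s s' : Store} {t : ℕ} :
      c.eval s = 0 → Exec q s t s' → Exec (Prog.ite c p q) s (c.cost + t) s'
  | loop_done {c : Expr} {p : Prog} {s : Store} :
      c.eval s = 0 → Exec (Prog.loop c p) s c.cost s
  | loop_step {c : Expr} {p : Prog} {s s' s'' : Store} {t t' : ℕ} :
      c.eval s ≠ 0 → Exec p s t s' → Exec (Prog.loop c p) s' t' s'' →
        Exec (Prog.loop c p) s (c.cost + t + t') s''

/-! ### Input and output conventions, solving games -/

/-- The array that holds the values of `f`, followed by zeros. -/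
def arrayOf {n : ℕ} (f : Fin n → ℕ) : ℕ → ℕ :=
  fun i => if h : i < n then f ⟨i, h⟩ else 0

/-- The initial memory for a parity game: array `0` holds `n` and `m`, arrays `1` and `2` the
owners and the colors of the vertices, arrays `3` and `4` the sources and the targets of the edges.
All other cells are zero. -/
def ParityGame.input {n m : ℕ} (G : ParityGame n m) : Store
  | 0 => arrayOf ![n, m]
  | 1 => arrayOf fun v => (G.owner v : ℕ)
  | 2 => arrayOf G.color
  | 3 => arrayOf fun e => ((G.edge e).1 : ℕ)
  | 4 => arrayOf fun e => ((G.edge e).2 : ℕ)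
  | _ => fun _ => 0

/-- The initial memory for a bounded parity game with costs: as for parity games, and array `5`
holds the costs (`0` or `1`) of the edges. -/
def BndCostGame.input {n m : ℕ} (G : BndCostGame n m) : Store
  | 5 => arrayOf fun e => (G.cost e).toNat
  | a => G.toParityGame.input a

/-- The final memory `s` holds a solution of the parity game `G`: array `6` tells for each vertex
which player wins from it, and array `7` gives for each vertex a successor, such that these choices
at the vertices of Player `i` are a uniform positional winning strategy for Player `i`. -/
def ParityGame.IsSolution {n m : ℕ} (G : ParityGame n m) (s : Store) : Prop :=
  ∃ (win : Fin n → Fin 2) (nxt : Fin n → Fin n),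
    (∀ v : Fin n, s 6 v = win v) ∧
    (∀ v : Fin n, s 7 v = nxt v) ∧
    ∀ i, G.arena.winningRegion (parity G.color) i = {v | win v = i} ∧
      G.arena.IsWinningFrom (parity G.color) i (positional nxt)
        (G.arena.winningRegion (parity G.color) i)

/-- The final memory `s` holds a solution of the bounded parity game with costs `G`: array `6`
tells for each vertex which player wins from it, cell `0` of array `8` holds the size `k` of a
memory structure whose initialization function is in array `9` and whose update function is in
array `10`, and array `7` holds a next-move function, such that these moves at the vertices of
Player `i` are a uniform finite-state winning strategy for Player `i`. The values for vertex `v`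
and memory state `q` are at index `q * n + v`. The memory has at most one state more than there are
odd colors. -/
def BndCostGame.IsSolution {n m : ℕ} (G : BndCostGame n m) (s : Store) : Prop :=
  ∃ (win : Fin n → Fin 2) (k : ℕ) (𝓜 : MemoryStructure (Fin n) (Fin k))
    (nxt : Fin n → Fin k → Fin n),
    (∀ v : Fin n, s 6 v = win v) ∧
    s 8 0 = k ∧
    (∀ v : Fin n, s 9 v = 𝓜.init v) ∧
    (∀ (q : Fin k) (v : Fin n), s 10 (q * n + v) = 𝓜.upd q v) ∧
    (∀ (q : Fin k) (v : Fin n), s 7 (q * n + v) = nxt v q) ∧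
    k ≤ G.numOddColors + 1 ∧
    ∀ i, G.arena.winningRegion (bndCostParity G.color G.Cst) i = {v | win v = i} ∧
      G.arena.IsWinningFrom (bndCostParity G.color G.Cst) i (𝓜.strategy nxt)
        (G.arena.winningRegion (bndCostParity G.color G.Cst) i)

/-- The program `P` solves every parity game with `n` vertices, `m` edges and `d` colors within
`f n m d` steps. -/
def SolvesParityGames (P : Prog) (f : ℕ → ℕ → ℕ → ℕ) : Prop :=
  ∀ (n m : ℕ) (G : ParityGame n m),
    ∃ t s, Exec P G.input t s ∧ t ≤ f n m G.numColors ∧ G.IsSolution s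

/-- The program `P` solves every bounded parity game with costs with `n` vertices, `m` edges and
`d` colors within `f n m d` steps. -/
def SolvesBndCostGames (P : Prog) (f : ℕ → ℕ → ℕ → ℕ) : Prop :=
  ∀ (n m : ℕ) (G : BndCostGame n m),
    ∃ t s, Exec P G.input t s ∧ t ≤ f n m G.numColors ∧ G.IsSolution s

end CostGames

/-! A bounded parity game with costs is solved by solving two parity games.

Consider the condition without a bound on the costs (`CostCond`). If infinitely often no request is
open, then all requests are answered. Otherwise some request is never answered, and Player 0 wins
iff there are finitely many increments and the parity condition holds (`TracksOpen.costCond_iff`).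
Once a memory records the largest open request, this is a parity condition: an even color `top` when
nothing is open, the odd color `bad` below it after an increment, the original color otherwise
(`TracksOpen.parityCond_productColor`). The bound then comes for free. If a finite-state strategy
allowed too costly an infix with a request always open, then two of its increments would share
vertex and memory state, and repeating the cycle between them would give a consistent but lost play
(`infixCost_le_of_finite_memory`).

The difficulty is to fit this into `d` copies of the graph and `d + 2` colors, although increments
are marked by additional detour vertices. Colors are first compressed into an interval from `b ≤ 1`
to `D`, of length at most `d` if there are vertices, which preserves the condition
(`IsParity.bndCostParity_eq`). The copies of a vertex `v` are its levels in this interval. Level `2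
* q` stands for the open request `2 * q - 1`, and level `2 * q - 1` is the detour leading there
after an increment. The state without open request uses level `c v`, which is then even and
otherwise free, since the color `2 * q` answers the request `2 * q - 1`. Only one state has no
level: if `D` is odd, an open request of color `D` would need level `D + 1`. That request can never
be answered, so the state is never left, and the rest of the play is a parity game of its own
(`product₁`, on the levels `D` and `D - 1`). Its winners are coded in the colors of sinks at level
`D` of the second game (`product₂`). Positional strategies for both games combine to a finite-state
strategy (`Leveling.isWinningFrom_next`). Since this works for both players on complementary sets,
these sets are the winning regions (`Arena.winningRegion_eq`).

It remains to program the reduction. All tables are filled in time linear in `(d + 2) * (n + m +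
1)`, without multiplication or sorting, and the given program runs twice on disjoint renamed arrays
(`Exec.rename`). The linear part is absorbed by `T`, which is positive and at least linear. -/

namespace CostGames

/-! ### Reasoning about programs -/

/-- The number of steps, up to the numbers of iterations of the loops. -/
def Prog.work : Prog → ℕ
  | skip => 1
  | assign _ i e => i.cost + e.cost + 1
  | seq p q => p.work + q.work
  | ite c p q => c.cost + (p.work + q.work)
  | loop c p => c.cost + p.work + 10

/-- Started in `s`, the program `p` halts within `b` steps in a memory that satisfies `R`. -/
def Runs (p : Prog) (s : Store) (b : ℕ) (R : Store → Prop) : Prop :=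
  ∃ t s', Exec p s t s' ∧ t ≤ b ∧ R s'

theorem Runs.mono {p : Prog} {s : Store} {b b' : ℕ} {R R' : Store → Prop} (h : Runs p s b R)
    (hb : b ≤ b') (hR : ∀ s', R s' → R' s') : Runs p s b' R' := by
  obtain ⟨t, s', he, ht, hs⟩ := h
  exact ⟨t, s', he, ht.trans hb, hR _ hs⟩

theorem Runs.seq {p q : Prog} {s : Store} {b b' : ℕ} {R R' : Store → Prop}
    (h : Runs p s b R) (h' : ∀ s', R s' → Runs q s' b' R') :
    Runs (Prog.seq p q) s (b + b') R' := by
  obtain ⟨t, s', he, ht, hs⟩ := h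
  obtain ⟨t', s'', he', ht', hs'⟩ := h' s' hs
  exact ⟨t + t', s'', he.seq he', add_le_add ht ht', hs'⟩

/-- `p` halts within linearly many steps in `B`, in a memory that satisfies `R`. -/
def Linear (B : ℕ) (p : Prog) (s : Store) (R : Store → Prop) : Prop :=
  Runs p s (p.work * (B + 1)) R

theorem Linear.mono {B : ℕ} {p : Prog} {s : Store} {R R' : Store → Prop} (h : Linear B p s R)
    (hR : ∀ s', R s' → R' s') : Linear B p s R' :=
  Runs.mono h le_rfl hR

theorem Linear.seq {B : ℕ} {p q : Prog} {s : Store} {R R' : Store → Prop}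
    (h : Linear B p s R) (h' : ∀ s', R s' → Linear B q s' R') :
    Linear B (Prog.seq p q) s R' :=
  (Runs.seq h h').mono (by simp only [Prog.work]; rw [add_mul]) fun _ h => h

theorem Exec.one_le {p : Prog} {s s' : Store} {t : ℕ} (h : Exec p s t s') : 1 ≤ t := by
  have hc : ∀ e : Expr, 1 ≤ e.cost := by intro e; cases e <;> simp [Expr.cost]
  induction h with
  | skip => exact le_rfl
  | assign => omega
  | seq _ _ _ _ => omega
  | ite_true _ _ _ => omega
  | ite_false _ _ _ => omega
  | loop_done _ => exact hc _
  | loop_step _ _ _ _ _ => omega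

theorem Store.write_apply (s : Store) (a i x a' i' : ℕ) :
    s.write a i x a' i' = if a' = a ∧ i' = i then x else s a' i' := by
  unfold Store.write
  by_cases h : a' = a
  · subst h; by_cases h' : i' = i
    · subst h'; simp
    · simp [h']
  · simp [h]

theorem Store.write_of_ne (s : Store) {a i x a' : ℕ} (h : a' ≠ a) : s.write a i x a' = s a' := by
  unfold Store.write; simp [h]

/-- Expressions with case distinctions. -/
inductive Cases where
  | leaf (e : Expr)
  | node (c : Expr) (l r : Cases)

namespace Cases

def eval (s : Store) : Cases → ℕ
  | leaf e => e.eval s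
  | node c l r => if c.eval s ≠ 0 then l.eval s else r.eval s

/-- Writing the value of an expression with case distinctions to a cell. -/
def assign (a : ℕ) (i : Expr) : Cases → Prog
  | leaf e => Prog.assign a i e
  | node c l r => Prog.ite c (l.assign a i) (r.assign a i)

theorem exec_assign (a : ℕ) (i : Expr) (e : Cases) (s : Store) :
    ∃ t, Exec (e.assign a i) s t (s.write a (i.eval s) (e.eval s)) ∧ t ≤ (e.assign a i).work := by
  induction e with
  | leaf e => exact ⟨_, Exec.assign a i e s, le_rfl⟩
  | node c l r ihl ihr =>
    by_cases h : c.eval s ≠ 0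
    · obtain ⟨t, ht, hb⟩ := ihl
      refine ⟨c.cost + t, ?_, by simp only [assign, Prog.work]; omega⟩
      simp only [eval, if_pos h]
      exact Exec.ite_true h ht
    · obtain ⟨t, ht, hb⟩ := ihr
      refine ⟨c.cost + t, ?_, by simp only [assign, Prog.work]; omega⟩
      simp only [eval, if_neg h]
      exact Exec.ite_false (not_not.1 h) ht

end Cases

/-- The loop variable. -/
abbrev loopVar : Expr := Expr.get 11 (Expr.const 0)

/-- `body` is executed for all values of the loop variable below `N`. -/
def forLoop (N : Expr) (body : Prog) : Prog :=
  Prog.seq (Prog.assign 11 (Expr.const 0) (Expr.const 0))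
    (Prog.loop (Expr.sub N loopVar)
      (Prog.seq body (Prog.assign 11 (Expr.const 0) (Expr.add loopVar (Expr.const 1)))))

/-- The invariant `I i` holds whenever the loop variable is about to be tested with value `i`. The
body has to run within `body.work`, without the factor `B + 1`, so each pass takes constant time and
the loop is linear. -/
theorem linear_forLoop {B : ℕ} {N : Expr} {body : Prog} {s : Store} (n : ℕ) (hn : n ≤ B) (I : ℕ → Store → Prop)
    (h0 : I 0 (s.write 11 0 0))
    (hN : ∀ i ≤ n, ∀ s, I i s → s 11 0 = i ∧ N.eval s = n)
    (hb : ∀ i < n, ∀ s, I i s →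
      Runs body s body.work fun s' => I (i + 1) (s'.write 11 0 (s' 11 0 + 1))) :
    Linear B (forLoop N body) s (I n) := by
  -- Induction on the number `k` of remaining passes. Besides the body and the evaluation of `N`, a
  -- pass takes 3 steps for the test and 6 for the increment.
  have key : ∀ k i s, i + k = n → I i s →
      Runs (Prog.loop (Expr.sub N loopVar)
        (Prog.seq body (Prog.assign 11 (Expr.const 0) (Expr.add loopVar (Expr.const 1))))) s
        ((body.work + N.cost + 9) * k + N.cost + 3) (I n) := by
    intro k
    induction k with
    | zero =>
      intro i s hi hI
      obtain ⟨h1, h2⟩ := hN i (by omega) s hI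
      refine ⟨_, s, Exec.loop_done ?_, ?_, by simpa [← hi] using hI⟩
      · simp only [Expr.eval, h1, h2]; omega
      · simp [Expr.cost]
    | succ k ih =>
      intro i s hi hI
      obtain ⟨h1, h2⟩ := hN i (by omega) s hI
      obtain ⟨t, s', he, ht, hI'⟩ := hb i (by omega) s hI
      obtain ⟨t', s'', he', ht', hI''⟩ := ih (i + 1) _ (by omega) hI'
      refine ⟨_, s'', Exec.loop_step ?_ (he.seq (Exec.assign 11 (Expr.const 0)
        (Expr.add loopVar (Expr.const 1)) s')) he', ?_, hI''⟩
      · simp only [Expr.eval, h1, h2]; omega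
      · simp only [Expr.cost]; rw [Nat.mul_succ]; omega
  obtain ⟨t, s', he, ht, hI⟩ := key n 0 _ (by omega) h0
  refine ⟨_, s', (Exec.assign 11 (Expr.const 0) (Expr.const 0) s).seq he, ?_, hI⟩
  have h1 : (forLoop N body).work = body.work + N.cost + 22 := by
    simp only [forLoop, Prog.work, Expr.cost]; omega
  have h2 : (body.work + N.cost + 22) * (n + 1) ≤ (body.work + N.cost + 22) * (B + 1) :=
    Nat.mul_le_mul_left _ (by omega)
  have h3 : (body.work + N.cost + 22) * (n + 1) =
      (body.work + N.cost + 9) * n + 13 * n + (body.work + N.cost + 22) := by ring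
  rw [h1]
  simp only [Expr.cost]
  omega

/-- Cell `x` of array `a` is set to the value of `e`, for all `x` below `N` in increasing order. -/
def fill (a : ℕ) (N : Expr) (e : Cases) : Prog := forLoop N (e.assign a loopVar)

/-- When cell `j` is computed, the cells before it already hold the values of `f`. Recursively
defined tables, such as running sums and wrapping counters, are therefore covered. -/
theorem linear_fill {B a : ℕ} {N : Expr} {e : Cases} {s : Store} (n : ℕ) (hB : n ≤ B)
    (f : ℕ → ℕ) (ha : a ≠ 11)
    (hN : ∀ st : Store, (∀ b, b ≠ a → b ≠ 11 → st b = s b) → N.eval st = n)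
    (he : ∀ j < n, ∀ st : Store, st 11 0 = j → (∀ b, b ≠ a → b ≠ 11 → st b = s b) →
      (∀ i < j, st a i = f i) → (∀ i, j ≤ i → st a i = s a i) → e.eval st = f j) :
    Linear B (fill a N e) s fun s' =>
      (∀ b, b ≠ a → b ≠ 11 → s' b = s b) ∧ (∀ i < n, s' a i = f i) ∧
        ∀ i, n ≤ i → s' a i = s a i := by
  refine (linear_forLoop n hB (fun j st => st 11 0 = j ∧
    (∀ b, b ≠ a → b ≠ 11 → st b = s b) ∧ (∀ i < j, st a i = f i) ∧
      ∀ i, j ≤ i → st a i = s a i) ?_ ?_ ?_).mono fun s' h => h.2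
  · refine ⟨by simp [Store.write_apply], fun b _ hb => Store.write_of_ne _ hb, by simp, ?_⟩
    intro i _
    rw [Store.write_of_ne _ ha]
  · rintro i - st ⟨h1, h2, -⟩
    exact ⟨h1, hN st h2⟩
  · rintro j hj st ⟨h1, h2, h3, h4⟩
    obtain ⟨t, ht, hb⟩ := e.exec_assign a loopVar st
    refine ⟨t, _, ht, hb, ?_⟩
    have hl : loopVar.eval st = j := by simp [Expr.eval, h1]
    rw [hl, he j hj st h1 h2 h3 h4]
    refine ⟨by simp [Store.write_apply, ha.symm, h1], ?_, ?_, ?_⟩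
    · intro b hb hb'
      rw [Store.write_of_ne _ hb', Store.write_of_ne _ hb, h2 b hb hb']
    · intro i hi
      rw [Store.write_of_ne _ ha, Store.write_apply]
      split_ifs with h
      · rw [h.2]
      · exact h3 i (by omega)
    · intro i hi
      rw [Store.write_of_ne _ ha, Store.write_apply, if_neg (by omega)]
      exact h4 i (by omega)

/-- For all `x` below `N` in increasing order, cell `i` of array `a` is set to `e`, where `i` and
`e` may depend on `x`. -/
def scatter (a : ℕ) (N i e : Expr) : Prog := forLoop N (Prog.assign a i e)

/-- Several `j` may write to the same cell, so the final content is only known to come from some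
`j'` with the same address. This suffices to choose representatives, one vertex for each color or
one outgoing edge for each vertex. -/
theorem linear_scatter {B a : ℕ} {N i e : Expr} {s : Store} (n : ℕ) (hB : n ≤ B) (f g : ℕ → ℕ) (ha : a ≠ 11)
    (hN : ∀ st : Store, (∀ b, b ≠ a → b ≠ 11 → st b = s b) → N.eval st = n)
    (he : ∀ j < n, ∀ st : Store, st 11 0 = j → (∀ b, b ≠ a → b ≠ 11 → st b = s b) →
      i.eval st = f j ∧ e.eval st = g j) :
    Linear B (scatter a N i e) s fun s' =>
      (∀ b, b ≠ a → b ≠ 11 → s' b = s b) ∧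
        (∀ j < n, ∃ j' < n, f j' = f j ∧ s' a (f j) = g j') ∧
          ∀ k, (∀ j < n, f j ≠ k) → s' a k = s a k := by
  refine (linear_forLoop n hB (fun j st => st 11 0 = j ∧
    (∀ b, b ≠ a → b ≠ 11 → st b = s b) ∧
      (∀ k < j, ∃ k' < j, f k' = f k ∧ st a (f k) = g k') ∧
        ∀ k, (∀ i < j, f i ≠ k) → st a k = s a k) ?_ ?_ ?_).mono fun s' h => h.2
  · exact ⟨by simp [Store.write_apply], fun b _ hb => Store.write_of_ne _ hb, by simp,
      fun k _ => by rw [Store.write_of_ne _ ha]⟩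
  · rintro i - st ⟨h1, h2, -⟩
    exact ⟨h1, hN st h2⟩
  · rintro j hj st ⟨h1, h2, h3, h4⟩
    refine ⟨_, _, Exec.assign a i e st, le_rfl, ?_⟩
    obtain ⟨hi, hg⟩ := he j hj st h1 h2
    rw [hi, hg]
    refine ⟨by simp [Store.write_apply, ha.symm, h1], ?_, ?_, ?_⟩
    · intro b hb hb'
      rw [Store.write_of_ne _ hb', Store.write_of_ne _ hb, h2 b hb hb']
    · intro k hk
      rw [Store.write_of_ne _ ha, Store.write_apply]
      by_cases hkj : f k = f j
      · exact ⟨j, by omega, hkj.symm, by simp [hkj]⟩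
      · obtain ⟨k', hk', h5, h6⟩ := h3 k (by
          rcases Nat.lt_succ_iff_lt_or_eq.1 hk with h | h
          · exact h
          · exact absurd (by rw [h]) hkj)
        exact ⟨k', by omega, h5, by simp [hkj, h6]⟩
    · intro k hk
      rw [Store.write_of_ne _ ha, Store.write_apply, if_neg fun h => hk j (by omega) h.2.symm]
      exact h4 k fun i hi => hk i (by omega)

/-- Incrementing cell `0` of array `k`. -/
def increment (k : ℕ) : Prog :=
  Prog.assign k (Expr.const 0) (Expr.add (Expr.get k (Expr.const 0)) (Expr.const 1))

/-- For all `x` below `N` that satisfy `c`, the values of `e` and `e'` are appended to the lists in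
the arrays `a` and `a'`, whose common length is in cell `0` of array `k`. -/
def collect (a a' k : ℕ) (N c e e' : Expr) : Prog :=
  forLoop N (Prog.ite c
    (Prog.seq (Prog.assign a (Expr.get k (Expr.const 0)) e)
      (Prog.seq (Prog.assign a' (Expr.get k (Expr.const 0)) e') (increment k))) Prog.skip)

theorem getD_append_singleton (l : List ℕ) (x i : ℕ) :
    (l ++ [x]).getD i 0 = if i = l.length then x else l.getD i 0 := by
  split_ifs with h
  · subst h; simp
  · rcases lt_or_gt_of_ne h with h | h
    · rw [List.getD_append _ _ _ _ h]
    · rw [List.getD_eq_default _ _ (by simp; omega), List.getD_eq_default _ _ (by omega)]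

/-- The further store `st'` in `he` is needed because `e'` is evaluated after the value of `e` has
been written. -/
theorem linear_collect {B a a' k : ℕ} {N c e e' : Expr} {s : Store} (n : ℕ) (hB : n ≤ B)
    (p : ℕ → Bool) (f f' : ℕ → ℕ) (hd : [a, a', k, 11].Nodup)
    (hs : ∀ i, s a i = 0) (hs' : ∀ i, s a' i = 0) (hk : s k 0 = 0)
    (hN : ∀ st : Store, (∀ b, b ≠ a → b ≠ a' → b ≠ k → b ≠ 11 → st b = s b) → N.eval st = n)
    (he : ∀ j < n, ∀ st : Store, st 11 0 = j →
      (∀ b, b ≠ a → b ≠ a' → b ≠ k → b ≠ 11 → st b = s b) →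
      (c.eval st ≠ 0 ↔ p j) ∧ (∀ st' : Store, (∀ b, b ≠ a → b ≠ a' → st' b = st b) → p j →
        e.eval st' = f j ∧ e'.eval st' = f' j)) :
    Linear B (collect a a' k N c e e') s fun s' =>
      (∀ b, b ≠ a → b ≠ a' → b ≠ k → b ≠ 11 → s' b = s b) ∧
        s' k 0 = ((List.range n).filter p).length ∧
        (∀ i, s' a i = (((List.range n).filter p).map f).getD i 0) ∧
        ∀ i, s' a' i = (((List.range n).filter p).map f').getD i 0 := by
  simp only [List.nodup_cons, List.mem_cons, List.not_mem_nil, or_false, not_or,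
    not_false_eq_true, List.nodup_nil, and_true] at hd
  obtain ⟨⟨d1, d2, d3⟩, ⟨d4, d5⟩, d6⟩ := hd
  refine (linear_forLoop n hB (fun j st => st 11 0 = j ∧
    (∀ b, b ≠ a → b ≠ a' → b ≠ k → b ≠ 11 → st b = s b) ∧
        st k 0 = ((List.range j).filter p).length ∧
        (∀ i, st a i = (((List.range j).filter p).map f).getD i 0) ∧
        ∀ i, st a' i = (((List.range j).filter p).map f').getD i 0) ?_ ?_ ?_).mono
          fun s' h => h.2
  · refine ⟨by simp [Store.write_apply], fun b _ _ _ hb => Store.write_of_ne _ hb, ?_, ?_, ?_⟩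
    · rw [Store.write_of_ne _ d6]; simpa using hk
    · intro i; rw [Store.write_of_ne _ d3]; simpa using hs i
    · intro i; rw [Store.write_of_ne _ d5]; simpa using hs' i
  · rintro i - st ⟨h1, h2, -⟩
    exact ⟨h1, hN st h2⟩
  · rintro j hj st ⟨h1, h2, h3, h4, h5⟩
    obtain ⟨hc, hev⟩ := he j hj st h1 h2
    by_cases hp : p j
    · have hr : (List.range (j + 1)).filter p = (List.range j).filter p ++ [j] := by
        simp [List.range_succ, hp]
      refine ⟨_, _, Exec.ite_true (hc.2 hp) ((Exec.assign a _ e st).seq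
        ((Exec.assign a' _ e' _).seq (Exec.assign k _ _ _))), ?_, ?_⟩
      · simp only [Prog.work, increment, Expr.cost]; omega
      · have e1 := (hev st (fun _ _ _ => rfl) hp).1
        have e2 := (hev (st.write a (st k 0) (f j))
          (fun b hb _ => Store.write_of_ne _ hb) hp).2
        simp only [Expr.eval, e1, e2, Store.write_of_ne _ (Ne.symm d2),
          Store.write_of_ne _ (Ne.symm d4)]
        rw [hr]
        refine ⟨by simp [Store.write_apply, Ne.symm d6, Ne.symm d5, Ne.symm d3, h1], ?_, ?_, ?_, ?_⟩
        · intro b hb hb' hb'' hb'''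
          rw [Store.write_of_ne _ hb''', Store.write_of_ne _ hb'', Store.write_of_ne _ hb',
            Store.write_of_ne _ hb, h2 b hb hb' hb'' hb''']
        · rw [Store.write_of_ne _ d6]; simp [Store.write_apply, h3]
        · intro i
          rw [Store.write_of_ne _ d3, Store.write_of_ne _ d2, Store.write_of_ne _ d1,
            List.map_append, List.map_singleton, getD_append_singleton, Store.write_apply]
          simp [h3, h4]
        · intro i
          rw [Store.write_of_ne _ d5, Store.write_of_ne _ d4,
            List.map_append, List.map_singleton, getD_append_singleton, Store.write_apply,
            Store.write_of_ne _ (Ne.symm d1)]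
          simp [h3, h5]
    · have hr : (List.range (j + 1)).filter p = (List.range j).filter p := by
        simp [List.range_succ, hp]
      refine ⟨_, st, Exec.ite_false (not_not.1 fun h => hp (hc.1 h)) (Exec.skip st),
        by simp only [Prog.work]; omega, ?_⟩
      rw [hr]
      refine ⟨by simp [Store.write_apply, h1], ?_, ?_, ?_, ?_⟩
      · intro b hb hb' hb'' hb'''
        rw [Store.write_of_ne _ hb''', h2 b hb hb' hb'' hb''']
      · rw [Store.write_of_ne _ d6, h3]
      · intro i; rw [Store.write_of_ne _ d3, h4]
      · intro i; rw [Store.write_of_ne _ d5, h5]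

/-! ### Renaming the arrays of a program -/

def Expr.rename (f : ℕ → ℕ) : Expr → Expr
  | const k => const k
  | get a i => get (f a) (i.rename f)
  | add x y => add (x.rename f) (y.rename f)
  | sub x y => sub (x.rename f) (y.rename f)
  | half x => half (x.rename f)

def Prog.rename (f : ℕ → ℕ) : Prog → Prog
  | skip => skip
  | assign a i e => assign (f a) (i.rename f) (e.rename f)
  | seq p q => seq (p.rename f) (q.rename f)
  | ite c p q => ite (c.rename f) (p.rename f) (q.rename f)
  | loop c p => loop (c.rename f) (p.rename f)

theorem Expr.cost_rename (f : ℕ → ℕ) (e : Expr) : (e.rename f).cost = e.cost := by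
  induction e <;> simp_all [Expr.rename, Expr.cost]

theorem Expr.eval_rename (f : ℕ → ℕ) {s S : Store} (h : ∀ a, S (f a) = s a) (e : Expr) :
    (e.rename f).eval S = e.eval s := by
  induction e <;> simp_all [Expr.rename, Expr.eval]

/-- Injectivity of `f` keeps a write to one array from affecting the image of another. Arrays
outside the range of `f` survive, so the given program can run beside the tables and beside the
results of its own earlier run. -/
theorem Exec.rename {f : ℕ → ℕ} (hf : Function.Injective f) {p : Prog} {s s' : Store} {t : ℕ}
    (h : Exec p s t s') : ∀ S : Store, (∀ a, S (f a) = s a) →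
      ∃ S', Exec (p.rename f) S t S' ∧ (∀ a, S' (f a) = s' a) ∧
        ∀ b, b ∉ Set.range f → S' b = S b := by
  induction h with
  | skip s => exact fun S hS => ⟨S, Exec.skip S, hS, fun _ _ => rfl⟩
  | assign a i e s =>
    intro S hS
    have := Exec.assign (f a) (i.rename f) (e.rename f) S
    rw [Expr.cost_rename, Expr.cost_rename, Expr.eval_rename f hS, Expr.eval_rename f hS] at this
    refine ⟨_, this, ?_, ?_⟩
    · intro b
      by_cases hb : b = a
      · subst hb; simp [Store.write, hS]
      · rw [Store.write_of_ne _ hb, Store.write_of_ne _ (hf.ne hb), hS]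
    · intro b hb
      exact Store.write_of_ne _ fun h => hb ⟨a, h.symm⟩
  | seq _ _ ih ih' =>
    intro S hS
    obtain ⟨S', h1, h2, h3⟩ := ih S hS
    obtain ⟨S'', h4, h5, h6⟩ := ih' S' h2
    exact ⟨S'', h1.seq h4, h5, fun b hb => (h6 b hb).trans (h3 b hb)⟩
  | ite_true hc _ ih =>
    intro S hS
    obtain ⟨S', h1, h2, h3⟩ := ih S hS
    exact ⟨S', Expr.cost_rename f _ ▸ Exec.ite_true (by rwa [Expr.eval_rename f hS]) h1, h2, h3⟩
  | ite_false hc _ ih =>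
    intro S hS
    obtain ⟨S', h1, h2, h3⟩ := ih S hS
    exact ⟨S', Expr.cost_rename f _ ▸ Exec.ite_false (by rwa [Expr.eval_rename f hS]) h1, h2, h3⟩
  | loop_done hc =>
    intro S hS
    exact ⟨S, Expr.cost_rename f _ ▸ Exec.loop_done (by rwa [Expr.eval_rename f hS]), hS,
      fun _ _ => rfl⟩
  | loop_step hc _ _ ih ih' =>
    intro S hS
    obtain ⟨S', h1, h2, h3⟩ := ih S hS
    obtain ⟨S'', h4, h5, h6⟩ := ih' S' h2
    exact ⟨S'', Expr.cost_rename f _ ▸ Exec.loop_step (by rwa [Expr.eval_rename f hS]) h1 h4, h5,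
      fun b hb => (h6 b hb).trans (h3 b hb)⟩

open Filter

/-! ### The parity condition for sequences of colors -/

/-- All but finitely many requests of a sequence of colors are answered. -/
def ParityCond (f : ℕ → ℕ) : Prop := ∀ᶠ k in atTop, ∃ k', k ≤ k' ∧ f k' ∈ answers (f k)

theorem mem_parity_iff {V : Type*} (Ω : V → ℕ) (ρ : ℕ → V) :
    ρ ∈ parity Ω ↔ ParityCond fun k => Ω (ρ k) := Iff.rfl

theorem parityCond_shift (f : ℕ → ℕ) (j : ℕ) :
    ParityCond (fun k => f (j + k)) ↔ ParityCond f := by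
  simp only [ParityCond, eventually_atTop]
  constructor
  · rintro ⟨K, hK⟩
    refine ⟨j + K, fun k hk => ?_⟩
    obtain ⟨k', hk', h⟩ := hK (k - j) (by omega)
    rw [show j + (k - j) = k by omega] at h
    exact ⟨j + k', by omega, h⟩
  · rintro ⟨K, hK⟩
    refine ⟨K, fun k hk => ?_⟩
    obtain ⟨k', hk', h⟩ := hK (j + k) (by omega)
    refine ⟨k' - j, by omega, ?_⟩
    rwa [show j + (k' - j) = k' by omega]

theorem parityCond_congr {f g : ℕ → ℕ} (h : ∀ᶠ k in atTop, f k = g k) :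
    ParityCond f ↔ ParityCond g := by
  obtain ⟨K, hK⟩ := eventually_atTop.1 h
  rw [← parityCond_shift f K, ← parityCond_shift g K]
  have : (fun k => f (K + k)) = fun k => g (K + k) := funext fun k => hK _ (by omega)
  rw [this]

/-- `c` is the limit superior of the sequence `f`. -/
def IsLimsup (f : ℕ → ℕ) (c : ℕ) : Prop := (∃ᶠ k in atTop, f k = c) ∧ ∀ᶠ k in atTop, f k ≤ c

theorem exists_isLimsup {f : ℕ → ℕ} {B : ℕ} (hB : ∀ k, f k ≤ B) : ∃ c, IsLimsup f c := by
  classical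
  have h0 : ∃ᶠ k in atTop, 0 ≤ f k := Frequently.of_forall fun _ => Nat.zero_le _
  set c := Nat.findGreatest (fun c => ∃ᶠ k in atTop, c ≤ f k) B with hc
  have h1 : ∃ᶠ k in atTop, c ≤ f k :=
    Nat.findGreatest_spec (P := fun c => ∃ᶠ k in atTop, c ≤ f k) (Nat.zero_le B) h0
  have h2 : ∀ᶠ k in atTop, f k ≤ c := by
    by_contra h
    have h3 : ∃ᶠ k in atTop, c + 1 ≤ f k := by
      refine Frequently.mono (not_eventually.1 h) fun k hk => ?_
      omega
    have h4 : c + 1 ≤ B := by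
      obtain ⟨k, hk⟩ := h3.exists
      exact hk.trans (hB k)
    have := Nat.le_findGreatest (P := fun c => ∃ᶠ k in atTop, c ≤ f k) h4 h3
    omega
  exact ⟨c, (h1.and_eventually h2).mono fun k hk => le_antisymm hk.2 hk.1, h2⟩

/-- A late request of color `c` can only be answered by `c` itself, as nothing larger occurs any
more. Conversely, an even `c` recurs and answers all late requests. -/
theorem IsLimsup.parityCond_iff {f : ℕ → ℕ} {c : ℕ} (h : IsLimsup f c) :
    ParityCond f ↔ Even c := by
  obtain ⟨h1, h2⟩ := h
  obtain ⟨K, hK⟩ := eventually_atTop.1 h2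
  constructor
  · intro hp
    obtain ⟨K', hK'⟩ := eventually_atTop.1 hp
    obtain ⟨k, hk, hkc⟩ := frequently_atTop.1 h1 (max K K')
    obtain ⟨k', hk', h3, h4⟩ := hK' k ((le_max_right _ _).trans hk)
    have h5 : f k' ≤ c := hK k' (((le_max_left _ _).trans hk).trans hk')
    rw [hkc] at h3
    rwa [le_antisymm h3 h5]
  · intro hc
    refine eventually_atTop.2 ⟨K, fun k hk => ?_⟩
    obtain ⟨k', hk', hkc⟩ := frequently_atTop.1 h1 k
    exact ⟨k', hk', by rw [hkc]; exact hK k hk, by rwa [hkc]⟩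

/-! ### Plays with optional intermediate vertices -/

/-- Steps through positions `(k, false)`, with intermediate positions `(k, true)` where `p k`. -/
def detourStep (p : ℕ → Bool) : ℕ × Bool → ℕ × Bool
  | (k, false) => if p k then (k, true) else (k + 1, false)
  | (k, true) => (k + 1, false)

def detour (p : ℕ → Bool) (i : ℕ) : ℕ × Bool := (detourStep p)^[i] (0, false)

theorem detour_succ (p : ℕ → Bool) (i : ℕ) : detour p (i + 1) = detourStep p (detour p i) :=
  Function.iterate_succ_apply' _ _ _

theorem detour_true {p : ℕ → Bool} {i : ℕ} (h : (detour p i).2 = true) :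
    p (detour p i).1 = true := by
  cases i with
  | zero => simp [detour] at h
  | succ i =>
    rw [detour_succ] at h ⊢
    rcases hx : detour p i with ⟨k, b⟩
    rw [hx] at h
    cases b
    · simp only [detourStep] at h ⊢
      by_cases hp : p k
      · simp [hp]
      · simp [hp] at h
    · simp [detourStep] at h

theorem exists_detour_eq (p : ℕ → Bool) (k : ℕ) : ∃ i, k ≤ i ∧ detour p i = (k, false) := by
  induction k with
  | zero => exact ⟨0, le_rfl, rfl⟩
  | succ k ih =>
    obtain ⟨i, hi, h⟩ := ih
    by_cases hp : p k
    · exact ⟨i + 2, by omega, by rw [detour_succ, detour_succ, h]; simp [detourStep, hp]⟩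
    · exact ⟨i + 1, by omega, by rw [detour_succ, h]; simp [detourStep, hp]⟩

/-- Late positions of the expanded sequence thus come from late positions of the original one. -/
theorem le_two_mul_detour (p : ℕ → Bool) (i : ℕ) :
    i ≤ 2 * (detour p i).1 + (detour p i).2.toNat := by
  induction i with
  | zero => simp
  | succ i ih =>
    rw [detour_succ]
    rcases hx : detour p i with ⟨k, b⟩
    rw [hx] at ih
    cases b
    · by_cases hp : p k <;> simp [detourStep, hp] at ih ⊢ <;> omega
    · simp [detourStep] at ih ⊢; omega

/-- A play is obtained from a sequence `a` of vertices with edges to the vertices `t k`, where `t k`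
is `a (k + 1)` or has `a (k + 1)` as its only successor. -/
theorem exists_play_of_detours {V : Type*} (A : Arena V) (col : V → ℕ) {B : ℕ}
    (hB : ∀ v, col v ≤ B) (i : Fin 2) (σ : V → V) (hσ : A.IsStrategy i (positional σ))
    (a t : ℕ → V) (hat : ∀ k, A.E (a k) (t k))
    (hta : ∀ k, t k ≠ a (k + 1) → ∀ y, A.E (t k) y ↔ y = a (k + 1))
    (hcons : ∀ k, A.owner (a k) = i → σ (a k) = t k) :
    ∃ h : ℕ → V, h 0 = a 0 ∧ A.IsPlay h ∧ A.Consistent i (positional σ) h ∧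
      (h ∈ parity col ↔
        ParityCond fun k => max (col (a k)) (if k = 0 then 0 else col (t (k - 1)))) := by
  classical
  set p : ℕ → Bool := fun k => decide (t k ≠ a (k + 1)) with hp
  set h : ℕ → V := fun j => if (detour p j).2 then t (detour p j).1 else a (detour p j).1 with hh
  have hstep : ∀ j, A.E (h j) (h (j + 1)) ∧ (A.owner (h j) = i → h (j + 1) = σ (h j)) := by
    intro j
    have htr := @detour_true p j
    simp only [hh]
    rw [detour_succ]
    rcases hx : detour p j with ⟨k, b⟩
    rw [hx] at htr
    cases b
    · by_cases hpk : t k = a (k + 1)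
      · have : p k = false := by simp [hp, hpk]
        simp only [detourStep, this]
        simp only [Bool.false_eq_true, if_false]
        exact ⟨hpk ▸ hat k, fun ho => by rw [hcons k ho, hpk]⟩
      · have : p k = true := by simp [hp, hpk]
        simp only [detourStep, this]
        simp only [Bool.false_eq_true, if_false, if_true]
        exact ⟨hat k, fun ho => (hcons k ho).symm⟩
    · have hpk : t k ≠ a (k + 1) := by simpa [hp] using htr rfl
      simp only [detourStep, Bool.false_eq_true, if_false, if_true]
      -- An intermediate vertex has a single successor, so any strategy of its owner moves there.
      exact ⟨(hta k hpk _).2 rfl, fun ho => ((hta k hpk _).1 (hσ [] _ ho)).symm⟩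
  refine ⟨h, by simp [hh, detour], fun j => (hstep j).1, fun j ho => (hstep j).2 ho, ?_⟩
  -- Both conditions are compared through a common limit superior `c`. The maximum pairs `a k` with
  -- the vertex `t (k - 1)` passed before it; without a detour the two coincide.
  obtain ⟨c, hc⟩ := exists_isLimsup (f := fun j => col (h j)) fun j => hB _
  rw [mem_parity_iff, hc.parityCond_iff]
  obtain ⟨hc1, hc2⟩ := hc
  obtain ⟨K, hK⟩ := eventually_atTop.1 hc2
  have ha : ∀ k, K ≤ k → col (a k) ≤ c := by
    intro k hk
    obtain ⟨j, hj, hjk⟩ := exists_detour_eq p k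
    have := hK j (by omega)
    simpa [hh, hjk] using this
  have ht : ∀ k, K ≤ k → col (t k) ≤ c := by
    intro k hk
    by_cases hpk : t k = a (k + 1)
    · rw [hpk]; exact ha _ (by omega)
    · obtain ⟨j, hj, hjk⟩ := exists_detour_eq p k
      have := hK (j + 1) (by omega)
      have hpk' : p k = true := by simp [hp, hpk]
      simpa [hh, detour_succ, hjk, detourStep, hpk'] using this
  refine (IsLimsup.parityCond_iff ⟨?_, ?_⟩).symm
  · refine frequently_atTop.2 fun k₀ => ?_
    obtain ⟨j, hj, hjc⟩ := frequently_atTop.1 hc1 (2 * (k₀ + K + 1) + 1)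
    have h2 := le_two_mul_detour p j
    rcases hx : detour p j with ⟨k, b⟩
    rw [hx] at h2
    cases b
    · have hk : k₀ + K + 1 ≤ k := by simp at h2; omega
      have hc' : col (a k) = c := by simpa [hh, hx] using hjc
      refine ⟨k, by omega, ?_⟩
      rw [if_neg (by omega), hc']
      exact max_eq_left (ht _ (by omega))
    · have hk : k₀ + K + 1 ≤ k := by simp at h2; omega
      have hc' : col (t k) = c := by simpa [hh, hx] using hjc
      refine ⟨k + 1, by omega, ?_⟩
      rw [if_neg (by omega), Nat.add_sub_cancel, hc']
      exact max_eq_right (ha _ (by omega))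
  · refine eventually_atTop.2 ⟨K + 1, fun k hk => ?_⟩
    rw [if_neg (by omega)]
    exact max_le (ha _ (by omega)) (ht _ (by omega))

/-! ### Strategies -/

theorem MemoryStructure.updPlus_append {V M : Type*} (𝓜 : MemoryStructure V M) (w : List V)
    (u v : V) : 𝓜.updPlus (w ++ [u]) v = 𝓜.upd (𝓜.updPlus w u) v := by
  cases w <;> simp [MemoryStructure.updPlus, List.foldl_append]

/-- The memory state at a position of a play. -/
def MemoryStructure.state {V M : Type*} (𝓜 : MemoryStructure V M) (ρ : ℕ → V) : ℕ → M
  | 0 => 𝓜.init (ρ 0)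
  | k + 1 => 𝓜.upd (𝓜.state ρ k) (ρ (k + 1))

theorem MemoryStructure.updPlus_range {V M : Type*} (𝓜 : MemoryStructure V M) (ρ : ℕ → V)
    (k : ℕ) : 𝓜.updPlus ((List.range k).map ρ) (ρ k) = 𝓜.state ρ k := by
  induction k with
  | zero => rfl
  | succ k ih =>
    rw [List.range_succ, List.map_append, List.map_singleton, updPlus_append, ih]; rfl

theorem Arena.exists_consistent {V : Type*} (A : Arena V) (σ : Fin 2 → List V → V → V)
    (hσ : ∀ i, A.IsStrategy i (σ i)) (v : V) :
    ∃ ρ, A.IsPlay ρ ∧ ρ 0 = v ∧ ∀ i, A.Consistent i (σ i) ρ := by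
  -- The recursion carries the history together with the current vertex.
  let S : ℕ → List V × V := fun k => Nat.rec ([], v)
    (fun _ x => (x.1 ++ [x.2], σ (A.owner x.2) x.1 x.2)) k
  have hS : ∀ k, S (k + 1) = ((S k).1 ++ [(S k).2], σ (A.owner (S k).2) (S k).1 (S k).2) :=
    fun _ => rfl
  have hl : ∀ k, (S k).1 = (List.range k).map fun j => (S j).2 := by
    intro k
    induction k with
    | zero => rfl
    | succ k ih =>
      rw [List.range_succ, List.map_append, ← ih, hS]; rfl
  refine ⟨fun k => (S k).2, fun k => ?_, rfl, fun i k ho => ?_⟩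
  · show A.E (S k).2 (S (k + 1)).2
    rw [hS]; exact hσ _ _ _ rfl
  · show (S (k + 1)).2 = _
    rw [hS, ← hl, ← ho]

/-- If the players' regions cover the arena, and both have uniform winning strategies, then these
are the winning regions. -/
theorem Arena.winningRegion_eq {V : Type*} (A : Arena V) (Win : Set (ℕ → V)) (win : V → Fin 2)
    (σ : List V → V → V) (h : ∀ i, A.IsWinningFrom Win i σ {v | win v = i}) (i : Fin 2) :
    A.winningRegion Win i = {v | win v = i} := by
  ext v
  constructor
  · rintro ⟨τ, hτ⟩
    by_contra hv
    have hv' : win v ≠ i := hv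
    -- If `v` were in the other player's region, `τ` could be played against `σ`, and the resulting
    -- play would be won by both players.
    obtain ⟨ρ, hρ, h0, hc⟩ := A.exists_consistent (fun j => if j = i then τ else σ) (by
      intro j
      by_cases hj : j = i
      · subst hj; simpa using hτ.1
      · simpa [hj] using (h j).1) v
    have h1 := hτ.2 ρ hρ h0 (by simpa using hc i)
    have h2 := (h (win v)).2 ρ hρ (by simp [h0]) (by simpa [hv'] using hc (win v))
    unfold WonBy at h1 h2
    rw [h1] at h2
    omega
  · intro hv
    exact ⟨σ, (h i).1, fun ρ hρ h0 => (h i).2 ρ hρ (by rw [Set.mem_singleton_iff.1 h0]; exact hv)⟩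

/-! ### Open requests -/

/-- The update of the memory that keeps track of the largest open request: `0` means that no request
is open, and `q ≠ 0` means that `2 * q - 1` is the largest color of an open request. -/
def openUpd (c q : ℕ) : ℕ :=
  if Odd c then max q ((c + 1) / 2) else if q ≤ c / 2 then 0 else q

/-- The numbers of the largest open requests along a sequence of colors. -/
structure TracksOpen (f m : ℕ → ℕ) : Prop where
  zero : m 0 = openUpd (f 0) 0
  succ : ∀ k, m (k + 1) = openUpd (f (k + 1)) (m k)

theorem mem_answers_iff (c c' : ℕ) : c' ∈ answers c ↔ c ≤ c' ∧ Even c' := Iff.rfl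

/-- Because of this, a product vertex may be addressed by the memory state before or after the visit
of its vertex. -/
theorem openUpd_idem (c q : ℕ) : openUpd c (openUpd c q) = openUpd c q := by
  unfold openUpd; split_ifs <;> omega

/-- As long as the request at `j` is open, nothing can lower the memory below its number: only an
even color resets the memory, and one large enough to do so would be an answer. -/
theorem TracksOpen.le_of_unanswered {f m : ℕ → ℕ} (h : TracksOpen f m) {j : ℕ} (hj : Odd (f j)) :
    ∀ k, j ≤ k → (∀ i, j ≤ i → i ≤ k → f i ∉ answers (f j)) → (f j + 1) / 2 ≤ m k := by
  intro k
  have hupd : ∀ q, (f j + 1) / 2 ≤ openUpd (f j) q := by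
    intro q; unfold openUpd; rw [if_pos hj]; exact le_max_right _ _
  induction k with
  | zero =>
    intro hjk _
    obtain rfl : j = 0 := by omega
    rw [h.zero]; exact hupd _
  | succ k ih =>
    intro hjk hun
    rcases Nat.lt_succ_iff_lt_or_eq.1 (Nat.lt_succ_of_le hjk) with hlt | rfl
    · have h1 := ih (by omega) fun i hi hi' => hun i hi (by omega)
      have h2 := hun (k + 1) hjk le_rfl
      rw [mem_answers_iff] at h2
      rw [h.succ]
      unfold openUpd
      split_ifs with h3 h4
      · exact le_max_of_le_left h1
      · have h5 : Even (f (k + 1)) := Nat.not_odd_iff_even.1 h3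
        have h6 : ¬ f j ≤ f (k + 1) := fun h' => h2 ⟨h', h5⟩
        rw [Nat.odd_iff] at hj
        rw [Nat.even_iff] at h5
        omega
      · exact h1
    · rw [h.succ]; exact hupd _

/-- Conversely, a nonzero memory is witnessed by a request that is still open. -/
theorem TracksOpen.exists_unanswered {f m : ℕ → ℕ} (h : TracksOpen f m) :
    ∀ k, m k ≠ 0 → ∃ j ≤ k, f j + 1 = 2 * m k ∧ ∀ i, j ≤ i → i ≤ k → f i ∉ answers (f j) := by
  have hodd : ∀ k, Odd (f k) → (f k + 1) / 2 = m k → ∃ j ≤ k, f j + 1 = 2 * m k ∧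
      ∀ i, j ≤ i → i ≤ k → f i ∉ answers (f j) := by
    intro k hk hm
    refine ⟨k, le_rfl, by rw [Nat.odd_iff] at hk; omega, fun i hi hi' => ?_⟩
    obtain rfl : i = k := by omega
    rw [mem_answers_iff]
    exact fun hh => (Nat.not_even_iff_odd.2 hk) hh.2
  intro k
  induction k with
  | zero =>
    intro hm
    rw [h.zero] at hm
    unfold openUpd at hm
    split_ifs at hm with h1 h2
    · exact hodd 0 h1 (by rw [h.zero, openUpd, if_pos h1]; omega)
    · omega
    · omega
  | succ k ih =>
    intro hm
    have hs := h.succ k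
    unfold openUpd at hs
    split_ifs at hs with h1 h2
    · rcases le_total (m k) ((f (k + 1) + 1) / 2) with hle | hle
      · exact hodd _ h1 (by omega)
      · obtain ⟨j, hj, hjm, hun⟩ := ih (by rw [Nat.odd_iff] at h1; omega)
        refine ⟨j, by omega, by omega, fun i hi hi' => ?_⟩
        rcases Nat.lt_succ_iff_lt_or_eq.1 (Nat.lt_succ_of_le hi') with hlt | rfl
        · exact hun i hi (by omega)
        · rw [mem_answers_iff]
          exact fun hh => (Nat.not_even_iff_odd.2 h1) hh.2
    · exact absurd hs hm
    · obtain ⟨j, hj, hjm, hun⟩ := ih (by omega)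
      refine ⟨j, by omega, by omega, fun i hi hi' => ?_⟩
      rcases Nat.lt_succ_iff_lt_or_eq.1 (Nat.lt_succ_of_le hi') with hlt | rfl
      · exact hun i hi (by omega)
      · rw [mem_answers_iff]
        rintro ⟨h3, h4⟩
        rw [Nat.even_iff] at h4
        omega

/-- If there are infinitely many increments then all requests are answered, and otherwise almost
all. -/
def CostCond (f : ℕ → ℕ) (inc : ℕ → Prop) : Prop :=
  ((∃ᶠ k in atTop, inc k) → ∀ k, ∃ k', k ≤ k' ∧ f k' ∈ answers (f k)) ∧
    (¬ (∃ᶠ k in atTop, inc k) → ParityCond f)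

theorem TracksOpen.forall_answered {f m : ℕ → ℕ} (h : TracksOpen f m)
    (hm : ∃ᶠ k in atTop, m k = 0) (k : ℕ) : ∃ k', k ≤ k' ∧ f k' ∈ answers (f k) := by
  by_contra hun
  push Not at hun
  have hodd : Odd (f k) := by
    by_contra he
    exact hun k le_rfl ⟨le_rfl, Nat.not_odd_iff_even.1 he⟩
  obtain ⟨k', hk', h0⟩ := frequently_atTop.1 hm k
  have := h.le_of_unanswered hodd k' hk' fun i hi _ => hun i hi
  rw [Nat.odd_iff] at hodd
  omega

/-- While the memory stays away from `0` it can only grow. Being bounded it becomes constant, and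
the open request that witnesses the constant value is never answered. -/
theorem TracksOpen.exists_never_answered {f m : ℕ → ℕ} (h : TracksOpen f m) {B : ℕ}
    (hB : ∀ k, m k ≤ B) (hm : ¬ ∃ᶠ k in atTop, m k = 0) : ∃ k, ∀ k', k ≤ k' → f k' ∉ answers (f k) := by
  obtain ⟨K, hK⟩ := eventually_atTop.1 (not_frequently.1 hm)
  have hmono : ∀ k, K ≤ k → m k ≤ m (k + 1) := by
    intro k hk
    have h1 := hK (k + 1) (by omega)
    have hs := h.succ k
    unfold openUpd at hs
    split_ifs at hs <;> omega
  obtain ⟨c, hc1, hc2⟩ := exists_isLimsup hB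
  obtain ⟨K', hK'⟩ := eventually_atTop.1 hc2
  obtain ⟨k, hk, hkc⟩ := frequently_atTop.1 hc1 (K + K')
  have hconst : ∀ j, m (k + j) = c := by
    intro j
    induction j with
    | zero => exact hkc
    | succ j ih =>
      have h1 := hmono (k + j) (by omega)
      have h2 := hK' (k + j + 1) (by omega)
      rw [← add_assoc]; omega
  obtain ⟨j, hj, hjm, hun⟩ := h.exists_unanswered k (hK k (by omega))
  refine ⟨j, fun i hi => ?_⟩
  by_cases hik : i ≤ k
  · exact hun i hi hik
  · obtain ⟨l, rfl⟩ : ∃ l, i = k + l + 1 := ⟨i - k - 1, by omega⟩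
    have h1 := hconst l
    have h2 := hconst (l + 1)
    have hs := h.succ (k + l)
    have h3 := hK (k + l + 1) (by omega)
    rw [← add_assoc] at h2
    rw [mem_answers_iff]
    rintro ⟨h4, h5⟩
    unfold openUpd at hs
    rw [if_neg (Nat.not_odd_iff_even.2 h5)] at hs
    rw [Nat.even_iff] at h5
    split_ifs at hs <;> omega

theorem TracksOpen.costCond_iff {f m : ℕ → ℕ} (h : TracksOpen f m) {B : ℕ} (hB : ∀ k, m k ≤ B)
    (inc : ℕ → Prop) : CostCond f inc ↔
      (∃ᶠ k in atTop, m k = 0) ∨ (¬ (∃ᶠ k in atTop, inc k) ∧ ParityCond f) := by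
  constructor
  · rintro ⟨h1, h2⟩
    by_cases hm : ∃ᶠ k in atTop, m k = 0
    · exact Or.inl hm
    · have hi : ¬ ∃ᶠ k in atTop, inc k := by
        intro hi
        obtain ⟨k, hk⟩ := h.exists_never_answered hB hm
        obtain ⟨k', hk', h3⟩ := h1 hi k
        exact hk k' hk' h3
      exact Or.inr ⟨hi, h2 hi⟩
  · rintro (hm | ⟨hi, hp⟩)
    · exact ⟨fun _ => h.forall_answered hm, fun _ =>
        Eventually.of_forall (h.forall_answered hm)⟩
    · exact ⟨fun hi' => absurd hi' hi, fun _ => hp⟩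

/-- The sequence of colors of the parity game that corresponds to a play: an even color above all
others if no request is open, an odd color above the remaining ones after an increment and where the
largest color, if it is odd, occurs. -/
noncomputable def productColor (D bad top : ℕ) (f m : ℕ → ℕ) (inc : ℕ → Prop) (k : ℕ) : ℕ :=
  open Classical in
  if m k = 0 then top else if (k ≠ 0 ∧ inc (k - 1)) ∨ (f k = D ∧ Odd D) then bad else f k

/-- The limit superior is `top` if the memory is `0` infinitely often, else `bad` if there are
infinitely many increments. Otherwise the colors eventually are those of `f`, up to replacing an odd
`D` by `bad`. This is harmless, since both are odd and above all other colors that still occur. -/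
theorem TracksOpen.parityCond_productColor {f m : ℕ → ℕ} (h : TracksOpen f m) {B D bad top : ℕ}
    (hB : ∀ k, m k ≤ B) (hD : ∀ k, f k ≤ D) (hbad : Odd bad) (hDbad : D < bad)
    (htop : Even top) (hbt : bad < top) (inc : ℕ → Prop) :
    ParityCond (productColor D bad top f m inc) ↔ CostCond f inc := by
  classical
  rw [h.costCond_iff hB]
  set g := productColor D bad top f m inc with hg
  have hgt : ∀ k, m k = 0 → g k = top := fun k hk => by simp [hg, productColor, hk]
  have hgb : ∀ k, m k ≠ 0 → g k ≤ bad := by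
    intro k hk
    have := hD k
    simp only [hg, productColor, if_neg hk]
    split_ifs <;> omega
  have hgi : ∀ k, m (k + 1) ≠ 0 → inc k → g (k + 1) = bad := by
    intro k hk hi
    simp [hg, productColor, hk, hi]
  by_cases hm : ∃ᶠ k in atTop, m k = 0
  · have : IsLimsup g top := by
      refine ⟨hm.mono hgt, Eventually.of_forall fun k => ?_⟩
      by_cases hk : m k = 0
      · rw [hgt k hk]
      · exact (hgb k hk).trans hbt.le
    simp [hm, this.parityCond_iff, htop]
  have hm' := not_frequently.1 hm
  have hle : ∀ᶠ k in atTop, g k ≤ bad := hm'.mono hgb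
  by_cases hi : ∃ᶠ k in atTop, inc k
  · have : IsLimsup g bad := by
      refine ⟨?_, hle⟩
      obtain ⟨K, hK⟩ := eventually_atTop.1 hm'
      refine frequently_atTop.2 fun k => ?_
      obtain ⟨j, hj, hij⟩ := frequently_atTop.1 hi (k + K)
      exact ⟨j + 1, by omega, hgi j (hK _ (by omega)) hij⟩
    simp [hm, hi, this.parityCond_iff, hbad]
  have hi' : ∀ᶠ k in atTop, ¬ (k ≠ 0 ∧ inc (k - 1)) := by
    obtain ⟨K, hK⟩ := eventually_atTop.1 (not_frequently.1 hi)
    exact eventually_atTop.2 ⟨K + 1, fun k hk hh => hK (k - 1) (by omega) hh.2⟩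
  simp only [hm, hi, not_false_eq_true, true_and, false_or]
  by_cases hDf : (∃ᶠ k in atTop, f k = D) ∧ Odd D
  · have h1 : IsLimsup f D := ⟨hDf.1, Eventually.of_forall hD⟩
    have h2 : IsLimsup g bad := by
      refine ⟨(hDf.1.and_eventually hm').mono fun k hk => ?_, hle⟩
      simp [hg, productColor, hk.2, hk.1, hDf.2]
    rw [h1.parityCond_iff, h2.parityCond_iff, ← Nat.not_odd_iff_even, ← Nat.not_odd_iff_even]
    simp [hbad, hDf.2]
  · have hDf' : ∀ᶠ k in atTop, ¬ (f k = D ∧ Odd D) := by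
      by_cases hDo : Odd D
      · have : ¬ ∃ᶠ k in atTop, f k = D := fun hh => hDf ⟨hh, hDo⟩
        exact (not_frequently.1 this).mono fun k hk hh => hk hh.1
      · exact Eventually.of_forall fun k hh => hDo hh.2
    refine parityCond_congr ?_
    filter_upwards [hm', hi', hDf'] with k h1 h2 h3
    simp only [hg, productColor]
    rw [if_neg h1, if_neg (by tauto)]

/-! ### The bounded cost-parity condition -/

section

variable {V : Type*} (Ω : V → ℕ) (Cst : V → V → EdgeCost) (ρ : ℕ → V)

/-- The edge from position `k` to position `k + 1` is an increment-edge. -/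
def IsInc (k : ℕ) : Prop := Cst (ρ k) (ρ (k + 1)) = EdgeCost.inc

theorem infixCost_eq_card [DecidablePred (IsInc Cst ρ)] (k k' : ℕ) :
    infixCost Cst ρ k k' = ((Finset.Ico k k').filter (IsInc Cst ρ)).card := by
  rw [Finset.card_filter]
  refine Finset.sum_congr rfl fun j _ => ?_
  by_cases h : IsInc Cst ρ j
  · rw [if_pos h, show Cst (ρ j) (ρ (j + 1)) = EdgeCost.inc from h]; rfl
  · rw [if_neg h]
    cases hc : Cst (ρ j) (ρ (j + 1)) with
    | eps => rfl
    | inc => exact absurd hc h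

theorem infixCost_succ_le {k k' : ℕ} (h : k ≤ k') :
    infixCost Cst ρ k (k' + 1) ≤ infixCost Cst ρ k k' + 1 := by
  unfold infixCost
  rw [Finset.sum_Ico_succ_top h]
  have : (Cst (ρ k') (ρ (k' + 1))).toNat ≤ 1 := by
    cases Cst (ρ k') (ρ (k' + 1)) <;> simp [EdgeCost.toNat]
  omega

theorem suffixCost_eq_top_iff (k : ℕ) :
    suffixCost Cst ρ k = ⊤ ↔ ∃ᶠ j in atTop, IsInc Cst ρ j := by
  classical
  constructor
  · intro h
    by_contra hf
    obtain ⟨K, hK⟩ := eventually_atTop.1 (not_frequently.1 hf)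
    have : suffixCost Cst ρ k ≤ K := by
      refine iSup_le fun k' => ?_
      rw [infixCost_eq_card]
      have h1 : (Finset.Ico k k').filter (IsInc Cst ρ) ⊆ Finset.range K := by
        intro j hj
        rw [Finset.mem_filter] at hj
        rw [Finset.mem_range]
        by_contra hjK
        exact hK j (by omega) hj.2
      have h2 := Finset.card_le_card h1
      rw [Finset.card_range] at h2
      exact_mod_cast h2
    rw [h] at this
    exact absurd this (by simp)
  · intro h
    have : ∀ N : ℕ, ∃ k', k ≤ k' ∧ N ≤ infixCost Cst ρ k k' := by
      intro N
      induction N with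
      | zero => exact ⟨k, le_rfl, Nat.zero_le _⟩
      | succ N ih =>
        obtain ⟨k', hk', hN⟩ := ih
        obtain ⟨j, hj, hi⟩ := frequently_atTop.1 h k'
        refine ⟨j + 1, by omega, ?_⟩
        unfold infixCost at hN ⊢
        rw [Finset.sum_Ico_succ_top (by omega), show Cst (ρ j) (ρ (j + 1)) = EdgeCost.inc from hi]
        have h2 := Finset.sum_le_sum_of_subset
          (f := fun j => (Cst (ρ j) (ρ (j + 1))).toNat) (Finset.Ico_subset_Ico_right (a := k) hj)
        have h3 : EdgeCost.inc.toNat = 1 := rfl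
        rw [h3]
        exact Nat.add_le_add_right (hN.trans h2) 1
    refine ENat.eq_top_iff_forall_ge.2 fun N => ?_
    obtain ⟨k', -, h'⟩ := this N
    exact le_iSup_of_le k' (by exact_mod_cast h')

/-- This direction needs no bound and suffices for Player 1, whose winning plays violate even the
weaker condition. -/
theorem costCond_of_mem_bndCostParity (h : ρ ∈ bndCostParity Ω Cst) :
    CostCond (fun k => Ω (ρ k)) (IsInc Cst ρ) := by
  obtain ⟨h1, h2⟩ := h
  constructor
  · intro hi k
    by_contra hk
    exact h2 k ⟨hk, (suffixCost_eq_top_iff Cst ρ k).2 hi⟩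
  · intro _
    refine (eventually_lt_of_limsup_lt h1).mono fun k hk => ?_
    by_contra hun
    have : costOfResponse Ω Cst ρ k = ⊤ := by
      unfold costOfResponse
      rw [sInf_eq_top]
      rintro c ⟨k', hk', ha, -⟩
      exact absurd ⟨k', hk', ha⟩ hun
    rw [this] at hk
    exact absurd hk (by simp)

/-- Up to the position before its first answer, an odd request keeps the memory nonzero, so that
this infix costs at most `N`. The edge into the answer adds at most `1`. -/
theorem mem_bndCostParity_of_costCond {m : ℕ → ℕ} (hm : TracksOpen (fun k => Ω (ρ k)) m) (N : ℕ)
    (h : CostCond (fun k => Ω (ρ k)) (IsInc Cst ρ))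
    (hN : ∀ k k', (∀ j, k ≤ j → j ≤ k' → m j ≠ 0) → infixCost Cst ρ k k' ≤ N) :
    ρ ∈ bndCostParity Ω Cst := by
  classical
  constructor
  · have h1 : ∀ᶠ k in atTop, Answered Ω ρ k := by
      by_cases hi : ∃ᶠ k in atTop, IsInc Cst ρ k
      · exact Eventually.of_forall (h.1 hi)
      · exact h.2 hi
    have h2 : ∀ᶠ k in atTop, costOfResponse Ω Cst ρ k ≤ ((N + 1 : ℕ) : ℕ∞) := by
      refine h1.mono fun k hk => ?_
      have hk' : ∃ k', k ≤ k' ∧ Ω (ρ k') ∈ answers (Ω (ρ k)) := hk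
      obtain ⟨h3, h4⟩ := Nat.find_spec hk'
      have h5 : ∀ j, j < Nat.find hk' → ¬ (k ≤ j ∧ Ω (ρ j) ∈ answers (Ω (ρ k))) :=
        fun j hj => Nat.find_min hk' hj
      set k' := Nat.find hk'
      have hle : costOfResponse Ω Cst ρ k ≤ (infixCost Cst ρ k k' : ℕ∞) :=
        sInf_le ⟨k', h3, h4, rfl⟩
      refine hle.trans ?_
      rcases Nat.eq_or_lt_of_le h3 with h6 | h6
      · rw [← h6]; simp [infixCost]
      · obtain ⟨l, hl⟩ : ∃ l, k' = l + 1 := ⟨k' - 1, by omega⟩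
        rw [hl]
        have hodd : Odd (Ω (ρ k)) := by
          by_contra he
          exact h5 k h6 ⟨le_rfl, le_rfl, Nat.not_odd_iff_even.1 he⟩
        have h7 := hN k l fun j hj hj' h0 => by
          have := hm.le_of_unanswered hodd j hj fun i hi hi' ha =>
            h5 i (by omega) ⟨hi, ha⟩
          rw [Nat.odd_iff] at hodd
          omega
        have h8 := infixCost_succ_le Cst ρ (k := k) (k' := l) (by omega)
        exact_mod_cast h8.trans (Nat.add_le_add_right h7 1)
    exact lt_of_le_of_lt (limsup_le_of_le (by isBoundedDefault) h2) (ENat.natCast_lt_top _)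
  · rintro k ⟨h1, h2⟩
    exact h1 (h.1 ((suffixCost_eq_top_iff Cst ρ k).1 h2) k)

/-- The bounded cost-parity condition only depends on which colors are odd and on the order between
odd and even colors. -/
theorem bndCostParity_congr {Ω' : V → ℕ} (hpar : ∀ v, Odd (Ω v) ↔ Odd (Ω' v))
    (hord : ∀ v w, Odd (Ω v) → ¬ Odd (Ω w) → (Ω v ≤ Ω w ↔ Ω' v ≤ Ω' w)) :
    bndCostParity Ω Cst = bndCostParity Ω' Cst := by
  have hans : ∀ v w, Odd (Ω v) → (Ω w ∈ answers (Ω v) ↔ Ω' w ∈ answers (Ω' v)) := by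
    intro v w hv
    simp only [mem_answers_iff, ← Nat.not_odd_iff_even, ← hpar w]
    exact ⟨fun hh => ⟨(hord v w hv hh.2).1 hh.1, hh.2⟩,
      fun hh => ⟨(hord v w hv hh.2).2 hh.1, hh.2⟩⟩
  have h1 : costOfResponse Ω Cst = costOfResponse Ω' Cst := by
    funext ρ k
    by_cases hk : Odd (Ω (ρ k))
    · unfold costOfResponse
      simp only [hans _ _ hk]
    -- An even request is its own answer, at cost `0`, whatever the coloring.
    · have hz : ∀ Ω : V → ℕ, Even (Ω (ρ k)) → costOfResponse Ω Cst ρ k = 0 := by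
        intro Ω he
        refine le_antisymm (sInf_le ⟨k, le_rfl, ⟨le_rfl, he⟩, by simp [infixCost]⟩) bot_le
      rw [hz Ω (Nat.not_odd_iff_even.1 hk),
        hz Ω' (Nat.not_odd_iff_even.1 fun hh => hk ((hpar _).2 hh))]
  have h2 : Answered Ω = Answered Ω' := by
    funext ρ k
    by_cases hk : Odd (Ω (ρ k))
    · unfold Answered
      simp only [hans _ _ hk]
    · have hz : ∀ Ω : V → ℕ, Even (Ω (ρ k)) → (Answered Ω ρ k ↔ True) := by
        intro Ω he
        exact iff_true_intro ⟨k, le_rfl, le_rfl, he⟩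
      rw [hz Ω (Nat.not_odd_iff_even.1 hk),
        hz Ω' (Nat.not_odd_iff_even.1 fun hh => hk ((hpar _).2 hh))]
  unfold bndCostParity
  rw [h1, h2]

end

/-- If no play that is consistent with a finite-state strategy has infinitely many increments but
only finitely often a memory state in `S`, then the costs of the infixes that avoid `S` are
bounded. -/
theorem infixCost_le_of_finite_memory {V M : Type*} [Fintype V] [Fintype M] (A : Arena V)
    (Cst : V → V → EdgeCost) (𝓜 : MemoryStructure V M) (nxt : V → M → V) (S : Set M) (i : Fin 2)
    (v : V)
    (H : ∀ ρ, A.IsPlay ρ → ρ 0 = v → A.Consistent i (𝓜.strategy nxt) ρ →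
      (∃ᶠ k in atTop, IsInc Cst ρ k) → ∃ᶠ k in atTop, 𝓜.state ρ k ∈ S)
    {ρ : ℕ → V} (hρ : A.IsPlay ρ) (h0 : ρ 0 = v) (hc : A.Consistent i (𝓜.strategy nxt) ρ)
    (k k' : ℕ) (hS : ∀ j, k ≤ j → j ≤ k' → 𝓜.state ρ j ∉ S) :
    infixCost Cst ρ k k' ≤ Fintype.card (V × M) := by
  classical
  by_contra hlt
  rw [not_le, infixCost_eq_card, ← Finset.card_univ] at hlt
  -- There are more increments in the infix than pairs of a vertex and a memory state.
  obtain ⟨x, hx, y, hy, hxy, hst⟩ := Finset.exists_ne_map_eq_of_card_lt_of_maps_to hlt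
    (f := fun j => (ρ j, 𝓜.state ρ j)) fun _ _ => Finset.mem_univ _
  wlog hlt' : x < y generalizing x y
  · exact this y hy x hx hxy.symm hst.symm (by omega)
  simp only [Finset.mem_filter, Finset.mem_Ico] at hx hy
  simp only [Prod.mk.injEq] at hst
  -- The pumped play follows `ρ` up to `y` and then repeats the cycle from `x` to `y` for ever. It
  -- is again a consistent play because vertex and memory state agree at `x` and `y`.
  set μ : ℕ → ℕ := fun t => if t < y then t else x + (t - x) % (y - x) with hμ
  have hμ0 : μ 0 = 0 := by simp [hμ]; omega
  have hμs : ∀ t, μ (t + 1) = μ t + 1 ∨ (μ t + 1 = y ∧ μ (t + 1) = x) := by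
    intro t
    simp only [hμ]
    by_cases h1 : t + 1 < y
    · left; rw [if_pos h1, if_pos (by omega)]
    · rw [if_neg h1]
      by_cases h2 : t < y
      · right; rw [if_pos h2]
        have : t + 1 - x = y - x := by omega
        rw [this, Nat.mod_self]; omega
      · rw [if_neg h2]
        have h3 : t + 1 - x = (t - x) + 1 := by omega
        have h4 : (t - x) % (y - x) < y - x := Nat.mod_lt _ (by omega)
        have h5 := Nat.add_mod (t - x) 1 (y - x)
        rw [h3]
        by_cases h6 : (t - x) % (y - x) + 1 = y - x
        · right
          refine ⟨by omega, ?_⟩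
          rw [← Nat.mod_add_mod, h6, Nat.mod_self]; rfl
        · left
          rw [← Nat.mod_add_mod, Nat.mod_eq_of_lt (by omega)]; omega
  have hμρ : ∀ t, ρ (μ (t + 1)) = ρ (μ t + 1) ∧ 𝓜.state ρ (μ (t + 1)) = 𝓜.state ρ (μ t + 1) := by
    intro t
    rcases hμs t with h1 | ⟨h1, h2⟩
    · rw [h1]; exact ⟨rfl, rfl⟩
    · rw [h1, h2]; exact hst
  have hstate : ∀ t, 𝓜.state (fun t => ρ (μ t)) t = 𝓜.state ρ (μ t) := by
    intro t
    induction t with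
    | zero => rw [hμ0]; simp [MemoryStructure.state, hμ0]
    | succ t ih =>
      rw [(hμρ t).2, MemoryStructure.state, MemoryStructure.state, ih, (hμρ t).1]
  have hfr := H (fun t => ρ (μ t)) (fun t => by
      show A.E (ρ (μ t)) (ρ (μ (t + 1)))
      rw [(hμρ t).1]; exact hρ _)
    (by rw [hμ0, h0]) (fun t ho => by
      have h1 := hc (μ t) ho
      unfold MemoryStructure.strategy at h1 ⊢
      rw [MemoryStructure.updPlus_range] at h1
      rw [𝓜.updPlus_range (fun t => ρ (μ t)), hstate]
      show ρ (μ (t + 1)) = _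
      rw [(hμρ t).1, h1])
    (by
      refine frequently_atTop.2 fun t => ?_
      have h1 : μ (x + (y - x) * (t + 1)) = x := by
        simp only [hμ]
        rw [if_neg (by nlinarith [Nat.sub_add_cancel hlt'.le]), Nat.add_sub_cancel_left,
          Nat.mul_mod_right, add_zero]
      refine ⟨x + (y - x) * (t + 1), ?_, ?_⟩
      · have h3 : 1 * (t + 1) ≤ (y - x) * (t + 1) := Nat.mul_le_mul_right _ (by omega)
        omega
      · show Cst (ρ (μ _)) (ρ (μ (_ + 1))) = _
        rw [(hμρ _).1, h1]
        exact hx.2)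
  -- From `y` on, the pumped play only uses positions between `x` and `y`, where the memory avoids
  -- `S`.
  obtain ⟨t, ht, hm⟩ := frequently_atTop.1 hfr y
  rw [hstate] at hm
  have h1 : x ≤ μ t ∧ μ t < y := by
    simp only [hμ]
    rw [if_neg (by omega)]
    have h4 : (t - x) % (y - x) < y - x := Nat.mod_lt _ (by omega)
    omega
  exact hS (μ t) (by omega) (by omega) hm

/-! ### Product games with one copy of the vertices for each of `l` levels -/

instance : DecidableEq EdgeCost
  | EdgeCost.eps, EdgeCost.eps => isTrue rfl
  | EdgeCost.inc, EdgeCost.inc => isTrue rfl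
  | EdgeCost.eps, EdgeCost.inc => isFalse EdgeCost.noConfusion
  | EdgeCost.inc, EdgeCost.eps => isFalse EdgeCost.noConfusion

theorem BndCostGame.Cst_edge {n m : ℕ} (G : BndCostGame n m) (e : Fin m) :
    G.Cst (G.edge e).1 (G.edge e).2 = G.cost e := by
  have h : ∃ e', G.edge e' = ((G.edge e).1, (G.edge e).2) := ⟨e, rfl⟩
  unfold BndCostGame.Cst
  rw [dif_pos h]
  exact congrArg G.cost (G.edge_injective h.choose_spec)

/-- A product of a game with memory: a copy `y` of a vertex has either a memory state `q`, with
`kind y = q + 1`, and copies of the outgoing edges, or `kind y = 0` and a single edge to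
`link y`. -/
structure Product {n m : ℕ} (G : BndCostGame n m) (l : ℕ) where
  kind : Fin (l * n) → ℕ
  link : Fin (l * n) → Fin (l * n)
  tgt : EdgeCost → ℕ → Fin n → Fin (l * n)
  color : Fin (l * n) → ℕ
  modNat_tgt : ∀ κ q v, (tgt κ q v).modNat = v
  out : Fin n → Fin m
  edge_out : ∀ v, (G.edge (out v)).1 = v

namespace Product

variable {n m : ℕ} {G : BndCostGame n m} {l : ℕ} (H : Product G l)

def source (G : BndCostGame n m) (x : Fin (l * m)) : Fin (l * n) :=
  finProdFinEquiv (x.divNat, (G.edge x.modNat).1)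

def target (x : Fin (l * m)) : Fin (l * n) :=
  if H.kind (source G x) = 0 then H.link (source G x)
  else H.tgt (G.cost x.modNat) (H.kind (source G x) - 1) (G.edge x.modNat).2

/-- Possible edges are indexed by a level and an edge of `G`, which bounds their number by `l * m`.
A copy with a single edge keeps only the index given by `out`. -/
def valid (x : Fin (l * m)) : Bool :=
  decide (H.kind (source G x) ≠ 0 ∨ H.out (G.edge x.modNat).1 = x.modNat)

def candidates : List (Fin (l * m)) := (List.finRange (l * m)).filter H.valid

theorem divNat_finProdFinEquiv {a b : ℕ} (x : Fin a) (y : Fin b) :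
    (finProdFinEquiv (x, y)).divNat = x :=
  congrArg Prod.fst (finProdFinEquiv.symm_apply_apply (x, y))

theorem modNat_finProdFinEquiv {a b : ℕ} (x : Fin a) (y : Fin b) :
    (finProdFinEquiv (x, y)).modNat = y :=
  congrArg Prod.snd (finProdFinEquiv.symm_apply_apply (x, y))

theorem eq_of_divNat_eq_of_modNat_eq {a b : ℕ} {x y : Fin (a * b)} (h : x.divNat = y.divNat)
    (h' : x.modNat = y.modNat) : x = y :=
  finProdFinEquiv.symm.injective (Prod.ext h h')

theorem divNat_source (x : Fin (l * m)) : (source G x).divNat = x.divNat :=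
  divNat_finProdFinEquiv _ _

theorem modNat_source (x : Fin (l * m)) : (source G x).modNat = (G.edge x.modNat).1 :=
  modNat_finProdFinEquiv _ _

theorem exists_candidate (y : Fin (l * n)) (e : Fin m) (he : (G.edge e).1 = y.modNat)
    (h : H.kind y ≠ 0 ∨ H.out y.modNat = e) :
    ∃ x ∈ H.candidates, source G x = y ∧ x.modNat = e := by
  have hs : source G (finProdFinEquiv (y.divNat, e)) = y :=
    eq_of_divNat_eq_of_modNat_eq (by rw [divNat_source, divNat_finProdFinEquiv])
      (by rw [modNat_source, modNat_finProdFinEquiv, he])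
  refine ⟨finProdFinEquiv (y.divNat, e), ?_, hs, modNat_finProdFinEquiv _ _⟩
  rw [candidates, List.mem_filter]
  refine ⟨List.mem_finRange _, ?_⟩
  rw [valid, hs, modNat_finProdFinEquiv, he]
  simpa using h

/-- From a copy with memory state, different edges lead to copies of different vertices, by
`modNat_tgt`. From any other copy only one index is left. -/
theorem nodup_candidates : (H.candidates.map fun x => (source G x, H.target x)).Nodup := by
  refine List.Nodup.map_on ?_ ((List.nodup_finRange _).filter _)
  intro x hx x' hx' h
  rw [candidates, List.mem_filter, valid, decide_eq_true_eq] at hx hx'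
  simp only [Prod.mk.injEq] at h
  obtain ⟨h1, h2⟩ := h
  refine eq_of_divNat_eq_of_modNat_eq (by rw [← divNat_source, h1, divNat_source]) ?_
  have h3 : (G.edge x.modNat).1 = (G.edge x'.modNat).1 := by
    rw [← modNat_source, h1, modNat_source]
  by_cases hk : H.kind (source G x) = 0
  · have hk' : H.kind (source G x') = 0 := h1 ▸ hk
    have h4 := hx.2.resolve_left (not_not.2 hk)
    have h5 := hx'.2.resolve_left (not_not.2 hk')
    rw [← h4, ← h5, h3]
  · have hk' : ¬ H.kind (source G x') = 0 := h1 ▸ hk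
    rw [target, target, if_neg hk, if_neg hk'] at h2
    have h4 := congrArg Fin.modNat h2
    rw [H.modNat_tgt, H.modNat_tgt] at h4
    exact G.edge_injective (Prod.ext h3 h4)

/-- The product as a parity game. -/
def game : ParityGame (l * n) H.candidates.length where
  owner y := G.owner y.modNat
  color := H.color
  edge i := (source G (H.candidates.get i), H.target (H.candidates.get i))
  edge_injective := by
    intro i j hij
    have := H.nodup_candidates
    rw [List.nodup_iff_injective_get] at this
    have h1 := @this (i.cast (by simp)) (j.cast (by simp)) (by simpa using hij)
    simpa [Fin.ext_iff] using h1
  total y := by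
    obtain ⟨x, hx, hs, -⟩ := H.exists_candidate y (H.out y.modNat) (H.edge_out _) (Or.inr rfl)
    obtain ⟨i, hi⟩ := List.get_of_mem hx
    exact ⟨i, by rw [hi, hs]⟩

theorem length_candidates_le : H.candidates.length ≤ l * m := by
  refine (List.length_filter_le _ _).trans ?_
  simp

theorem game_E_iff (y y' : Fin (l * n)) : H.game.arena.E y y' ↔
    (H.kind y ≠ 0 ∧ ∃ v, G.arena.E y.modNat v ∧
      y' = H.tgt (G.Cst y.modNat v) (H.kind y - 1) v) ∨ (H.kind y = 0 ∧ y' = H.link y) := by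
  constructor
  · rintro ⟨i, hi⟩
    have hi' : (source G (H.candidates.get i), H.target (H.candidates.get i)) = (y, y') := hi
    generalize H.candidates.get i = x at hi'
    rw [Prod.mk.injEq] at hi'
    obtain ⟨h1, h2⟩ := hi'
    by_cases hk : H.kind y = 0
    · exact Or.inr ⟨hk, by rw [← h2, target, h1, if_pos hk]⟩
    · refine Or.inl ⟨hk, (G.edge x.modNat).2, ⟨x.modNat, ?_⟩, ?_⟩
      · rw [← h1, modNat_source]
      · rw [← h2, target, h1, if_neg hk, ← h1, modNat_source, G.Cst_edge]
  · have key : ∀ x ∈ H.candidates, H.game.arena.E (source G x) (H.target x) := by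
      intro x hx
      obtain ⟨i, hi⟩ := List.get_of_mem hx
      exact ⟨i, by rw [← hi]; rfl⟩
    rintro (⟨hk, v, ⟨e, he⟩, hy⟩ | ⟨hk, hy⟩)
    · obtain ⟨x, hx, hs, hxe⟩ := H.exists_candidate y e (by rw [he]) (Or.inl hk)
      have := key x hx
      rw [target, hs, if_neg hk, hxe, ← G.Cst_edge, he] at this
      rwa [hy]
    · obtain ⟨x, hx, hs, -⟩ := H.exists_candidate y (H.out y.modNat) (H.edge_out _) (Or.inr rfl)
      have := key x hx
      rw [target, hs, if_pos hk] at this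
      rwa [hy]

end Product

/-! ### The two product games -/

/-- A coloring of the vertices with colors between `b` and `D`. -/
structure Leveling (n : ℕ) where
  c : Fin n → ℕ
  b : ℕ
  D : ℕ
  b_le_one : b ≤ 1
  b_le : ∀ v, b ≤ c v
  le_D : ∀ v, c v ≤ D

namespace Leveling

variable {n : ℕ} (Λ : Leveling n)

def levels : ℕ := Λ.D - Λ.b + 1

/-- The number of the largest possible request. -/
def Q : ℕ := (Λ.D + 1) / 2

def bad : ℕ := 2 * Λ.Q + 1

def top : ℕ := 2 * Λ.Q + 2

/-- The copy of the vertex `v` at a level. -/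
def node (x : ℕ) (v : Fin n) : Fin (Λ.levels * n) :=
  -- The truncation makes level `D + 1` mean level `D`. It places the last memory state in the first
  -- game, and turns level `D` into sinks in the second one when `D` is odd.
  finProdFinEquiv (⟨min x Λ.D - Λ.b, by unfold levels; omega⟩, v)

def level (y : Fin (Λ.levels * n)) : ℕ := y.divNat + Λ.b

theorem modNat_node (x : ℕ) (v : Fin n) : (Λ.node x v).modNat = v :=
  Product.modNat_finProdFinEquiv _ _

theorem level_node {x : ℕ} (v : Fin n) (h : Λ.b ≤ x) (h' : x ≤ Λ.D) :
    Λ.level (Λ.node x v) = x := by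
  unfold level node
  rw [Product.divNat_finProdFinEquiv]
  show min x Λ.D - Λ.b + Λ.b = x
  omega

theorem node_min (x : ℕ) (v : Fin n) : Λ.node (min x Λ.D) v = Λ.node x v := by
  unfold node
  simp

def upd (q : ℕ) (v : Fin n) : ℕ := openUpd (Λ.c v) q

/-- The level at which a vertex is reached from memory state `q`. -/
def mainLevel (q : ℕ) (v : Fin n) : ℕ := if Λ.upd q v = 0 then Λ.c v else 2 * Λ.upd q v

def main (q : ℕ) (v : Fin n) : Fin (Λ.levels * n) := Λ.node (Λ.mainLevel q v) v

theorem upd_upd (q : ℕ) (v : Fin n) : Λ.upd (Λ.upd q v) v = Λ.upd q v := openUpd_idem _ _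

theorem main_upd (q : ℕ) (v : Fin n) : Λ.main (Λ.upd q v) v = Λ.main q v := by
  unfold main mainLevel
  rw [upd_upd]

theorem upd_le {q : ℕ} (hq : q ≤ Λ.Q) (v : Fin n) : Λ.upd q v ≤ Λ.Q := by
  have := Λ.le_D v
  unfold upd openUpd Q at *
  split_ifs <;> omega

theorem upd_Q (hD : Odd Λ.D) (v : Fin n) : Λ.upd Λ.Q v = Λ.Q := by
  have := Λ.le_D v
  rw [Nat.odd_iff] at hD
  unfold upd openUpd Q at *
  split_ifs with h1 h2
  · omega
  · rw [Nat.odd_iff] at h1; omega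
  · rfl

theorem main_eq_node_D (hD : Odd Λ.D) {q : ℕ} {v : Fin n} (h : Λ.upd q v = Λ.Q) :
    Λ.main q v = Λ.node Λ.D v := by
  rw [Nat.odd_iff] at hD
  unfold main mainLevel
  rw [h, if_neg (by unfold Q; omega), ← node_min, ← Λ.node_min Λ.D]
  congr 1
  unfold Q
  omega

variable {m : ℕ}

/-- The product game for plays with an open request that is never answered since its color is the
largest one. -/
def product₁ (G : BndCostGame n m) (out : Fin n → Fin m) (hout : ∀ v, (G.edge (out v)).1 = v) :
    Product G Λ.levels where
  -- Level `D` carries the vertices with the last memory state, level `D - 1` the detours.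
  kind y := if Λ.level y = Λ.D then Λ.Q + 1 else 0
  link y := Λ.node (if Λ.level y + 1 = Λ.D then Λ.D else Λ.level y) y.modNat
  tgt
    | EdgeCost.eps, q, v => Λ.main q v
    -- A vertex of color `D` needs no detour, as it is recolored with `bad` anyway. Any other vertex
    -- satisfies `b ≤ c v < D`, so that level `D - 1` exists.
    | EdgeCost.inc, q, v => if Λ.c v = Λ.D then Λ.main q v else Λ.node (Λ.D - 1) v
  color y := if Λ.level y = Λ.D then if Λ.c y.modNat = Λ.D then Λ.bad else Λ.c y.modNat else Λ.bad
  modNat_tgt := by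
    intro κ q v
    cases κ
    · exact Λ.modNat_node _ _
    · dsimp only
      split_ifs <;> exact Λ.modNat_node _ _
  out := out
  edge_out := hout

/-- The product game for the other plays, where `W` gives the winners of the first game. -/
def product₂ (G : BndCostGame n m) (out : Fin n → Fin m) (hout : ∀ v, (G.edge (out v)).1 = v)
    (W : Fin n → Fin 2) : Product G Λ.levels where
  -- An even level equal to the color of the vertex means that no request is open; a larger even
  -- level means memory state `level / 2`. All other copies get a single edge.
  kind y := if ¬ Odd (Λ.level y) ∧ Λ.c y.modNat ≤ Λ.level y then
    (if Λ.level y = Λ.c y.modNat then 0 else Λ.level y / 2) + 1 else 0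
  link y := Λ.node (if Odd (Λ.level y) then Λ.level y + 1 else Λ.level y) y.modNat
  tgt
    | EdgeCost.eps, q, v => Λ.main q v
    -- An increment need not be marked if no request is open, as `top` exceeds `bad`, nor on the way
    -- into a sink.
    | EdgeCost.inc, q, v => if Λ.upd q v = 0 ∨ Λ.D < 2 * Λ.upd q v then Λ.main q v
      else Λ.node (2 * Λ.upd q v - 1) v
  -- Detours have color `bad`; a sink at an odd level `D` has a color that favors the winner `W` of
  -- the first game.
  color y := if Odd (Λ.level y) then
      if Λ.level y = Λ.D ∧ W y.modNat = 0 then Λ.top else Λ.bad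
    else if Λ.level y = Λ.c y.modNat then Λ.top else Λ.c y.modNat
  modNat_tgt := by
    intro κ q v
    cases κ
    · exact Λ.modNat_node _ _
    · dsimp only
      split_ifs <;> exact Λ.modNat_node _ _
  out := out
  edge_out := hout

theorem odd_bad : Odd Λ.bad := ⟨_, rfl⟩

theorem even_top : Even Λ.top := ⟨Λ.Q + 1, by unfold top; omega⟩

theorem D_lt_bad : Λ.D < Λ.bad := by unfold bad Q; omega

theorem bad_lt_top : Λ.bad < Λ.top := by unfold bad top; omega

variable (G : BndCostGame n m) (out : Fin n → Fin m) (hout : ∀ v, (G.edge (out v)).1 = v)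
  (W : Fin n → Fin 2)

theorem product₁_color_mem (y : Fin (Λ.levels * n)) : (Λ.product₁ G out hout).color y ∈
    Finset.Icc Λ.b Λ.D ∪ {Λ.bad, Λ.top} := by
  have h1 := Λ.b_le y.modNat
  have h2 := Λ.le_D y.modNat
  simp only [product₁, Finset.mem_union, Finset.mem_Icc, Finset.mem_insert, Finset.mem_singleton]
  split_ifs <;> omega

theorem product₂_color_mem (y : Fin (Λ.levels * n)) : (Λ.product₂ G out hout W).color y ∈
    Finset.Icc Λ.b Λ.D ∪ {Λ.bad, Λ.top} := by
  have h1 := Λ.b_le y.modNat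
  have h2 := Λ.le_D y.modNat
  simp only [product₂, Finset.mem_union, Finset.mem_Icc, Finset.mem_insert, Finset.mem_singleton]
  split_ifs <;> omega

theorem le_top_of_mem {x : ℕ} (h : x ∈ Finset.Icc Λ.b Λ.D ∪ {Λ.bad, Λ.top}) : x ≤ Λ.top := by
  have h1 := Λ.D_lt_bad
  have h2 := Λ.bad_lt_top
  simp only [Finset.mem_union, Finset.mem_Icc, Finset.mem_insert, Finset.mem_singleton] at h
  omega

end Leveling

/-! ### Simulation of plays in the two product games, and the combined strategy -/

namespace Leveling

variable {n m : ℕ} (Λ : Leveling n) (G : BndCostGame n m) (out : Fin n → Fin m)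
  (hout : ∀ v, (G.edge (out v)).1 = v) (W : Fin n → Fin 2)

/-- The memory structure that keeps track of the largest open request. -/
def memory : MemoryStructure (Fin n) (Fin (Λ.Q + 1)) where
  init v := ⟨Λ.upd 0 v, Nat.lt_succ_of_le (Λ.upd_le (Nat.zero_le _) v)⟩
  upd q v := ⟨Λ.upd q v, Nat.lt_succ_of_le (Λ.upd_le (Nat.le_of_lt_succ q.2) v)⟩

theorem tracksOpen_memory (ρ : ℕ → Fin n) :
    TracksOpen (fun k => Λ.c (ρ k)) fun k => (Λ.memory.state ρ k : ℕ) :=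
  ⟨rfl, fun _ => rfl⟩

theorem upd_state (ρ : ℕ → Fin n) (k : ℕ) :
    Λ.upd (Λ.memory.state ρ k) (ρ k) = Λ.memory.state ρ k := by
  cases k with
  | zero => exact Λ.upd_upd _ _
  | succ k => exact Λ.upd_upd _ _

theorem state_le (ρ : ℕ → Fin n) (k : ℕ) : (Λ.memory.state ρ k : ℕ) ≤ Λ.Q :=
  Nat.le_of_lt_succ (Λ.memory.state ρ k).2

/-- The next-move function that is obtained from positional strategies in the two games. -/
def next (nxt₁ nxt₂ : Fin (Λ.levels * n) → Fin (Λ.levels * n)) (v : Fin n)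
    (q : Fin (Λ.Q + 1)) : Fin n :=
  -- Updating `q` once more changes nothing along a play, but makes the moves legal for every pair
  -- of a state and a vertex.
  if Λ.D < 2 * Λ.upd q v then (nxt₁ (Λ.main q v)).modNat else (nxt₂ (Λ.main q v)).modNat

/-- This isolates the one memory state that has no level of its own, with `2 * q = D + 1`. -/
theorem eq_Q_iff {q : ℕ} (hq : q ≤ Λ.Q) : Λ.D < 2 * q ↔ Odd Λ.D ∧ q = Λ.Q := by
  rw [Nat.odd_iff]
  unfold Q at *
  omega

theorem kind₁_node_D (v : Fin n) :
    (Λ.product₁ G out hout).kind (Λ.node Λ.D v) = Λ.Q + 1 := by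
  have h1 := Λ.b_le v
  have h2 := Λ.le_D v
  simp only [product₁]
  rw [Λ.level_node v (by omega) le_rfl, if_pos rfl]

theorem E₁_node_D (v : Fin n) (y : Fin (Λ.levels * n)) :
    (Λ.product₁ G out hout).game.arena.E (Λ.node Λ.D v) y ↔
      ∃ v', G.arena.E v v' ∧ y = (Λ.product₁ G out hout).tgt (G.Cst v v') Λ.Q v' := by
  rw [Product.game_E_iff, Λ.kind₁_node_D G out hout, Λ.modNat_node]
  simp

theorem tgt₁ (hD : Odd Λ.D) (κ : EdgeCost) (v : Fin n) :
    (Λ.product₁ G out hout).tgt κ Λ.Q v =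
      if κ = EdgeCost.inc ∧ Λ.c v ≠ Λ.D then Λ.node (Λ.D - 1) v else Λ.node Λ.D v := by
  have hm := Λ.main_eq_node_D hD (Λ.upd_Q hD v)
  cases κ
  · simp [product₁, hm]
  · by_cases h : Λ.c v = Λ.D <;> simp [product₁, hm, h]

theorem E₁_detour (hD : Odd Λ.D) (κ : EdgeCost) (v : Fin n)
    (h : (Λ.product₁ G out hout).tgt κ Λ.Q v ≠ Λ.node Λ.D v) (y : Fin (Λ.levels * n)) :
    (Λ.product₁ G out hout).game.arena.E ((Λ.product₁ G out hout).tgt κ Λ.Q v) y ↔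
      y = Λ.node Λ.D v := by
  have h1 := Λ.b_le v
  have h2 := Λ.le_D v
  rw [Λ.tgt₁ G out hout hD] at h ⊢
  split_ifs at h ⊢ with h3
  · have hl : Λ.level (Λ.node (Λ.D - 1) v) = Λ.D - 1 := Λ.level_node v (by omega) (by omega)
    have hk : (Λ.product₁ G out hout).kind (Λ.node (Λ.D - 1) v) = 0 := by
      simp only [product₁]; rw [hl, if_neg (by omega)]
    rw [Product.game_E_iff, hk]
    simp only [product₁]
    rw [hl, if_pos (by omega), modNat_node]
    simp
  · exact absurd rfl h

theorem color₁_node_D (v : Fin n) : (Λ.product₁ G out hout).color (Λ.node Λ.D v) =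
    if Λ.c v = Λ.D then Λ.bad else Λ.c v := by
  have h1 := Λ.b_le v
  have h2 := Λ.le_D v
  simp only [product₁]
  rw [Λ.level_node v (by omega) le_rfl, if_pos rfl, modNat_node]

/-- The maximum over a vertex and the detour in front of it is the `productColor` in the last memory
state. -/
theorem color₁_tgt (hD : Odd Λ.D) (κ : EdgeCost) (v : Fin n) :
    max ((Λ.product₁ G out hout).color (Λ.node Λ.D v))
      ((Λ.product₁ G out hout).color ((Λ.product₁ G out hout).tgt κ Λ.Q v)) =
      if κ = EdgeCost.inc ∨ Λ.c v = Λ.D then Λ.bad else Λ.c v := by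
  have h1 := Λ.b_le v
  have h2 := Λ.le_D v
  have h3 := Λ.D_lt_bad
  rw [Λ.tgt₁ G out hout hD]
  by_cases hc : Λ.c v = Λ.D
  · simp [hc, color₁_node_D]
  · by_cases hκ : κ = EdgeCost.inc
    · have : (Λ.product₁ G out hout).color (Λ.node (Λ.D - 1) v) = Λ.bad := by
        simp only [product₁]
        rw [Λ.level_node v (by omega) (by omega), if_neg (by omega)]
      simp only [hκ, hc, ne_eq, not_false_eq_true, and_self, if_true, true_or, this,
        color₁_node_D, if_false]
      exact max_eq_right (by omega)
    · simp [hc, hκ, color₁_node_D]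

/-- The level determines the memory state: after the update, `q = 0` forces an even color, which is
the level, and `q ≠ 0` forces `c v < 2 * q`. -/
theorem kind₂_main {q : ℕ} {v : Fin n} (hq : Λ.upd q v = q) (hq' : ¬ Λ.D < 2 * q) :
    (Λ.product₂ G out hout W).kind (Λ.main q v) = q + 1 := by
  have h1 := Λ.b_le v
  have h2 := Λ.le_D v
  have h3 := Λ.b_le_one
  simp only [product₂, main, mainLevel]
  rw [modNat_node, hq]
  by_cases h0 : q = 0
  · rw [if_pos h0, Λ.level_node v (by omega) (by omega), if_pos rfl, if_pos, h0]
    refine ⟨fun ho => ?_, le_rfl⟩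
    unfold upd openUpd at hq
    rw [if_pos ho] at hq
    rw [Nat.odd_iff] at ho
    omega
  -- An even color of at least `2 * q` would have answered the request `2 * q - 1`.
  · have hlt : Λ.c v < 2 * q := by
      unfold upd openUpd at hq
      split_ifs at hq with h4 h5
      · rw [Nat.odd_iff] at h4; omega
      · omega
      · omega
    rw [if_neg h0, Λ.level_node v (by omega) (by omega), if_pos, if_neg (by omega)]
    · omega
    · exact ⟨by rw [Nat.odd_iff]; omega, by omega⟩

theorem E₂_main {q : ℕ} {v : Fin n} (hq : Λ.upd q v = q) (hq' : ¬ Λ.D < 2 * q)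
    (y : Fin (Λ.levels * n)) :
    (Λ.product₂ G out hout W).game.arena.E (Λ.main q v) y ↔
      ∃ v', G.arena.E v v' ∧ y = (Λ.product₂ G out hout W).tgt (G.Cst v v') q v' := by
  rw [Product.game_E_iff, Λ.kind₂_main G out hout W hq hq', main, Λ.modNat_node]
  simp

theorem E₂_detour (κ : EdgeCost) (q : ℕ) (v : Fin n)
    (h : (Λ.product₂ G out hout W).tgt κ q v ≠ Λ.main q v) (y : Fin (Λ.levels * n)) :
    (Λ.product₂ G out hout W).game.arena.E ((Λ.product₂ G out hout W).tgt κ q v) y ↔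
      y = Λ.main q v := by
  have h1 := Λ.b_le_one
  have h2 : (Λ.product₂ G out hout W).tgt EdgeCost.eps q v = Λ.main q v := rfl
  have h3 : (Λ.product₂ G out hout W).tgt EdgeCost.inc q v =
    if Λ.upd q v = 0 ∨ Λ.D < 2 * Λ.upd q v then Λ.main q v
      else Λ.node (2 * Λ.upd q v - 1) v := rfl
  cases κ
  · exact absurd h2 h
  rw [h3] at h ⊢
  split_ifs at h ⊢ with h4
  · exact absurd rfl h
  · rw [not_or] at h4
    obtain ⟨h4, h5⟩ := h4
    have hl : Λ.level (Λ.node (2 * Λ.upd q v - 1) v) = 2 * Λ.upd q v - 1 :=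
      Λ.level_node v (by omega) (by omega)
    have ho : Odd (2 * Λ.upd q v - 1) := by rw [Nat.odd_iff]; omega
    have hk : (Λ.product₂ G out hout W).kind (Λ.node (2 * Λ.upd q v - 1) v) = 0 := by
      simp only [product₂]; rw [hl, if_neg (fun hh => hh.1 ho)]
    rw [Product.game_E_iff, hk]
    simp only [product₂]
    rw [hl, if_pos ho, modNat_node, main, mainLevel, if_neg h4,
      show 2 * Λ.upd q v - 1 + 1 = 2 * Λ.upd q v by omega]
    simp

theorem color₂_main {q : ℕ} {v : Fin n} (hq' : ¬ Λ.D < 2 * Λ.upd q v) :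
    (Λ.product₂ G out hout W).color (Λ.main q v) = if Λ.upd q v = 0 then Λ.top else Λ.c v := by
  have h := Λ.kind₂_main G out hout W (Λ.upd_upd q v) hq'
  have h1 := Λ.b_le v
  have h2 := Λ.le_D v
  have h3 := Λ.b_le_one
  rw [Λ.main_upd] at h
  simp only [product₂, main] at h ⊢
  rw [modNat_node] at h ⊢
  have h6 : Λ.level (Λ.node (Λ.mainLevel q v) v) = Λ.mainLevel q v := by
    unfold mainLevel
    split_ifs <;> exact Λ.level_node v (by omega) (by omega)
  rw [h6] at h ⊢
  split_ifs at h with h4 h5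
  · rw [if_neg h4.1, if_pos h5, if_pos (by omega)]
  · rw [if_neg h4.1, if_neg h5, if_neg fun h0 => h5 (by rw [mainLevel, if_pos h0])]

theorem color₂_tgt (κ : EdgeCost) {q : ℕ} {v : Fin n} (hq' : ¬ Λ.D < 2 * Λ.upd q v) :
    max ((Λ.product₂ G out hout W).color (Λ.main q v))
      ((Λ.product₂ G out hout W).color ((Λ.product₂ G out hout W).tgt κ q v)) =
      if Λ.upd q v = 0 then Λ.top else if κ = EdgeCost.inc then Λ.bad else Λ.c v := by
  have hc := Λ.color₂_main G out hout W hq'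
  have h1 := Λ.b_le v
  have h2 := Λ.le_D v
  have h3 := Λ.b_le_one
  have h4 := Λ.D_lt_bad
  have h5 : (Λ.product₂ G out hout W).tgt EdgeCost.eps q v = Λ.main q v := rfl
  have h6 : (Λ.product₂ G out hout W).tgt EdgeCost.inc q v =
    if Λ.upd q v = 0 ∨ Λ.D < 2 * Λ.upd q v then Λ.main q v
      else Λ.node (2 * Λ.upd q v - 1) v := rfl
  cases κ
  · rw [h5, max_self, hc]; simp
  · rw [h6]
    by_cases h0 : Λ.upd q v = 0
    · rw [if_pos (Or.inl h0), max_self, hc, if_pos h0, if_pos h0]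
    · have h7 : (Λ.product₂ G out hout W).color (Λ.node (2 * Λ.upd q v - 1) v) = Λ.bad := by
        simp only [product₂]
        rw [Λ.level_node v (by omega) (by omega), if_pos (by rw [Nat.odd_iff]; omega),
          if_neg (by omega)]
      rw [if_neg (by tauto), hc, if_neg h0, if_neg h0, if_pos rfl, h7]
      exact max_eq_right (by omega)

theorem E₂_sink (hD : Odd Λ.D) (v : Fin n) (y : Fin (Λ.levels * n)) :
    (Λ.product₂ G out hout W).game.arena.E (Λ.node Λ.D v) y ↔ y = Λ.node Λ.D v := by
  have h1 := Λ.b_le v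
  have h2 := Λ.le_D v
  have hl : Λ.level (Λ.node Λ.D v) = Λ.D := Λ.level_node v (by omega) (by omega)
  have hk : (Λ.product₂ G out hout W).kind (Λ.node Λ.D v) = 0 := by
    simp only [product₂]; rw [hl, if_neg (fun hh => hh.1 hD)]
  rw [Product.game_E_iff, hk]
  simp only [product₂]
  rw [hl, if_pos hD, modNat_node, ← Λ.node_min (Λ.D + 1), min_eq_right (by omega)]
  simp

theorem color₂_sink (hD : Odd Λ.D) (v : Fin n) :
    (Λ.product₂ G out hout W).color (Λ.node Λ.D v) = if W v = 0 then Λ.top else Λ.bad := by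
  have h1 := Λ.b_le v
  have h2 := Λ.le_D v
  simp only [product₂]
  rw [Λ.level_node v (by omega) le_rfl, if_pos hD, modNat_node]
  simp

variable {win₁ win₂ : Fin (Λ.levels * n) → Fin 2}
  {nxt₁ nxt₂ : Fin (Λ.levels * n) → Fin (Λ.levels * n)}

/-- The next-move function follows the edges of the first game. -/
theorem nxt₁_eq {i : Fin 2}
    (h₁ : (Λ.product₁ G out hout).game.arena.IsStrategy i (positional nxt₁)) {v : Fin n}
    (hv : G.owner v = i) : ∃ v', G.arena.E v v' ∧ v' = (nxt₁ (Λ.node Λ.D v)).modNat ∧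
      nxt₁ (Λ.node Λ.D v) = (Λ.product₁ G out hout).tgt (G.Cst v v') Λ.Q v' := by
  have h := h₁ [] (Λ.node Λ.D v) (by
    show G.owner (Fin.modNat _) = i
    rwa [modNat_node])
  obtain ⟨v', hE, he⟩ := (Λ.E₁_node_D G out hout v _).1 h
  refine ⟨v', hE, ?_, he⟩
  have he' : nxt₁ (Λ.node Λ.D v) = _ := he
  rw [he', Product.modNat_tgt]

theorem nxt₂_eq {i : Fin 2} {q : ℕ} {v : Fin n} (hq : Λ.upd q v = q) (hq' : ¬ Λ.D < 2 * q)
    (h₂ : (Λ.product₂ G out hout W).game.arena.IsStrategy i (positional nxt₂))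
    (hv : G.owner v = i) : ∃ v', G.arena.E v v' ∧ v' = (nxt₂ (Λ.main q v)).modNat ∧
      nxt₂ (Λ.main q v) = (Λ.product₂ G out hout W).tgt (G.Cst v v') q v' := by
  have h := h₂ [] (Λ.main q v) (by
    show G.owner (Fin.modNat _) = i
    rwa [main, modNat_node])
  obtain ⟨v', hE, he⟩ := (Λ.E₂_main G out hout W hq hq' _).1 h
  refine ⟨v', hE, ?_, he⟩
  have he' : nxt₂ (Λ.main q v) = _ := he
  rw [he', Product.modNat_tgt]

theorem next_isStrategy {i : Fin 2}
    (h₁ : (Λ.product₁ G out hout).game.arena.IsStrategy i (positional nxt₁))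
    (h₂ : (Λ.product₂ G out hout W).game.arena.IsStrategy i (positional nxt₂)) :
    G.arena.IsStrategy i (Λ.memory.strategy (Λ.next nxt₁ nxt₂)) := by
  intro w v hv
  unfold MemoryStructure.strategy
  set q := Λ.memory.updPlus w v
  have hq : Λ.upd q v ≤ Λ.Q := Λ.upd_le (Nat.le_of_lt_succ q.2) v
  unfold next
  split_ifs with h
  · obtain ⟨hD, hQ⟩ := (Λ.eq_Q_iff hq).1 h
    obtain ⟨v', hE, hv', -⟩ := Λ.nxt₁_eq G out hout h₁ hv
    rw [Λ.main_eq_node_D hD hQ, ← hv']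
    exact hE
  · obtain ⟨v', hE, hv', -⟩ := Λ.nxt₂_eq G out hout W (Λ.upd_upd q v) h h₂ hv
    rw [← Λ.main_upd, ← hv']
    exact hE

/-- A play that has reached the last memory state. -/
theorem wonBy_of_last {i : Fin 2} (hD : Odd Λ.D)
    (h₁ : (Λ.product₁ G out hout).game.arena.IsWinningFrom
      (parity (Λ.product₁ G out hout).game.color) i (positional nxt₁) {y | win₁ y = i})
    {ρ : ℕ → Fin n} (hρ : G.arena.IsPlay ρ)
    (hc : G.arena.Consistent i (Λ.memory.strategy (Λ.next nxt₁ nxt₂)) ρ) {K : ℕ}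
    (hK : (Λ.memory.state ρ K : ℕ) = Λ.Q) (hw : win₁ (Λ.node Λ.D (ρ K)) = i) :
    ParityCond (productColor Λ.D Λ.bad Λ.top (fun k => Λ.c (ρ k))
      (fun k => (Λ.memory.state ρ k : ℕ)) (IsInc G.Cst ρ)) ↔ i = 0 := by
  -- The last memory state is never left, so the whole suffix from `K` on can be simulated in the
  -- first game.
  have hm : ∀ k, (Λ.memory.state ρ (K + k) : ℕ) = Λ.Q := by
    intro k
    induction k with
    | zero => exact hK
    | succ k ih =>
      have : (Λ.memory.state ρ (K + (k + 1)) : ℕ) =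
        Λ.upd (Λ.memory.state ρ (K + k)) (ρ (K + k + 1)) := rfl
      rw [this, ih, Λ.upd_Q hD]
  have hlt : Λ.D < 2 * Λ.Q := (Λ.eq_Q_iff le_rfl).2 ⟨hD, rfl⟩
  obtain ⟨h, h0, hp, hcons, hpar⟩ := exists_play_of_detours (Λ.product₁ G out hout).game.arena
    (Λ.product₁ G out hout).game.color (B := Λ.top)
    (fun y => Λ.le_top_of_mem (Λ.product₁_color_mem G out hout y)) i nxt₁ h₁.1
    (fun k => Λ.node Λ.D (ρ (K + k)))
    (fun k => (Λ.product₁ G out hout).tgt (G.Cst (ρ (K + k)) (ρ (K + k + 1))) Λ.Q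
      (ρ (K + k + 1)))
    (fun k => (Λ.E₁_node_D G out hout _ _).2 ⟨_, hρ _, rfl⟩)
    (fun k hk y => Λ.E₁_detour G out hout hD _ _ hk y)
    (fun k ho => by
      have ho' : G.owner (ρ (K + k)) = i := by
        have : G.owner (Fin.modNat (Λ.node Λ.D (ρ (K + k)))) = i := ho
        rwa [modNat_node] at this
      obtain ⟨v', hE, hv', he⟩ := Λ.nxt₁_eq G out hout h₁.1 ho'
      have h3 := hc (K + k) ho'
      unfold MemoryStructure.strategy at h3
      rw [MemoryStructure.updPlus_range] at h3
      unfold next at h3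
      rw [Λ.upd_state, hm, if_pos hlt, Λ.main_eq_node_D hD (Λ.upd_Q hD _), ← hv'] at h3
      rw [he, h3])
  have hwon := h₁.2 h hp (by rw [h0]; exact hw) hcons
  unfold WonBy at hwon
  rw [hpar] at hwon
  rw [← hwon, ← parityCond_shift _ K]
  -- The first position is left out: the simulated play starts without a detour, whereas `ρ` may
  -- enter position `K` by an increment.
  refine parityCond_congr (eventually_atTop.2 ⟨1, fun k hk => ?_⟩)
  obtain ⟨k, rfl⟩ : ∃ j, k = j + 1 := ⟨k - 1, by omega⟩
  rw [if_neg (by omega)]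
  have := Λ.color₁_tgt G out hout hD (G.Cst (ρ (K + k)) (ρ (K + k + 1))) (ρ (K + k + 1))
  refine Eq.trans ?_ this.symm
  have hQ : Λ.Q ≠ 0 := by omega
  simp only [productColor, hm, hQ, if_false]
  rw [← add_assoc, Nat.add_sub_cancel]
  simp [IsInc, hD]

theorem parityCond_of_consistent {i : Fin 2}
    (h₁ : (Λ.product₁ G out hout).game.arena.IsWinningFrom
      (parity (Λ.product₁ G out hout).game.color) i (positional nxt₁) {y | win₁ y = i})
    (h₂ : (Λ.product₂ G out hout fun v => win₁ (Λ.node Λ.D v)).game.arena.IsWinningFrom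
      (parity (Λ.product₂ G out hout fun v => win₁ (Λ.node Λ.D v)).game.color) i
      (positional nxt₂) {y | win₂ y = i})
    {ρ : ℕ → Fin n} (hρ : G.arena.IsPlay ρ) (hw : win₂ (Λ.main 0 (ρ 0)) = i)
    (hc : G.arena.Consistent i (Λ.memory.strategy (Λ.next nxt₁ nxt₂)) ρ) :
    ParityCond (productColor Λ.D Λ.bad Λ.top (fun k => Λ.c (ρ k))
      (fun k => (Λ.memory.state ρ k : ℕ)) (IsInc G.Cst ρ)) ↔ i = 0 := by
  classical
  set W : Fin n → Fin 2 := fun v => win₁ (Λ.node Λ.D v) with hW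
  set m : ℕ → ℕ := fun k => (Λ.memory.state ρ k : ℕ) with hm
  have hupd : ∀ k, Λ.upd (m k) (ρ k) = m k := Λ.upd_state ρ
  have hsucc : ∀ k, m (k + 1) = Λ.upd (m k) (ρ (k + 1)) := fun _ => rfl
  have hmain : ∀ k, Λ.main (m k) (ρ (k + 1)) = Λ.main (m (k + 1)) (ρ (k + 1)) := by
    intro k; rw [hsucc, main_upd]
  have hmain0 : Λ.main 0 (ρ 0) = Λ.main (m 0) (ρ 0) := (Λ.main_upd 0 (ρ 0)).symm
  have hnext : ∀ k, ¬ Λ.D < 2 * m k → G.owner (ρ k) = i →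
      nxt₂ (Λ.main (m k) (ρ k)) =
        (Λ.product₂ G out hout W).tgt (G.Cst (ρ k) (ρ (k + 1))) (m k) (ρ (k + 1)) := by
    intro k hk ho
    obtain ⟨v', hE, hv', he⟩ := Λ.nxt₂_eq G out hout W (hupd k) hk h₂.1 ho
    have h3 := hc k ho
    unfold MemoryStructure.strategy at h3
    rw [MemoryStructure.updPlus_range] at h3
    unfold next at h3
    rw [Λ.upd_state, if_neg hk, ← hv'] at h3
    rw [he, h3]
  have hB := fun y => Λ.le_top_of_mem (Λ.product₂_color_mem G out hout W y)
  have howner : ∀ x v, (Λ.product₂ G out hout W).game.arena.owner (Λ.node x v) = i →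
      G.owner v = i := by
    intro x v ho
    have : G.owner (Fin.modNat (Λ.node x v)) = i := ho
    rwa [modNat_node] at this
  -- If the last memory state is reached, first at `K`, then the play of the second game ends in a
  -- sink, and the first game decides. Otherwise the second game simulates all of `ρ`.
  by_cases hlast : ∃ k, Λ.D < 2 * m k
  · set K := Nat.find hlast with hKdef
    have hK : Λ.D < 2 * m K := Nat.find_spec hlast
    have hmin : ∀ k, k < K → ¬ Λ.D < 2 * m k := fun k hk => Nat.find_min hlast hk
    obtain ⟨hD, hKQ⟩ := (Λ.eq_Q_iff (Λ.state_le ρ K)).1 hK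
    refine Λ.wonBy_of_last G out hout hD h₁ hρ hc hKQ ?_
    have hmK : Λ.main (m K) (ρ K) = Λ.node Λ.D (ρ K) :=
      Λ.main_eq_node_D hD ((hupd K).trans hKQ)
    set a : ℕ → Fin (Λ.levels * n) := fun k =>
      if k < K then Λ.main (m k) (ρ k) else Λ.node Λ.D (ρ K) with ha
    have ha' : ∀ k, k ≤ K → a k = Λ.main (m k) (ρ k) := by
      intro k hk
      simp only [ha]
      rcases Nat.eq_or_lt_of_le hk with rfl | h
      · rw [if_neg (by omega), hmK]
      · rw [if_pos h]
    have ha'' : ∀ k, K ≤ k → a k = Λ.node Λ.D (ρ K) := by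
      intro k hk
      simp only [ha]
      rw [if_neg (by omega)]
    set t : ℕ → Fin (Λ.levels * n) := fun k =>
      if k < K then (Λ.product₂ G out hout W).tgt (G.Cst (ρ k) (ρ (k + 1))) (m k) (ρ (k + 1))
      else Λ.node Λ.D (ρ K) with ht
    have ht' : ∀ k, K ≤ k → t k = Λ.node Λ.D (ρ K) := by
      intro k hk
      simp only [ht]
      rw [if_neg (by omega)]
    obtain ⟨h, h0, hp, hcons, hpar⟩ := exists_play_of_detours
      (Λ.product₂ G out hout W).game.arena (Λ.product₂ G out hout W).game.color hB i nxt₂ h₂.1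
      a t
      (by
        intro k
        by_cases hk : k < K
        · rw [ha' k hk.le]
          simp only [ht, if_pos hk]
          exact (Λ.E₂_main G out hout W (hupd k) (hmin k hk) _).2 ⟨_, hρ k, rfl⟩
        · rw [ha'' k (by omega), ht' k (by omega)]
          exact (Λ.E₂_sink G out hout W hD _ _).2 rfl)
      (by
        intro k hk y
        by_cases hkK : k < K
        · rw [ha' (k + 1) hkK, ← hmain] at hk ⊢
          simp only [ht, if_pos hkK] at hk ⊢
          exact Λ.E₂_detour G out hout W _ _ _ hk y
        · rw [ha'' (k + 1) (by omega), ht' k (by omega)] at hk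
          exact absurd rfl hk)
      (by
        intro k ho
        by_cases hk : k < K
        · rw [ha' k hk.le] at ho ⊢
          rw [hnext k (hmin k hk) (howner _ _ ho)]
          simp only [ht, if_pos hk]
        · rw [ha'' k (by omega)] at ho ⊢
          rw [ht' k (by omega)]
          exact (Λ.E₂_sink G out hout W hD _ _).1 (h₂.1 [] _ ho))
    have hwon := h₂.2 h hp (by rw [h0, ha' 0 (Nat.zero_le _), ← hmain0]; exact hw) hcons
    unfold WonBy at hwon
    rw [hpar] at hwon
    -- After `K` the simulated play stays in one sink, whose color reveals the winner of the first
    -- game from `ρ K`.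
    have hlim : IsLimsup (fun k => max ((Λ.product₂ G out hout W).game.color (a k))
        (if k = 0 then 0 else (Λ.product₂ G out hout W).game.color (t (k - 1))))
        (if W (ρ K) = 0 then Λ.top else Λ.bad) := by
      have : ∀ k ≥ K + 1, max ((Λ.product₂ G out hout W).game.color (a k))
          (if k = 0 then 0 else (Λ.product₂ G out hout W).game.color (t (k - 1))) =
          if W (ρ K) = 0 then Λ.top else Λ.bad := by
        intro k hk
        rw [if_neg (by omega), ha'' k (by omega), ht' (k - 1) (by omega), max_self]
        exact Λ.color₂_sink G out hout W hD (ρ K)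
      have hev := eventually_atTop.2 ⟨K + 1, this⟩
      exact ⟨hev.frequently, hev.mono fun k hk => hk.le⟩
    rw [hlim.parityCond_iff] at hwon
    show W (ρ K) = i
    by_cases h0 : W (ρ K) = 0
    · rw [if_pos h0] at hwon
      rw [h0, hwon.1 Λ.even_top]
    · rw [if_neg h0] at hwon
      have : i ≠ 0 := fun hi => (Nat.not_even_iff_odd.2 Λ.odd_bad) (hwon.2 hi)
      omega
  · push Not at hlast
    have hlast' : ∀ k, ¬ Λ.D < 2 * m k := fun k => not_lt.2 (hlast k)
    obtain ⟨h, h0, hp, hcons, hpar⟩ := exists_play_of_detours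
      (Λ.product₂ G out hout W).game.arena (Λ.product₂ G out hout W).game.color hB i nxt₂ h₂.1
      (fun k => Λ.main (m k) (ρ k))
      (fun k => (Λ.product₂ G out hout W).tgt (G.Cst (ρ k) (ρ (k + 1))) (m k) (ρ (k + 1)))
      (fun k => (Λ.E₂_main G out hout W (hupd k) (hlast' k) _).2 ⟨_, hρ k, rfl⟩)
      (fun k hk y => by
        rw [← hmain] at hk ⊢
        exact Λ.E₂_detour G out hout W _ _ _ hk y)
      (fun k ho => hnext k (hlast' k) (howner _ _ ho))
    have hwon := h₂.2 h hp (by rw [h0, ← hmain0]; exact hw) hcons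
    unfold WonBy at hwon
    rw [hpar] at hwon
    rw [← hwon]
    refine parityCond_congr (eventually_atTop.2 ⟨1, fun k hk => ?_⟩)
    obtain ⟨k, rfl⟩ : ∃ j, k = j + 1 := ⟨k - 1, by omega⟩
    rw [if_neg (by omega), Nat.add_sub_cancel, ← hmain]
    have h4 := Λ.color₂_tgt G out hout W (G.Cst (ρ k) (ρ (k + 1))) (q := m k) (v := ρ (k + 1))
      (hlast' (k + 1))
    refine Eq.trans ?_ h4.symm
    rw [← hsucc]
    simp only [productColor]
    rw [Nat.add_sub_cancel]
    -- A visit to an odd color `D` would have led to the last memory state.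
    have hnD : ¬ (Λ.c (ρ (k + 1)) = Λ.D ∧ Odd Λ.D) := by
      rintro ⟨h5, h6⟩
      have h7 := hlast' (k + 1)
      rw [hsucc] at h7
      unfold upd openUpd at h7
      rw [h5, if_pos h6] at h7
      rw [Nat.odd_iff] at h6
      omega
    simp [hnD, IsInc]

/-- Solutions of the two product games give a solution of the bounded parity game with costs. -/
theorem isWinningFrom_next {i : Fin 2}
    (h₁ : (Λ.product₁ G out hout).game.arena.IsWinningFrom
      (parity (Λ.product₁ G out hout).game.color) i (positional nxt₁) {y | win₁ y = i})
    (h₂ : (Λ.product₂ G out hout fun v => win₁ (Λ.node Λ.D v)).game.arena.IsWinningFrom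
      (parity (Λ.product₂ G out hout fun v => win₁ (Λ.node Λ.D v)).game.color) i
      (positional nxt₂) {y | win₂ y = i}) :
    G.arena.IsWinningFrom (bndCostParity Λ.c G.Cst) i
      (Λ.memory.strategy (Λ.next nxt₁ nxt₂)) {v | win₂ (Λ.main 0 v) = i} := by
  refine ⟨Λ.next_isStrategy G out hout _ h₁.1 h₂.1, ?_⟩
  have key : ∀ ρ, G.arena.IsPlay ρ → win₂ (Λ.main 0 (ρ 0)) = i →
      G.arena.Consistent i (Λ.memory.strategy (Λ.next nxt₁ nxt₂)) ρ →
      (CostCond (fun k => Λ.c (ρ k)) (IsInc G.Cst ρ) ↔ i = 0) := by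
    intro ρ hρ h0 hc
    rw [← Λ.parityCond_of_consistent G out hout h₁ h₂ hρ h0 hc]
    exact ((Λ.tracksOpen_memory ρ).parityCond_productColor (Λ.state_le ρ) (fun k => Λ.le_D _)
      Λ.odd_bad Λ.D_lt_bad Λ.even_top Λ.bad_lt_top _).symm
  intro ρ hρ h0 hc
  constructor
  · intro hmem
    exact (key ρ hρ h0 hc).1 (costCond_of_mem_bndCostParity _ _ _ hmem)
  · intro hi
    refine mem_bndCostParity_of_costCond _ _ _ (Λ.tracksOpen_memory ρ) _
      ((key ρ hρ h0 hc).2 hi) fun k k' hk =>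
        infixCost_le_of_finite_memory G.arena G.Cst Λ.memory (Λ.next nxt₁ nxt₂)
          {q | (q : ℕ) = 0} i (ρ 0) ?_ hρ rfl hc k k' fun j hj hj' => hk j hj hj'
    -- Pumped plays start in the same vertex and follow the same strategy, so they satisfy
    -- `CostCond` too. With infinitely many increments this forces the memory to return to `0`
    -- infinitely often.
    intro ρ' hρ' h0' hc' hinc
    have := (key ρ' hρ' (by rw [h0']; exact h0) hc').2 hi
    rcases ((Λ.tracksOpen_memory ρ').costCond_iff (Λ.state_le ρ') _).1 this with h | h
    · exact h
    · exact absurd hinc h.1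

end Leveling

/-! ### Compressing the colors of a game -/

section

variable {n : ℕ} (col : Fin n → ℕ)

/-- The number of colors below `x`. -/
def rank (x : ℕ) : ℕ := ((Finset.univ.image col).filter (· < x)).card

variable {col}

theorem rank_mono {x y : ℕ} (h : x ≤ y) : rank col x ≤ rank col y :=
  Finset.card_le_card fun z hz => by
    rw [Finset.mem_filter] at hz ⊢
    exact ⟨hz.1, hz.2.trans_le h⟩

theorem rank_lt_rank {v : Fin n} {y : ℕ} (h : col v < y) : rank col (col v) < rank col y := by
  refine Finset.card_lt_card ?_
  rw [Finset.ssubset_iff_of_subset fun z hz => by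
    rw [Finset.mem_filter] at hz ⊢
    exact ⟨hz.1, hz.2.trans h⟩]
  exact ⟨col v, by simp [h], by simp⟩

theorem rank_inj {v w : Fin n} (h : rank col (col v) = rank col (col w)) : col v = col w := by
  rcases lt_trichotomy (col v) (col w) with hlt | heq | hlt
  · exact absurd h (rank_lt_rank hlt).ne
  · exact heq
  · exact absurd h (rank_lt_rank hlt).ne'

theorem rank_lt_card (v : Fin n) : rank col (col v) < (Finset.univ.image col).card := by
  refine Finset.card_lt_card ?_
  rw [Finset.ssubset_iff_of_subset (Finset.filter_subset _ _)]
  exact ⟨col v, by simp, by simp⟩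

theorem exists_rank_eq {i : ℕ} (hi : i < (Finset.univ.image col).card) :
    ∃ v, rank col (col v) = i := by
  have h1 : (Finset.univ.image col).image (rank col) ⊆
      Finset.range (Finset.univ.image col).card := by
    intro j hj
    simp only [Finset.mem_image, Finset.mem_univ, true_and, exists_exists_eq_and] at hj
    obtain ⟨v, rfl⟩ := hj
    exact Finset.mem_range.2 (rank_lt_card v)
  have h2 : ((Finset.univ.image col).image (rank col)).card = (Finset.univ.image col).card := by
    refine Finset.card_image_of_injOn ?_
    intro x hx y hy hxy
    simp only [Finset.coe_image, Finset.coe_univ, Set.image_univ, Set.mem_range] at hx hy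
    obtain ⟨v, rfl⟩ := hx
    obtain ⟨w, rfl⟩ := hy
    exact rank_inj hxy
  have h3 := Finset.eq_of_subset_of_card_le h1 (by rw [h2, Finset.card_range])
  have h4 : i ∈ (Finset.univ.image col).image (rank col) := by
    rw [h3]; exact Finset.mem_range.2 hi
  simpa using h4

theorem rank_eq_card_filter_getD {l : List ℕ} (hl : l.Nodup)
    (hS : l.toFinset = Finset.univ.image col) (x : ℕ) :
    rank col x = ((Finset.range l.length).filter fun i => l.getD i 0 < x).card := by
  unfold rank
  rw [← hS]
  have : l.toFinset.filter (· < x) =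
      ((Finset.range l.length).filter fun i => l.getD i 0 < x).image fun i => l.getD i 0 := by
    ext y
    simp only [Finset.mem_filter, List.mem_toFinset, Finset.mem_image, Finset.mem_range]
    constructor
    · rintro ⟨hy, hyx⟩
      obtain ⟨i, hi, rfl⟩ := List.getElem_of_mem hy
      refine ⟨i, ⟨hi, ?_⟩, ?_⟩ <;> rw [List.getD_eq_getElem _ _ hi]
      exact hyx
    · rintro ⟨i, ⟨hi, hix⟩, rfl⟩
      rw [List.getD_eq_getElem _ _ hi] at hix ⊢
      exact ⟨List.getElem_mem hi, hix⟩
  rw [this]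
  refine Finset.card_image_of_injOn ?_
  intro i hi j hj hij
  simp only [Finset.coe_filter, Finset.mem_range, Set.mem_ofPred_eq] at hi hj
  simp only [List.getD_eq_getElem _ _ hi.1, List.getD_eq_getElem _ _ hj.1] at hij
  exact (List.Nodup.getElem_inj_iff hl).1 hij

end

/-- The smallest non-decreasing sequence with the given parities. -/
def compress (p : ℕ → ℕ) : ℕ → ℕ
  | 0 => p 0
  | i + 1 => if p (i + 1) = compress p i % 2 then compress p i else compress p i + 1

section

variable {p : ℕ → ℕ} (hp : ∀ i, p i ≤ 1)
include hp

theorem compress_mod_two (i : ℕ) : compress p i % 2 = p i := by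
  cases i with
  | zero => have := hp 0; simp only [compress]; omega
  | succ i =>
    have := hp (i + 1)
    simp only [compress]
    split_ifs <;> omega

omit hp in
theorem compress_le_add (i j : ℕ) : compress p i ≤ compress p (i + j) ∧
    compress p (i + j) ≤ compress p i + j := by
  induction j with
  | zero => simp
  | succ j ih =>
    rw [← add_assoc]
    simp only [compress]
    split_ifs <;> omega

omit hp in
theorem compress_mono {i j : ℕ} (h : i ≤ j) : compress p i ≤ compress p j := by
  obtain ⟨k, rfl⟩ := Nat.exists_eq_add_of_le h
  exact (compress_le_add i k).1

/-- The compressed sequence starts at `0` or `1` and grows by steps of `1`, so it attains every odd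
value up to its last one. This bounds the memory by the number of odd colors. -/
theorem half_compress_le (i : ℕ) :
    (compress p i + 1) / 2 ≤ ((Finset.range (i + 1)).filter fun j => p j = 1).card := by
  induction i with
  | zero =>
    have := hp 0
    rw [Finset.range_one, Finset.filter_singleton]
    simp only [compress]
    split_ifs <;> simp <;> omega
  | succ i ih =>
    rw [Finset.range_add_one, Finset.filter_insert]
    have := hp (i + 1)
    have h2 := compress_mod_two hp i
    simp only [compress]
    split_ifs with h3 h4 h4
    · rw [Finset.card_insert_of_notMem (by simp)]; omega
    · exact ih
    · rw [Finset.card_insert_of_notMem (by simp)]; omega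
    · omega

end

/-! ### The leveling given by the compressed colors, and the bounds on its size -/

section

variable {n m : ℕ} (G : BndCostGame n m) (p : ℕ → ℕ)

/-- `p` gives the parities of the colors by their rank. -/
structure IsParity : Prop where
  eq : ∀ v, p (rank G.color (G.color v)) = G.color v % 2
  eq_zero : ∀ i, (∀ v, rank G.color (G.color v) ≠ i) → p i = 0

variable {G p}

theorem IsParity.le_one (hp : IsParity G p) (i : ℕ) : p i ≤ 1 := by
  by_cases h : ∃ v, rank G.color (G.color v) = i
  · obtain ⟨v, rfl⟩ := h
    rw [hp.eq]; omega
  · push Not at h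
    rw [hp.eq_zero i h]; omega

/-- The coloring that is obtained by compressing the colors. -/
def IsParity.leveling (hp : IsParity G p) : Leveling n where
  c v := compress p (rank G.color (G.color v))
  b := compress p 0
  D := compress p (G.numColors - 1)
  b_le_one := hp.le_one 0
  b_le _ := compress_mono (Nat.zero_le _)
  le_D v := compress_mono (Nat.le_sub_one_of_lt (rank_lt_card v))

theorem IsParity.odd_c_iff (hp : IsParity G p) (v : Fin n) :
    Odd (hp.leveling.c v) ↔ Odd (G.color v) := by
  rw [Nat.odd_iff, Nat.odd_iff, ← hp.eq, ← compress_mod_two hp.le_one]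
  rfl

/-- Compression is monotone and only identifies colors of the same parity, so the order between an
odd and an even color is preserved. -/
theorem IsParity.bndCostParity_eq (hp : IsParity G p) :
    bndCostParity G.color G.Cst = bndCostParity hp.leveling.c G.Cst := by
  refine bndCostParity_congr _ _ (fun v => (hp.odd_c_iff v).symm) fun v w hv hw => ?_
  have key : ∀ {v w}, G.color v ≤ G.color w → hp.leveling.c v ≤ hp.leveling.c w :=
    fun h => compress_mono (rank_mono h)
  refine ⟨key, fun h => ?_⟩
  by_contra hlt
  have h1 := key (not_le.1 hlt).le
  have h2 : hp.leveling.c v = hp.leveling.c w := le_antisymm h h1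
  rw [← hp.odd_c_iff] at hv hw
  exact hw (h2 ▸ hv)

theorem numColors_pos (hn : 0 < n) : 0 < G.numColors :=
  Finset.card_pos.2 ⟨G.color ⟨0, hn⟩, by simp⟩

theorem IsParity.levels_le (hp : IsParity G p) (hn : 0 < n) :
    hp.leveling.levels ≤ G.numColors := by
  have h1 := numColors_pos (G := G) hn
  have h2 := (compress_le_add (p := p) 0 (G.numColors - 1)).2
  rw [zero_add] at h2
  show compress p (G.numColors - 1) - compress p 0 + 1 ≤ _
  omega

theorem IsParity.levels_mul_le (hp : IsParity G p) :
    hp.leveling.levels * n ≤ G.numColors * n ∧ hp.leveling.levels * m ≤ G.numColors * m := by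
  rcases Nat.eq_zero_or_pos n with rfl | hn
  · have : m = 0 := by
      by_contra hm
      exact (G.edge ⟨0, by omega⟩).1.elim0
    subst this; simp
  · exact ⟨Nat.mul_le_mul_right _ (hp.levels_le hn), Nat.mul_le_mul_right _ (hp.levels_le hn)⟩

theorem IsParity.Q_le_numOddColors (hp : IsParity G p) : hp.leveling.Q ≤ G.numOddColors := by
  rcases Nat.eq_zero_or_pos n with rfl | hn
  · have h0 : G.numColors = 0 := by simp [ParityGame.numColors]
    have h1 : hp.leveling.D = 0 := by
      show compress p (G.numColors - 1) = 0
      rw [h0]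
      exact hp.eq_zero 0 fun v => v.elim0
    rw [Leveling.Q, h1]; simp
  · have h1 := numColors_pos (G := G) hn
    refine (half_compress_le hp.le_one (G.numColors - 1)).trans ?_
    rw [Nat.sub_add_cancel h1]
    have : (Finset.range G.numColors).filter (fun j => p j = 1) ⊆
        ((Finset.univ.image G.color).filter Odd).image (rank G.color) := by
      intro j hj
      rw [Finset.mem_filter, Finset.mem_range] at hj
      obtain ⟨v, rfl⟩ := exists_rank_eq hj.1
      refine Finset.mem_image_of_mem _ (Finset.mem_filter.2 ⟨by simp, ?_⟩)
      rw [Nat.odd_iff, ← hp.eq, hj.2]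
    exact (Finset.card_le_card this).trans Finset.card_image_le

/-- This includes the empty game, which has one level but no color. The index tables have `d + 1`
blocks for this reason and to hold `Q + 1` memory states. -/
theorem IsParity.levels_le_succ (hp : IsParity G p) : hp.leveling.levels ≤ G.numColors + 1 := by
  have h2 := (compress_le_add (p := p) 0 (G.numColors - 1)).2
  rw [zero_add] at h2
  show compress p (G.numColors - 1) - compress p 0 + 1 ≤ _
  omega

theorem IsParity.Q_le (hp : IsParity G p) : hp.leveling.Q ≤ G.numColors :=
  hp.Q_le_numOddColors.trans (Finset.card_le_card (Finset.filter_subset _ _))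

/-- The number of colors of a product game. -/
theorem IsParity.card_le (hp : IsParity G p) {N : ℕ} (hN : n = 0 → N = 0) (f : Fin N → ℕ)
    (hf : ∀ y, f y ∈ Finset.Icc hp.leveling.b hp.leveling.D ∪
      {hp.leveling.bad, hp.leveling.top}) :
    (Finset.univ.image f).card ≤ G.numColors + 2 := by
  rcases Nat.eq_zero_or_pos n with h0 | hn
  · obtain rfl := hN h0
    simp
  · refine (Finset.card_le_card (Finset.image_subset_iff.2 fun y _ => hf y)).trans ?_
    refine (Finset.card_union_le _ _).trans (add_le_add ?_ Finset.card_le_two)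
    rw [Nat.card_Icc]
    have := hp.levels_le hn
    unfold Leveling.levels at this
    omega

end

/-! ### The program: tables and compressed colors -/

instance (k : ℕ) : OfNat Expr k := ⟨Expr.const k⟩
instance : Add Expr := ⟨Expr.add⟩
instance : Sub Expr := ⟨Expr.sub⟩

namespace Expr

@[simp] theorem eval_zero (s : Store) : (0 : Expr).eval s = 0 := rfl
@[simp] theorem eval_one (s : Store) : (1 : Expr).eval s = 1 := rfl
@[simp] theorem eval_two (s : Store) : (2 : Expr).eval s = 2 := rfl
@[simp] theorem eval_add (s : Store) (x y : Expr) : (x + y).eval s = x.eval s + y.eval s := rfl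
@[simp] theorem eval_sub (s : Store) (x y : Expr) : (x - y).eval s = x.eval s - y.eval s := rfl
@[simp] theorem eval_half (s : Store) (x : Expr) : (half x).eval s = x.eval s / 2 := rfl
@[simp] theorem eval_get (s : Store) (a : ℕ) (i : Expr) : (get a i).eval s = s a (i.eval s) := rfl
@[simp] theorem eval_const (s : Store) (k : ℕ) : (const k).eval s = k := rfl

/-- Not zero iff the values differ. -/
def ne (x y : Expr) : Expr := (x - y) + (y - x)

/-- Not zero iff the values agree. -/
def eq (x y : Expr) : Expr := 1 - ne x y

/-- The parity. -/
def parity (x : Expr) : Expr := x - (half x + half x)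

theorem eval_ne (s : Store) (x y : Expr) : (ne x y).eval s ≠ 0 ↔ x.eval s ≠ y.eval s := by
  simp only [ne, eval_add, eval_sub]; omega

theorem eval_eq (s : Store) (x y : Expr) : (eq x y).eval s ≠ 0 ↔ x.eval s = y.eval s := by
  simp only [eq, ne, eval_add, eval_sub, eval_one]; omega

@[simp] theorem eval_parity (s : Store) (x : Expr) : (parity x).eval s = x.eval s % 2 := by
  simp only [parity, eval_add, eval_sub, eval_half]; omega

end Expr

open CostGames.Expr (get half)

theorem Cases.eval_leaf (s : Store) (e : Expr) : (Cases.leaf e).eval s = e.eval s := rfl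

theorem Cases.eval_node (s : Store) (c : Expr) (l r : Cases) :
    (Cases.node c l r).eval s = if c.eval s ≠ 0 then l.eval s else r.eval s := rfl

theorem linear_fill_fin {B a : ℕ} {N : Expr} {e : Cases} {s : Store} (n : ℕ) (hB : n ≤ B)
    (F : Fin n → ℕ) (ha : a ≠ 11)
    (hN : ∀ st : Store, (∀ b, b ≠ a → b ≠ 11 → st b = s b) → N.eval st = n)
    (he : ∀ y : Fin n, ∀ st : Store, st 11 0 = y → (∀ b, b ≠ a → b ≠ 11 → st b = s b) →
      e.eval st = F y) :
    Linear B (fill a N e) s fun s' =>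
      (∀ b, b ≠ a → b ≠ 11 → s' b = s b) ∧ (∀ y : Fin n, s' a y = F y) ∧
        ((∀ i, s a i = 0) → s' a = arrayOf F) := by
  refine (linear_fill n hB (fun i => if h : i < n then F ⟨i, h⟩ else 0) ha hN ?_).mono ?_
  · intro j hj st h1 h2 _ _
    rw [dif_pos hj]
    exact he ⟨j, hj⟩ st h1 h2
  · rintro s' ⟨h1, h2, h3⟩
    refine ⟨h1, fun y => by rw [h2 y y.2, dif_pos y.2], fun h0 => ?_⟩
    funext i
    unfold arrayOf
    by_cases hi : i < n
    · rw [h2 i hi]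
    · rw [h3 i (by omega), h0, dif_neg hi]

def nE : Expr := get 0 0
def mE : Expr := get 0 1
def dE : Expr := get 15 0
def bE : Expr := get 25 0
def DE : Expr := get 25 (dE - 1)
def QE : Expr := half (DE + 1)
def levelsE : Expr := DE - bE + 1

/-- The list of the colors in array `13`, and their number in array `15`. -/
def listColors : Prog :=
  Prog.seq (scatter 12 nE (get 2 loopVar) loopVar)
    (collect 13 14 15 nE (Expr.eq (get 12 (get 2 loopVar)) loopVar) (get 2 loopVar) 0)

/-- Colors serve as addresses: each color is marked with some vertex that has it, and is listed only
at that vertex. This removes repetitions in linear time, however large the colors are. -/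
theorem linear_listColors {n B : ℕ} (hB : n ≤ B) (col : Fin n → ℕ) {s : Store} (h0 : s 0 0 = n)
    (h2 : ∀ v : Fin n, s 2 v = col v) (h13 : ∀ i, s 13 i = 0) (h14 : ∀ i, s 14 i = 0)
    (h15 : ∀ i, s 15 i = 0) :
    Linear B listColors s fun s' => (∀ b, b < 11 ∨ 15 < b → s' b = s b) ∧
      ∃ l : List ℕ, l.Nodup ∧ l.toFinset = Finset.univ.image col ∧ s' 15 0 = l.length ∧
        ∀ i, s' 13 i = l.getD i 0 := by
  refine Linear.seq (linear_scatter n hB (fun j => s 2 j) (fun j => j) (by decide) ?_ ?_) ?_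
  · intro st hst
    simp [nE, hst, h0]
  · intro j hj st hx hst
    simp [hst, hx]
  rintro s' ⟨hs', h12, -⟩
  refine (linear_collect n hB (fun j => decide (s' 12 (s 2 j) = j)) (fun j => s 2 j) (fun _ => 0)
    (by decide) ?_ ?_ ?_ ?_ ?_).mono ?_
  · intro i; rw [hs' 13 (by decide) (by decide), h13]
  · intro i; rw [hs' 14 (by decide) (by decide), h14]
  · rw [hs' 15 (by decide) (by decide), h15]
  · intro st hst
    simp [nE, hst, hs', h0]
  · intro j hj st hx hst
    refine ⟨?_, fun st' hst' _ => ?_⟩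
    · rw [Expr.eval_eq]
      simp [hst, hx, hs']
    · simp [hst', hst, hx, hs']
  · rintro s'' ⟨h1, h3, h4, -⟩
    refine ⟨?_, ((List.range n).filter fun j => decide (s' 12 (s 2 j) = j)).map fun j => s 2 j,
      ?_, ?_, ?_, h4⟩
    · intro b hb
      rw [h1 b (by omega) (by omega) (by omega) (by omega), hs' b (by omega) (by omega)]
    · refine List.Nodup.map_on ?_ (List.nodup_range.filter _)
      intro j hj j' hj' hjj'
      simp only [List.mem_filter, decide_eq_true_eq] at hj hj'
      rw [← hj.2, ← hj'.2, hjj']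
    · ext y
      simp only [List.mem_toFinset, List.mem_map, List.mem_filter, List.mem_range,
        decide_eq_true_eq, Finset.mem_image, Finset.mem_univ, true_and]
      constructor
      · rintro ⟨j, ⟨hj, -⟩, rfl⟩
        exact ⟨⟨j, hj⟩, (h2 ⟨j, hj⟩).symm⟩
      · rintro ⟨v, rfl⟩
        obtain ⟨j, hj, hjv, hj'⟩ := h12 v v.2
        exact ⟨j, ⟨hj, by rw [hjv, hj']⟩, by rw [hjv, h2]⟩
    · rw [h3, List.length_map]

/-- Multiples of `e`, quotients and remainders. -/
def multiples (a : ℕ) (e : Expr) : Prog :=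
  fill a (dE + 2) (Cases.node loopVar (Cases.leaf (get a (loopVar - 1) + e)) (Cases.leaf 0))

/-- A counter that returns to `0` on reaching the value of `e`. -/
def remainders (a a' : ℕ) (e : Expr) : Prog :=
  fill a (get a' (dE + 1)) (Cases.node loopVar
    (Cases.node (e - (get a (loopVar - 1) + 1)) (Cases.leaf (get a (loopVar - 1) + 1))
      (Cases.leaf 0)) (Cases.leaf 0))

/-- The quotient increases exactly where the remainder, in array `a''`, is `0` again. -/
def quotients (a a' a'' : ℕ) : Prog :=
  fill a (get a' (dE + 1)) (Cases.node loopVar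
    (Cases.node (get a'' loopVar) (Cases.leaf (get a (loopVar - 1)))
      (Cases.leaf (get a (loopVar - 1) + 1))) (Cases.leaf 0))

theorem linear_multiples {B a d k : ℕ} {e : Expr} {s : Store} (hB : d + 2 ≤ B) (ha : a ≠ 11)
    (had : a ≠ 15) (hd : s 15 0 = d)
    (he : ∀ st : Store, (∀ b, b ≠ a → b ≠ 11 → st b = s b) → e.eval st = k) :
    Linear B (multiples a e) s fun s' =>
      (∀ b, b ≠ a → b ≠ 11 → s' b = s b) ∧ ∀ j < d + 2, s' a j = j * k := by
  refine (linear_fill (d + 2) hB (fun j => j * k) ha ?_ ?_).mono fun s' h => ⟨h.1, h.2.1⟩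
  · intro st hst
    simp [dE, hst 15 had.symm (by decide), hd]
  · intro j hj st hx hst hlt _
    cases j with
    | zero => simp [Cases.eval_node, Cases.eval_leaf, hx]
    | succ j =>
      have h1 := hlt j (by omega)
      simp [Cases.eval_node, Cases.eval_leaf, hx, h1, he st hst]
      ring

theorem linear_remainders {B a a' l d k : ℕ} {e : Expr} {s : Store} (hB : l * k ≤ B)
    (ha : a ≠ 11) (had : a ≠ 15) (haa : a' ≠ a) (ha' : a' ≠ 11) (hd : s 15 0 = d)
    (hl : s a' (d + 1) = l * k)
    (he : ∀ st : Store, (∀ b, b ≠ a → b ≠ 11 → st b = s b) → e.eval st = k) :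
    Linear B (remainders a a' e) s fun s' =>
      (∀ b, b ≠ a → b ≠ 11 → s' b = s b) ∧ ∀ j < l * k, s' a j = j % k := by
  refine (linear_fill (l * k) hB (fun j => j % k) ha ?_ ?_).mono fun s' h => ⟨h.1, h.2.1⟩
  · intro st hst
    simp [dE, hst 15 had.symm (by decide), hd, hst a' haa ha', hl]
  · intro j hj st hx hst hlt _
    have hk : 0 < k := Nat.pos_of_ne_zero fun h0 => by subst h0; simp at hj
    cases j with
    | zero => simp [Cases.eval_node, Cases.eval_leaf, hx]
    | succ j =>
      have h1 := hlt j (by omega)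
      have h2 := Nat.mod_lt j hk
      simp only [Cases.eval_node, Cases.eval_leaf, Expr.eval_get, Expr.eval_sub, Expr.eval_add,
        Expr.eval_one, Expr.eval_const, hx, he st hst, Nat.add_sub_cancel, h1]
      rw [if_pos (show j + 1 ≠ 0 by omega)]
      have h4 := Nat.mod_add_mod j k 1
      by_cases h3 : k - (j % k + 1) = 0
      · rw [if_neg (not_not.2 h3), ← h4, show j % k + 1 = k by omega, Nat.mod_self, Expr.eval_zero]
      · rw [if_pos h3, ← h4, Nat.mod_eq_of_lt (show j % k + 1 < k by omega)]

theorem linear_quotients {B a a' a'' l d k : ℕ} {s : Store} (hB : l * k ≤ B)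
    (ha : a ≠ 11) (had : a ≠ 15) (haa : a' ≠ a) (ha' : a' ≠ 11) (haa' : a'' ≠ a) (ha'' : a'' ≠ 11)
    (hd : s 15 0 = d) (hl : s a' (d + 1) = l * k) (hr : ∀ j < l * k, s a'' j = j % k) :
    Linear B (quotients a a' a'') s fun s' =>
      (∀ b, b ≠ a → b ≠ 11 → s' b = s b) ∧ ∀ j < l * k, s' a j = j / k := by
  refine (linear_fill (l * k) hB (fun j => j / k) ha ?_ ?_).mono fun s' h => ⟨h.1, h.2.1⟩
  · intro st hst
    simp [dE, hst 15 had.symm (by decide), hd, hst a' haa ha', hl]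
  · intro j hj st hx hst hlt _
    have hk : 0 < k := Nat.pos_of_ne_zero fun h0 => by subst h0; simp at hj
    cases j with
    | zero => simp [Cases.eval_node, Cases.eval_leaf, hx]
    | succ j =>
      have h1 := hlt j (by omega)
      simp only [Cases.eval_node, Cases.eval_leaf, Expr.eval_get, Expr.eval_sub, Expr.eval_add,
        Expr.eval_one, Expr.eval_const, hx, Nat.add_sub_cancel, h1, hst a'' haa' ha'', hr _ hj]
      rw [if_pos (by omega), Nat.succ_div]
      by_cases h3 : (j + 1) % k = 0
      · rw [if_neg (not_not.2 h3), if_pos (Nat.dvd_of_mod_eq_zero h3)]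
      · rw [if_pos h3, if_neg fun hh => h3 (Nat.mod_eq_zero_of_dvd hh), add_zero]

/-- The tables for the arithmetic of indices. -/
def indexTables : Prog :=
  Prog.seq (multiples 16 nE) <| Prog.seq (multiples 21 mE) <|
  Prog.seq (remainders 17 16 nE) <| Prog.seq (quotients 18 16 17) <|
  Prog.seq (remainders 19 21 mE) (quotients 20 21 19)

/-- The memory holds the tables for the arithmetic of indices. -/
structure IndexTables (n m d : ℕ) (s : Store) : Prop where
  n_eq : s 0 0 = n
  m_eq : s 0 1 = m
  d_eq : s 15 0 = d
  mul_n : ∀ j < d + 2, s 16 j = j * n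
  mul_m : ∀ j < d + 2, s 21 j = j * m
  mod_n : ∀ j < (d + 1) * n, s 17 j = j % n
  div_n : ∀ j < (d + 1) * n, s 18 j = j / n
  mod_m : ∀ j < (d + 1) * m, s 19 j = j % m
  div_m : ∀ j < (d + 1) * m, s 20 j = j / m

theorem linear_indexTables {B n m d : ℕ} {s : Store} (hB : (d + 2) * (n + m + 1) ≤ B)
    (hn : s 0 0 = n) (hm : s 0 1 = m) (hd : s 15 0 = d) :
    Linear B indexTables s fun s' =>
      (∀ b, b < 11 ∨ 21 < b ∨ (11 < b ∧ b < 16) → s' b = s b) ∧ IndexTables n m d s' := by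
  have hB0 : d + 2 ≤ B := le_trans (Nat.le_mul_of_pos_right _ (by omega)) hB
  have hBn : (d + 1) * n ≤ B := le_trans (Nat.mul_le_mul (by omega) (by omega)) hB
  have hBm : (d + 1) * m ≤ B := le_trans (Nat.mul_le_mul (by omega) (by omega)) hB
  refine (linear_multiples (d := d) (k := n) hB0 (by decide) (by decide) hd ?_).seq ?_
  · intro st hst; simp [nE, hst, hn]
  rintro s1 ⟨f1, t1⟩
  refine (linear_multiples (d := d) (k := m) hB0 (by decide) (by decide) (by simp [f1, hd]) ?_).seq ?_
  · intro st hst; simp [mE, hst, f1, hm]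
  rintro s2 ⟨f2, t2⟩
  have t1' : ∀ j < d + 2, s2 16 j = j * n := by intro j hj; simp [f2, t1 j hj]
  refine (linear_remainders (l := d + 1) (d := d) (k := n) hBn (by decide) (by decide) (by decide)
    (by decide) (by simp [f1, f2, hd]) (t1' _ (by omega)) ?_).seq ?_
  · intro st hst; simp [nE, hst, f1, f2, hn]
  rintro s3 ⟨f3, t3⟩
  refine (linear_quotients (l := d + 1) (d := d) (k := n) hBn (by decide) (by decide) (by decide)
    (by decide) (by decide) (by decide) (by simp [f1, f2, f3, hd])
    (by simp [f3, t1' (d + 1) (by omega)]) t3).seq ?_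
  rintro s4 ⟨f4, t4⟩
  have t2' : ∀ j < d + 2, s4 21 j = j * m := by intro j hj; simp [f3, f4, t2 j hj]
  refine (linear_remainders (l := d + 1) (d := d) (k := m) hBm (by decide) (by decide) (by decide)
    (by decide) (by simp [f1, f2, f3, f4, hd]) (t2' _ (by omega)) ?_).seq ?_
  · intro st hst; simp [mE, hst, f1, f2, f3, f4, hm]
  rintro s5 ⟨f5, t5⟩
  refine (linear_quotients (l := d + 1) (d := d) (k := m) hBm (by decide) (by decide) (by decide)
    (by decide) (by decide) (by decide) (by simp [f1, f2, f3, f4, f5, hd])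
    (by simp [f5, t2' (d + 1) (by omega)]) t5).mono ?_
  rintro s6 ⟨f6, t6⟩
  refine ⟨?_, ?_, ?_, ?_, ?_, ?_, ?_, ?_, ?_, t6⟩
  · intro b hb
    rw [f6 b (by omega) (by omega), f5 b (by omega) (by omega), f4 b (by omega) (by omega),
      f3 b (by omega) (by omega), f2 b (by omega) (by omega), f1 b (by omega) (by omega)]
  · simp [f1, f2, f3, f4, f5, f6, hn]
  · simp [f1, f2, f3, f4, f5, f6, hm]
  · simp [f1, f2, f3, f4, f5, f6, hd]
  · intro j hj; simp [f3, f4, f5, f6, t1' j hj]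
  · intro j hj; simp [f5, f6, t2' j hj]
  · intro j hj; simp [f4, f5, f6, t3 j hj]
  · intro j hj; simp [f5, f6, t4 j hj]
  · intro j hj; simp [f6, t5 j hj]

theorem IndexTables.congr {n m d : ℕ} {s s' : Store} (h : IndexTables n m d s)
    (hs : ∀ b, b = 0 ∨ (14 < b ∧ b < 22) → s' b = s b) : IndexTables n m d s' := by
  obtain ⟨h1, h2, h3, h4, h5, h6, h7, h8, h9⟩ := h
  rw [← hs 0 (by decide)] at h1 h2
  rw [← hs 15 (by decide)] at h3
  rw [← hs 16 (by decide)] at h4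
  rw [← hs 21 (by decide)] at h5
  rw [← hs 17 (by decide)] at h6
  rw [← hs 18 (by decide)] at h7
  rw [← hs 19 (by decide)] at h8
  rw [← hs 20 (by decide)] at h9
  exact ⟨h1, h2, h3, h4, h5, h6, h7, h8, h9⟩

/-- The rank of the color of the vertex `loopVar`, in terms of the table `22`. -/
def rankE : Expr := get 22 (get 16 (dE - 1) + loopVar)

/-- Whether a color from the list is smaller than the color of a vertex. -/
def belowE : Expr := 1 - (1 - (get 2 (get 17 loopVar) - get 13 (get 18 loopVar)))

/-- The compressed colors in array `26`. -/
def compressColors : Prog :=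
  Prog.seq (fill 22 (get 16 dE) (Cases.node (get 18 loopVar)
    (Cases.leaf (get 22 (loopVar - nE) + belowE)) (Cases.leaf belowE))) <|
  Prog.seq (scatter 24 nE rankE (Expr.parity (get 2 loopVar))) <|
  Prog.seq (fill 25 dE (Cases.node loopVar
    (Cases.node (Expr.ne (get 24 loopVar) (Expr.parity (get 25 (loopVar - 1))))
      (Cases.leaf (get 25 (loopVar - 1) + 1)) (Cases.leaf (get 25 (loopVar - 1))))
      (Cases.leaf (get 24 0))))
  (fill 26 nE (Cases.leaf (get 25 rankE)))

/-- Block `i` of table `22` counts, for each vertex, the smaller colors among the first `i + 1`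
listed ones. The last block holds the ranks, after `d * n` steps and without sorting. -/
theorem linear_compressColors {B n m : ℕ} {G : BndCostGame n m} {s : Store} {l : List ℕ}
    (hB : (G.numColors + 2) * (n + m + 1) ≤ B) (hs : IndexTables n m G.numColors s)
    (h2 : ∀ v : Fin n, s 2 v = G.color v) (hl : l.Nodup)
    (hlS : l.toFinset = Finset.univ.image G.color) (h13 : ∀ i, s 13 i = l.getD i 0)
    (h24 : ∀ i, s 24 i = 0) (h25 : ∀ i, s 25 i = 0) :
    Linear B compressColors s fun s' =>
      (∀ b, b < 11 ∨ 26 < b ∨ (11 < b ∧ b < 22) → s' b = s b) ∧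
        ∃ p, ∃ hp : IsParity G p, (∀ v : Fin n, s' 26 v = hp.leveling.c v) ∧
          s' 25 0 = hp.leveling.b ∧ s' 25 (G.numColors - 1) = hp.leveling.D := by
  set d := G.numColors with hd
  have hBd : d ≤ B := le_trans (by omega) (le_trans (Nat.le_mul_of_pos_right (d + 2) (by omega)) hB)
  have hBn : n ≤ B := le_trans (by omega) (le_trans (Nat.le_mul_of_pos_left _ (by omega)) hB)
  have hBdn : d * n ≤ B := le_trans (Nat.mul_le_mul (by omega) (by omega)) hB
  have hld : l.length = d := by
    rw [hd, ParityGame.numColors, ← hlS, List.toFinset_card_of_nodup hl]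
  have hdn : d * n ≤ (d + 1) * n := Nat.mul_le_mul_right _ (by omega)
  set col : ℕ → ℕ := fun i => s 2 i with hcol
  refine (linear_fill (d * n) hBdn (fun j => ((Finset.range (j / n + 1)).filter fun i =>
    l.getD i 0 < col (j % n)).card) (by decide) ?_ ?_).seq ?_
  · intro st hst
    simp [dE, hst, hs.d_eq, hs.mul_n]
  · intro j hj st hx hst hlt _
    have hn : 0 < n := Nat.pos_of_ne_zero fun h0 => by rw [h0, mul_zero] at hj; omega
    have h17 := hs.mod_n j (by omega)
    have h18 := hs.div_n j (by omega)
    have hbelow : belowE.eval st = if l.getD (j / n) 0 < col (j % n) then 1 else 0 := by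
      simp only [belowE, Expr.eval_sub, Expr.eval_one, Expr.eval_get, Expr.eval_const, hx, hst,
        ne_eq, Nat.reduceEqDiff, not_false_eq_true, h17, h18, h13, hcol]
      split_ifs <;> omega
    rw [Finset.range_add_one, Finset.filter_insert]
    have hnot : j / n ∉ (Finset.range (j / n)).filter fun i => l.getD i 0 < col (j % n) := by simp
    have hcard : (if l.getD (j / n) 0 < col (j % n) then
        insert (j / n) ((Finset.range (j / n)).filter fun i => l.getD i 0 < col (j % n))
        else (Finset.range (j / n)).filter fun i => l.getD i 0 < col (j % n)).card =
        ((Finset.range (j / n)).filter fun i => l.getD i 0 < col (j % n)).card +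
          belowE.eval st := by
      rw [hbelow]
      split_ifs
      · rw [Finset.card_insert_of_notMem hnot]
      · rfl
    rw [hcard]
    have h18' : st 18 j = j / n := by simp [hst, h18]
    simp only [Cases.eval_node, Cases.eval_leaf, Expr.eval_get, Expr.eval_const, hx, h18',
      Expr.eval_add, Expr.eval_sub]
    by_cases h0 : j / n = 0
    · simp [h0]
    · rw [if_pos h0]
      have hnj : n ≤ j := by
        by_contra hlt
        exact h0 (Nat.div_eq_of_lt (by omega))
      have hne : nE.eval st = n := by simp [nE, hst, hs.n_eq]
      rw [hne, hlt (j - n) (by omega)]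
      have e1 : (j - n) / n + 1 = j / n := by
        rw [Nat.div_eq_sub_div hn hnj]
      rw [e1, ← Nat.mod_eq_sub_mod hnj]
  rintro s1 ⟨f1, t1, -⟩
  have hrank : ∀ v : Fin n, s1 22 (s1 16 (d - 1) + v) = rank G.color (G.color v) := by
    intro v
    have hd0 : 0 < d := numColors_pos (G := G) (by have := v.2; omega)
    have e1 : s1 16 (d - 1) = (d - 1) * n := by simp [f1, hs.mul_n (d - 1) (by omega)]
    have hlt : (d - 1) * n + v < d * n := by
      have h := v.2
      have : d * n = (d - 1) * n + n := by rw [← Nat.succ_mul]; congr 1; omega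
      omega
    rw [e1, t1 _ hlt, rank_eq_card_filter_getD hl hlS]
    have hn : 0 < n := by have := v.2; omega
    have e2 : ((d - 1) * n + v) / n + 1 = l.length := by
      rw [mul_comm, Nat.mul_add_div hn, Nat.div_eq_of_lt v.2, hld]; omega
    have e3 : ((d - 1) * n + v) % n = v := by
      rw [mul_comm, Nat.mul_add_mod, Nat.mod_eq_of_lt v.2]
    rw [e2, e3, hcol]
    simp only [h2]
  have hrankE : ∀ st : Store, (st 16 = s1 16) → (st 22 = s1 22) → st 15 = s1 15 → ∀ v : Fin n,
      st 11 0 = v → rankE.eval st = rank G.color (G.color v) := by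
    intro st h16 h22 h15 v hx
    have : s1 15 0 = d := by simp [f1, hs.d_eq]
    simp only [rankE, dE, Expr.eval_get, Expr.eval_add, Expr.eval_sub, Expr.eval_one,
      Expr.eval_zero, Expr.eval_const, hx, h16, h22, h15, this]
    exact hrank v
  refine (linear_scatter n hBn (fun j => s1 22 (s1 16 (d - 1) + j)) (fun j => col j % 2)
    (by decide) ?_ ?_).seq ?_
  · intro st hst
    simp [nE, hst, f1, hs.n_eq]
  · intro j hj st hx hst
    refine ⟨?_, by simp [hst, f1, hx, hcol]⟩
    rw [hrankE st (hst 16 (by decide) (by decide)) (hst 22 (by decide) (by decide))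
      (hst 15 (by decide) (by decide)) ⟨j, hj⟩ hx]
    exact (hrank ⟨j, hj⟩).symm
  rintro s2 ⟨f2, t2, t2'⟩
  have hp : IsParity G (s2 24) := by
    constructor
    · intro v
      obtain ⟨j, hj, h3, h4⟩ := t2 v v.2
      have h5 := hrank ⟨j, hj⟩
      simp only [] at h3 h4 h5
      rw [h5, hrank] at h3
      rw [hrank] at h4
      rw [h4, hcol, ← rank_inj h3]
      simp only []
      rw [← h2]
    · intro i hi
      rw [t2' i (fun j hj => by rw [hrank ⟨j, hj⟩]; exact hi _), f1 24 (by decide) (by decide), h24]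
  refine (linear_fill d hBd (compress (s2 24)) (by decide) ?_ ?_).seq ?_
  · intro st hst
    simp [dE, hst, f1, f2, hs.d_eq]
  · intro j hj st hx hst hlt _
    have h3 : st 24 = s2 24 := hst 24 (by decide) (by decide)
    cases j with
    | zero => simp [Cases.eval_node, Cases.eval_leaf, hx, h3, compress]
    | succ j =>
      have h1 := hlt j (by omega)
      simp only [Cases.eval_node, Cases.eval_leaf, Expr.eval_ne, Expr.eval_get, Expr.eval_const,
        Expr.eval_add, Expr.eval_sub, Expr.eval_parity, Expr.eval_one, hx, h3,
        Nat.add_sub_cancel, h1, compress]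
      rw [if_pos (by omega)]
      by_cases h4 : s2 24 (j + 1) = compress (s2 24) j % 2
      · rw [if_neg (not_not.2 h4), if_pos h4]
      · rw [if_pos h4, if_neg h4]
  rintro s3 ⟨f3, t3, t3'⟩
  -- The case `i = 0` is separate because nothing is written if `d = 0`; then the initial content
  -- `0` is right.
  have h25' : ∀ i, i = 0 ∨ i < d → s3 25 i = compress (s2 24) i := by
    intro i hi
    by_cases hid : i < d
    · exact t3 i hid
    · have hi0 : i = 0 := by omega
      subst hi0
      rw [t3' 0 (by omega), f2 25 (by decide) (by decide), f1 25 (by decide) (by decide), h25]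
      refine (hp.eq_zero 0 fun v => ?_).symm
      have := numColors_pos (G := G) (by have := v.2; omega)
      omega
  refine (linear_fill_fin n hBn (fun v => hp.leveling.c v) (by decide) ?_ ?_).mono ?_
  · intro st hst
    simp [nE, hst, f1, f2, f3, hs.n_eq]
  · intro v st hx hst
    have h3 : st 25 = s3 25 := hst 25 (by decide) (by decide)
    have hr := hrankE st (by simp [hst, f3, f2]) (by simp [hst, f3, f2]) (by simp [hst, f3, f2]) v hx
    simp only [Cases.eval_leaf, Expr.eval_get, hr, h3]
    exact h25' _ (Or.inr (rank_lt_card v))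
  rintro s4 ⟨f4, t4, -⟩
  refine ⟨?_, _, hp, t4, ?_, ?_⟩
  · intro b hb
    rw [f4 b (by omega) (by omega), f3 b (by omega) (by omega), f2 b (by omega) (by omega),
      f1 b (by omega) (by omega)]
  · rw [f4 25 (by decide) (by decide), h25' 0 (Or.inl rfl)]; rfl
  · rw [f4 25 (by decide) (by decide), h25' (d - 1) (by omega)]; rfl

/-! ### The program: tables for the memory structure and the levels -/

/-- The memory holds the game, the tables for the arithmetic of indices and the leveling. -/
structure ColorTables {n m : ℕ} (G : BndCostGame n m) (Λ : Leveling n) (s : Store) : Prop where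
  idx : IndexTables n m G.numColors s
  owner : ∀ v : Fin n, s 1 v = G.owner v
  src : ∀ e : Fin m, s 3 e = (G.edge e).1
  tgt : ∀ e : Fin m, s 4 e = (G.edge e).2
  cost : ∀ e : Fin m, s 5 e = (G.cost e).toNat
  c : ∀ v : Fin n, s 26 v = Λ.c v
  b : s 25 0 = Λ.b
  D : s 25 (G.numColors - 1) = Λ.D
  levels_le : Λ.levels ≤ G.numColors + 1
  Q_le : Λ.Q ≤ G.numColors

/-- The copy of the vertex `v` at the level `l`. -/
def nodeE (l v : Expr) : Expr := get 16 ((l - (l - DE)) - bE) + v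

def colorE : Expr := get 26 (get 17 loopVar)

namespace ColorTables

variable {n m : ℕ} {G : BndCostGame n m} {Λ : Leveling n} {s : Store}

theorem congr (h : ColorTables G Λ s) {s' : Store}
    (hs : ∀ b, b < 6 ∨ (14 < b ∧ b < 27) → s' b = s b) : ColorTables G Λ s' := by
  obtain ⟨h1, h2, h3, h4, h5, h6, h7, h8, h9, h10⟩ := h
  rw [← hs 1 (by decide)] at h2
  rw [← hs 3 (by decide)] at h3
  rw [← hs 4 (by decide)] at h4
  rw [← hs 5 (by decide)] at h5
  rw [← hs 26 (by decide)] at h6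
  rw [← hs 25 (by decide)] at h7 h8
  exact ⟨h1.congr fun b hb => hs b (by omega), h2, h3, h4, h5, h6, h7, h8, h9, h10⟩

variable (h : ColorTables G Λ s)
include h

theorem eval_bE : bE.eval s = Λ.b := h.b

theorem eval_nE : nE.eval s = n := h.idx.n_eq

theorem eval_mE : mE.eval s = m := h.idx.m_eq

theorem eval_DE : DE.eval s = Λ.D := by
  simp [DE, dE, h.idx.d_eq, h.D]

theorem eval_QE : QE.eval s = Λ.Q := by
  simp [QE, h.eval_DE, Leveling.Q]

theorem eval_levelsE : levelsE.eval s = Λ.levels := by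
  simp [levelsE, h.eval_DE, h.eval_bE, Leveling.levels]

theorem eval_mul_levels_n : (get 16 levelsE).eval s = Λ.levels * n := by
  have := h.levels_le
  rw [Expr.eval_get, h.eval_levelsE, h.idx.mul_n _ (by omega)]

theorem eval_mul_levels_m : (get 21 levelsE).eval s = Λ.levels * m := by
  have := h.levels_le
  rw [Expr.eval_get, h.eval_levelsE, h.idx.mul_m _ (by omega)]

theorem eval_mul_Q_n : (get 16 (QE + 1)).eval s = (Λ.Q + 1) * n := by
  have := h.Q_le
  rw [Expr.eval_get, Expr.eval_add, h.eval_QE, Expr.eval_one, h.idx.mul_n _ (by omega)]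

theorem modNat_n {l : ℕ} (hl : l ≤ G.numColors + 1) (x : Fin (l * n)) : s 17 x = x.modNat := by
  rw [h.idx.mod_n _ (x.2.trans_le (Nat.mul_le_mul_right n hl)), Fin.coe_modNat]

theorem divNat_n {l : ℕ} (hl : l ≤ G.numColors + 1) (x : Fin (l * n)) : s 18 x = x.divNat := by
  rw [h.idx.div_n _ (x.2.trans_le (Nat.mul_le_mul_right n hl)), Fin.coe_divNat]

theorem modNat_m {l : ℕ} (hl : l ≤ G.numColors + 1) (x : Fin (l * m)) : s 19 x = x.modNat := by
  rw [h.idx.mod_m _ (x.2.trans_le (Nat.mul_le_mul_right m hl)), Fin.coe_modNat]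

theorem divNat_m {l : ℕ} (hl : l ≤ G.numColors + 1) (x : Fin (l * m)) : s 20 x = x.divNat := by
  rw [h.idx.div_m _ (x.2.trans_le (Nat.mul_le_mul_right m hl)), Fin.coe_divNat]

theorem mul_n_add {l : ℕ} (hl : l ≤ G.numColors + 1) (q : Fin l) (v : Fin n) :
    s 16 q + v = (finProdFinEquiv (q, v) : Fin (l * n)) := by
  rw [h.idx.mul_n _ (by omega), finProdFinEquiv_apply_val, add_comm, mul_comm]

/-- With truncated subtraction, `l - (l - D)` is the minimum of `l` and `D`. -/
theorem eval_nodeE {l e : Expr} {v : Fin n} (he : e.eval s = v) :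
    (nodeE l e).eval s = Λ.node (l.eval s) v := by
  unfold nodeE Leveling.node
  rw [← h.mul_n_add h.levels_le]
  simp only [Expr.eval_add, Expr.eval_get, Expr.eval_sub, h.eval_DE, h.eval_bE, he]
  congr 2
  omega

theorem eval_vertex {l : ℕ} (hl : l ≤ G.numColors + 1) {x : Fin (l * n)} (hx : s 11 0 = x) :
    (get 17 loopVar).eval s = x.modNat := by
  rw [Expr.eval_get, Expr.eval_get, Expr.eval_const, hx, h.modNat_n hl]

theorem eval_level {l : ℕ} (hl : l ≤ G.numColors + 1) {x : Fin (l * n)} (hx : s 11 0 = x) :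
    (get 18 loopVar).eval s = x.divNat := by
  rw [Expr.eval_get, Expr.eval_get, Expr.eval_const, hx, h.divNat_n hl]

theorem eval_colorE {l : ℕ} (hl : l ≤ G.numColors + 1) {x : Fin (l * n)} (hx : s 11 0 = x) :
    colorE.eval s = Λ.c x.modNat := by
  rw [colorE, Expr.eval_get, h.eval_vertex hl hx, h.c]

end ColorTables

/-- In addition, the memory holds the memory structure, the main nodes and outgoing edges. -/
structure Tables {n m : ℕ} (G : BndCostGame n m) (Λ : Leveling n) (out : Fin n → Fin m)
    (s : Store) : Prop extends ColorTables G Λ s where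
  size : s 8 0 = Λ.Q + 1
  init : ∀ v : Fin n, s 9 v = Λ.upd 0 v
  upd : ∀ x : Fin ((Λ.Q + 1) * n), s 10 x = Λ.upd x.divNat x.modNat
  main : ∀ x : Fin ((Λ.Q + 1) * n), s 30 x = Λ.main x.divNat x.modNat
  out : ∀ v : Fin n, s 29 v = out v

theorem Tables.congr {n m : ℕ} {G : BndCostGame n m} {Λ : Leveling n} {out : Fin n → Fin m}
    {s s' : Store} (h : Tables G Λ out s)
    (hs : ∀ b, b < 6 ∨ (7 < b ∧ b < 11) ∨ (14 < b ∧ b < 31) → s' b = s b) :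
    Tables G Λ out s' := by
  obtain ⟨h0, h1, h2, h3, h4, h5⟩ := h
  rw [← hs 8 (by decide)] at h1
  rw [← hs 9 (by decide)] at h2
  rw [← hs 10 (by decide)] at h3
  rw [← hs 30 (by decide)] at h4
  rw [← hs 29 (by decide)] at h5
  exact ⟨h0.congr fun b hb => hs b (by omega), h1, h2, h3, h4, h5⟩

/-- The memory structure in arrays `8`, `9`, `10`, the main nodes in array `30`, and outgoing edges
in array `29`. -/
def memoryTables : Prog :=
  Prog.seq (fill 10 (get 16 (QE + 1)) (Cases.node (Expr.parity colorE)
    (Cases.leaf (get 18 loopVar + (half (colorE + 1) - get 18 loopVar)))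
    (Cases.node (get 18 loopVar - half colorE) (Cases.leaf (get 18 loopVar)) (Cases.leaf 0)))) <|
  -- The first `n` cells of the update table belong to state `0`, which is also where the memory
  -- starts.
  Prog.seq (fill 9 nE (Cases.leaf (get 10 loopVar))) <|
  Prog.seq (fill 8 1 (Cases.leaf (QE + 1))) <|
  Prog.seq (fill 30 (get 16 (QE + 1)) (Cases.node (get 10 loopVar)
    (Cases.leaf (nodeE (get 10 loopVar + get 10 loopVar) (get 17 loopVar)))
    (Cases.leaf (nodeE colorE (get 17 loopVar)))))
  (scatter 29 mE (get 3 loopVar) loopVar)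

theorem linear_memoryTables {B n m : ℕ} {G : BndCostGame n m} {Λ : Leveling n} {s : Store}
    (hB : (G.numColors + 2) * (n + m + 1) ≤ B) (h : ColorTables G Λ s) :
    Linear B memoryTables s fun s' => (∀ b, b < 8 ∨ 30 < b → s' b = s b) ∧
      ∃ out : Fin n → Fin m, (∀ v, (G.edge (out v)).1 = v) ∧ Tables G Λ out s' := by
  have hB1 : 1 ≤ B := le_trans (Nat.mul_pos (by omega) (by omega)) hB
  have hBn : n ≤ B := le_trans (by omega) (le_trans (Nat.le_mul_of_pos_left _ (by omega)) hB)
  have hBm : m ≤ B := le_trans (by omega) (le_trans (Nat.le_mul_of_pos_left _ (by omega)) hB)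
  have hQ := h.Q_le
  have hBQ : (Λ.Q + 1) * n ≤ B := le_trans (Nat.mul_le_mul (by omega) (by omega)) hB
  refine (linear_fill_fin _ hBQ (fun x => Λ.upd x.divNat x.modNat) (by decide) ?_ ?_).seq ?_
  · intro st hst
    exact (h.congr fun b hb => hst b (by omega) (by omega)).eval_mul_Q_n
  · intro x st hx hst
    have h' : ColorTables G Λ st := h.congr fun b hb => hst b (by omega) (by omega)
    have hc : colorE.eval st = Λ.c x.modNat := h'.eval_colorE (by omega) hx
    have hq : (get 18 loopVar).eval st = x.divNat := h'.eval_level (by omega) hx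
    simp only [Cases.eval_node, Cases.eval_leaf, Expr.eval_parity, Expr.eval_add, Expr.eval_sub,
      Expr.eval_half, Expr.eval_one, Expr.eval_zero, hc, hq, Leveling.upd, openUpd]
    by_cases hodd : Odd (Λ.c x.modNat)
    · rw [if_pos hodd, if_pos (by rw [Nat.odd_iff] at hodd; omega)]
      omega
    · rw [if_neg hodd, if_neg (by rw [Nat.odd_iff] at hodd; omega)]
      split_ifs <;> omega
  rintro s1 ⟨f1, t1, -⟩
  have h1 : ColorTables G Λ s1 := h.congr fun b hb => f1 b (by omega) (by omega)
  refine (linear_fill_fin n hBn (fun v => Λ.upd 0 v) (by decide) ?_ ?_).seq ?_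
  · intro st hst
    exact (h1.congr fun b hb => hst b (by omega) (by omega)).eval_nE
  · intro v st hx hst
    have h2 := t1 (finProdFinEquiv (0, v))
    rw [finProdFinEquiv_apply_val, Product.divNat_finProdFinEquiv,
      Product.modNat_finProdFinEquiv] at h2
    simpa [Cases.eval_leaf, hx, hst] using h2
  rintro s2 ⟨f2, t2, -⟩
  have h2 : ColorTables G Λ s2 := h1.congr fun b hb => f2 b (by omega) (by omega)
  refine (linear_fill_fin 1 hB1 (fun _ => Λ.Q + 1) (by decide) ?_ ?_).seq ?_
  · intro st hst; rfl
  · intro v st hx hst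
    rw [Cases.eval_leaf, Expr.eval_add,
      (h2.congr fun b hb => hst b (by omega) (by omega)).eval_QE, Expr.eval_one]
  rintro s3 ⟨f3, t3, -⟩
  have h3 : ColorTables G Λ s3 := h2.congr fun b hb => f3 b (by omega) (by omega)
  refine (linear_fill_fin _ hBQ (fun x => Λ.main x.divNat x.modNat) (by decide) ?_ ?_).seq ?_
  · intro st hst
    exact (h3.congr fun b hb => hst b (by omega) (by omega)).eval_mul_Q_n
  · intro x st hx hst
    have h' : ColorTables G Λ st := h3.congr fun b hb => hst b (by omega) (by omega)
    have hv : (get 17 loopVar).eval st = x.modNat := h'.eval_vertex (by omega) hx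
    have hc : colorE.eval st = Λ.c x.modNat := h'.eval_colorE (by omega) hx
    have hu : (get 10 loopVar).eval st = Λ.upd x.divNat x.modNat := by
      simp [hx, hst, f3, f2, t1]
    rw [Cases.eval_node, Cases.eval_leaf, Cases.eval_leaf, h'.eval_nodeE hv, h'.eval_nodeE hv,
      Expr.eval_add, hu, hc, Leveling.main, Leveling.mainLevel, ← two_mul]
    by_cases h0 : Λ.upd x.divNat x.modNat = 0
    · rw [if_neg (not_not.2 h0), if_pos h0]
    · rw [if_pos h0, if_neg h0]
  rintro s4 ⟨f4, t4, -⟩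
  have h4 : ColorTables G Λ s4 := h3.congr fun b hb => f4 b (by omega) (by omega)
  refine (linear_scatter m hBm (fun j => s4 3 j) (fun j => j) (by decide) ?_ ?_).mono ?_
  · intro st hst
    exact (h4.congr fun b hb => hst b (by omega) (by omega)).eval_mE
  · intro j hj st hx hst
    simp [hx, hst]
  rintro s5 ⟨f5, t5, -⟩
  have h5 : ColorTables G Λ s5 := h4.congr fun b hb => f5 b (by omega) (by omega)
  -- Each vertex has an outgoing edge, so its cell was written, and its content is an edge with this
  -- source.
  have hout : ∀ v : Fin n, ∃ e : Fin m, (G.edge e).1 = v ∧ s5 29 v = e := by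
    intro v
    obtain ⟨e, he⟩ := G.total v
    obtain ⟨j, hj, hje, hj'⟩ := t5 e e.2
    have e1 := h4.src ⟨j, hj⟩
    dsimp only at e1 hje hj'
    rw [e1, h4.src e, he, ← Fin.ext_iff] at hje
    rw [h4.src e, he] at hj'
    exact ⟨⟨j, hj⟩, hje, hj'⟩
  choose out hout1 hout2 using hout
  refine ⟨?_, out, hout1, h5, ?_, ?_, ?_, ?_, hout2⟩
  · intro b hb
    rw [f5 b (by omega) (by omega), f4 b (by omega) (by omega), f3 b (by omega) (by omega),
      f2 b (by omega) (by omega), f1 b (by omega) (by omega)]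
  · simpa [f5, f4] using t3 0
  · intro v; simp [f5, f4, f3, t2]
  · intro v; simp [f5, f4, f3, f2, t1]
  · intro v; simp [f5, t4]

theorem Tables.upd_apply {n m : ℕ} {G : BndCostGame n m} {Λ : Leveling n} {out : Fin n → Fin m}
    {s : Store} (h : Tables G Λ out s) (q : Fin (Λ.Q + 1)) (v : Fin n) :
    s 10 (q * n + v) = Λ.upd q v := by
  have := h.upd (finProdFinEquiv (q, v))
  rwa [Product.divNat_finProdFinEquiv, Product.modNat_finProdFinEquiv, finProdFinEquiv_apply_val,
    add_comm, mul_comm] at this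

theorem Tables.main_apply {n m : ℕ} {G : BndCostGame n m} {Λ : Leveling n} {out : Fin n → Fin m}
    {s : Store} (h : Tables G Λ out s) (q : Fin (Λ.Q + 1)) (v : Fin n) :
    s 30 (q * n + v) = Λ.main q v := by
  have := h.main (finProdFinEquiv (q, v))
  rwa [Product.divNat_finProdFinEquiv, Product.modNat_finProdFinEquiv, finProdFinEquiv_apply_val,
    add_comm, mul_comm] at this

/-! ### The program: writing down a product game -/

theorem arrayOf_get {α : Type*} (l : List α) (f : α → ℕ) (i : ℕ) :
    arrayOf (fun j : Fin l.length => f (l.get j)) i = (l.map f).getD i 0 := by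
  unfold arrayOf
  split_ifs with hi
  · rw [List.getD_eq_getElem _ _ (by simpa using hi)]; simp
  · rw [List.getD_eq_default _ _ (by simpa using hi)]

theorem exists_extension {α : Type*} [Inhabited α] {N : ℕ} (F : Fin N → α) :
    ∃ f : ℕ → α, ∀ x : Fin N, f x = F x :=
  ⟨fun j => if hj : j < N then F ⟨j, hj⟩ else default, fun x => dif_pos x.2⟩

theorem map_filter_range {N : ℕ} {p : ℕ → Bool} {P : Fin N → Bool} (hp : ∀ x : Fin N, p x = P x)
    {f : ℕ → ℕ} {F : Fin N → ℕ} (hf : ∀ x : Fin N, f x = F x) :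
    ((List.range N).filter p).map f = ((List.finRange N).filter P).map F := by
  rw [← List.map_coe_finRange_eq_range, List.filter_map, List.map_map]
  have h1 : (p ∘ fun x : Fin N => (x : ℕ)) = P := funext hp
  have h2 : (f ∘ fun x : Fin N => (x : ℕ)) = F := funext hf
  rw [h1, h2]

/-- The index of the source of a possible edge. -/
def sourceE : Expr := get 16 (get 20 loopVar) + get 3 (get 19 loopVar)

/-- The index of the target of a possible edge, in terms of the tables `k`, `k + 1`, `k + 2`. -/
def targetE (k : ℕ) : Cases :=
  Cases.node (get k sourceE)
    (Cases.node (get 5 (get 19 loopVar))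
      (Cases.leaf (get (k + 2) (get 16 (get k sourceE - 1) + get 4 (get 19 loopVar))))
      (Cases.leaf (get 30 (get 16 (get k sourceE - 1) + get 4 (get 19 loopVar)))))
    (Cases.leaf (get (k + 1) sourceE))

/-- The lists of edges of a product game in the arrays `o + 6` and `o + 8`, the owners of the
vertices in array `o + 2`, and the numbers of vertices and edges in array `o`. -/
def writeGame (k o : ℕ) : Prog :=
  Prog.seq (fill (k + 3) (get 21 levelsE) (targetE k)) <|
  Prog.seq (collect (o + 6) (o + 8) (k + 4) (get 21 levelsE)
    -- The sum acts as the disjunction in `Product.valid`.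
    (get k sourceE + Expr.eq (get 29 (get 3 (get 19 loopVar))) (get 19 loopVar))
    sourceE (get (k + 3) loopVar)) <|
  Prog.seq (fill (o + 2) (get 16 levelsE) (Cases.leaf (get 1 (get 17 loopVar))))
  (fill o 2 (Cases.node loopVar (Cases.leaf (get (k + 4) 0)) (Cases.leaf (get 16 levelsE))))

/-- The tables `k`, `k + 1` and `k + 2` describe the product `H`. -/
structure ProductTables {n m : ℕ} {G : BndCostGame n m} {Λ : Leveling n} (H : Product G Λ.levels)
    (k : ℕ) (s : Store) : Prop where
  kind : ∀ y : Fin (Λ.levels * n), s k y = H.kind y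
  link : ∀ y : Fin (Λ.levels * n), s (k + 1) y = H.link y
  inc : ∀ x : Fin ((Λ.Q + 1) * n), s (k + 2) x = H.tgt EdgeCost.inc x.divNat x.modNat

theorem linear_writeGame {B n m k o : ℕ} {G : BndCostGame n m} {Λ : Leveling n}
    {out : Fin n → Fin m} {H : Product G Λ.levels} {s : Store}
    (hB : (G.numColors + 2) * (n + m + 1) ≤ B) (hk : 30 < k) (hk' : k < 90) (ho : 99 < o)
    (h : Tables G Λ out s) (hH : ProductTables H k s) (hout : H.out = out)
    (hkind : ∀ y, H.kind y ≤ Λ.Q + 1) (heps : ∀ q v, H.tgt EdgeCost.eps q v = Λ.main q v)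
    (hs : ∀ b, (k + 2 < b ∧ b < k + 5) ∨ (o ≤ b ∧ b ≠ o + 4 ∧ (b + o) % 2 = 0) → ∀ i, s b i = 0)
    (hcolor : s (o + 4) = arrayOf H.color) :
    Linear B (writeGame k o) s fun s' =>
      (∀ b, b < 11 ∨ (11 < b ∧ b < k + 3) ∨ (k + 4 < b ∧ b < 100) ∨
        (99 < b ∧ (o + b) % 2 = 1) → s' b = s b) ∧
      ∀ a, s' (o + 2 * a) = H.game.input a := by
  have hl := h.levels_le
  have hQ := h.Q_le
  have hBln : Λ.levels * n ≤ B := le_trans (Nat.mul_le_mul (by omega) (by omega)) hB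
  have hBlm : Λ.levels * m ≤ B := le_trans (Nat.mul_le_mul (by omega) (by omega)) hB
  have hB2 : 2 ≤ B := le_trans (le_trans (by omega)
    (Nat.le_mul_of_pos_right (G.numColors + 2) (by omega : 0 < n + m + 1))) hB
  have hedge : ∀ st : Store, ColorTables G Λ st → ∀ x : Fin (Λ.levels * m), st 11 0 = x →
      (get 19 loopVar).eval st = x.modNat := by
    intro st hst x hx
    rw [Expr.eval_get, Expr.eval_get, Expr.eval_const, hx, hst.modNat_m hl]
  have hsource : ∀ st : Store, ColorTables G Λ st → ∀ x : Fin (Λ.levels * m), st 11 0 = x →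
      sourceE.eval st = Product.source G x := by
    intro st hst x hx
    rw [sourceE, Expr.eval_add, Expr.eval_get, Expr.eval_get, Expr.eval_get, Expr.eval_const,
      Expr.eval_get, hedge st hst x hx, hx, hst.divNat_m hl, hst.src, hst.mul_n_add hl]
    rfl
  refine (linear_fill_fin _ hBlm (fun x => (H.target x : ℕ)) (by omega) ?_ ?_).seq ?_
  · intro st hst
    exact (h.congr fun b hb => hst b (by omega) (by omega)).eval_mul_levels_m
  · intro x st hx hst
    have h' : Tables G Λ out st := h.congr fun b hb => hst b (by omega) (by omega)
    have he := hedge st h'.toColorTables x hx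
    have hsrc := hsource st h'.toColorTables x hx
    have hkd : (get k sourceE).eval st = H.kind (Product.source G x) := by
      rw [Expr.eval_get, hsrc, hst k (by omega) (by omega), hH.kind]
    rw [targetE, Cases.eval_node, hkd, Product.target]
    by_cases h0 : H.kind (Product.source G x) = 0
    · rw [if_neg (not_not.2 h0), if_pos h0, Cases.eval_leaf, Expr.eval_get, hsrc,
        hst (k + 1) (by omega) (by omega), hH.link]
    · rw [if_pos h0, if_neg h0]
      have hi : (get 16 (get k sourceE - 1) + get 4 (get 19 loopVar)).eval st =
          (finProdFinEquiv (⟨H.kind (Product.source G x) - 1,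
            by have := hkind (Product.source G x); omega⟩, (G.edge x.modNat).2) :
              Fin ((Λ.Q + 1) * n)) := by
        rw [← h'.mul_n_add (by omega), Expr.eval_add, Expr.eval_get, Expr.eval_sub, hkd,
          Expr.eval_get, he, h'.tgt]
        rfl
      rw [Cases.eval_node, Cases.eval_leaf, Cases.eval_leaf, Expr.eval_get, he, h'.cost,
        Expr.eval_get, hi, Expr.eval_get, hi, hst (k + 2) (by omega) (by omega), hH.inc, h'.main,
        Product.divNat_finProdFinEquiv, Product.modNat_finProdFinEquiv]
      cases G.cost x.modNat with
      | eps => rw [heps]; rfl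
      | inc => rfl
  rintro s1 ⟨f1, t1, -⟩
  have h1 : Tables G Λ out s1 := h.congr fun b hb => f1 b (by omega) (by omega)
  obtain ⟨p, hp⟩ := exists_extension H.valid
  obtain ⟨f, hf⟩ := exists_extension fun x => (Product.source G x : ℕ)
  obtain ⟨f', hf'⟩ := exists_extension fun x => (H.target x : ℕ)
  refine (linear_collect (Λ.levels * m) hBlm
p f f' ?_ ?_ ?_ ?_ ?_ ?_).seq ?_
  · simp only [List.nodup_cons, List.mem_cons, List.not_mem_nil, or_false, not_or,
      not_false_eq_true, List.nodup_nil, and_true]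
    omega
  · intro i; rw [f1 _ (by omega) (by omega), hs _ (by omega)]
  · intro i; rw [f1 _ (by omega) (by omega), hs _ (by omega)]
  · rw [f1 _ (by omega) (by omega), hs _ (by omega)]
  · intro st hst
    exact (h1.congr fun b hb =>
      hst b (by omega) (by omega) (by omega) (by omega)).eval_mul_levels_m
  · intro j hj st hx hst
    have h' : Tables G Λ out st :=
      h1.congr fun b hb => hst b (by omega) (by omega) (by omega) (by omega)
    have he := hedge st h'.toColorTables ⟨j, hj⟩ hx
    have hsrc := hsource st h'.toColorTables ⟨j, hj⟩ hx
    constructor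
    · have hkd : (get k sourceE).eval st = H.kind (Product.source G ⟨j, hj⟩) := by
        rw [Expr.eval_get, hsrc, hst k (by omega) (by omega) (by omega) (by omega),
          f1 k (by omega) (by omega), hH.kind]
      have heq := Expr.eval_eq st (get 29 (get 3 (get 19 loopVar))) (get 19 loopVar)
      rw [Expr.eval_get _ 29, Expr.eval_get _ 3, he, h'.src, h'.out, ← hout, ← Fin.ext_iff] at heq
      rw [hp ⟨j, hj⟩, Expr.eval_add, hkd, Product.valid, decide_eq_true_eq, ← heq]
      omega
    · intro st' hst' _
      have h'' : Tables G Λ out st' := h'.congr fun b hb => hst' b (by omega) (by omega)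
      have hx' : st' 11 0 = j := by rw [hst' 11 (by omega) (by omega), hx]
      rw [hf ⟨j, hj⟩, hf' ⟨j, hj⟩, hsource st' h''.toColorTables ⟨j, hj⟩ hx']
      refine ⟨rfl, ?_⟩
      rw [Expr.eval_get, Expr.eval_get, Expr.eval_const, hx', hst' _ (by omega) (by omega),
        hst _ (by omega) (by omega) (by omega) (by omega)]
      exact t1 ⟨j, hj⟩
  rintro s2 ⟨f2, t2, t2', t2''⟩
  have hlen := congrArg List.length (map_filter_range hp hf)
  rw [List.length_map, List.length_map] at hlen
  rw [hlen] at t2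
  rw [map_filter_range hp hf] at t2'
  rw [map_filter_range hp hf'] at t2''
  have h2 : Tables G Λ out s2 :=
    h1.congr fun b hb => f2 b (by omega) (by omega) (by omega) (by omega)
  refine (linear_fill_fin _ hBln (fun y => (G.owner y.modNat : ℕ)) (by omega) ?_ ?_).seq ?_
  · intro st hst
    exact (h2.congr fun b hb => hst b (by omega) (by omega)).eval_mul_levels_n
  · intro y st hy hst
    have h' : Tables G Λ out st := h2.congr fun b hb => hst b (by omega) (by omega)
    rw [Cases.eval_leaf, Expr.eval_get, h'.eval_vertex hl hy, h'.owner]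
  rintro s3 ⟨f3, -, t3⟩
  have h3 : Tables G Λ out s3 := h2.congr fun b hb => f3 b (by omega) (by omega)
  refine (linear_fill_fin 2 hB2 ![Λ.levels * n, H.candidates.length] (by omega) ?_ ?_).mono ?_
  · intro st hst; rfl
  · intro y st hy hst
    have h' : Tables G Λ out st := h3.congr fun b hb => hst b (by omega) (by omega)
    rw [Cases.eval_node, Cases.eval_leaf, Cases.eval_leaf, h'.eval_mul_levels_n, Expr.eval_get,
      Expr.eval_get, Expr.eval_zero, Expr.eval_const, hy]
    fin_cases y
    · rfl
    · have : st (k + 4) 0 = H.candidates.length := by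
        rw [hst _ (by omega) (by omega), f3 _ (by omega) (by omega)]; exact t2
      simpa using this
  rintro s4 ⟨f4, -, t4⟩
  refine ⟨?_, ?_⟩
  · intro b hb
    rw [f4 b (by omega) (by omega), f3 b (by omega) (by omega),
      f2 b (by omega) (by omega) (by omega) (by omega), f1 b (by omega) (by omega)]
  · have hz : ∀ a, a ≠ 0 → a ≠ 1 → a ≠ 3 → a ≠ 4 → s4 (o + 2 * a) = s (o + 2 * a) := by
      intro a h0 h1 h3 h4
      rw [f4 _ (by omega) (by omega), f3 _ (by omega) (by omega),
        f2 _ (by omega) (by omega) (by omega) (by omega), f1 _ (by omega) (by omega)]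
    intro a
    match a with
    | 0 =>
      refine t4 fun i => ?_
      rw [f3 _ (by omega) (by omega), f2 _ (by omega) (by omega) (by omega) (by omega),
        f1 _ (by omega) (by omega), hs _ (by omega)]
    | 1 =>
      rw [f4 _ (by omega) (by omega)]
      refine t3 fun i => ?_
      rw [f2 _ (by omega) (by omega) (by omega) (by omega), f1 _ (by omega) (by omega),
        hs _ (by omega)]
    | 2 => rw [hz 2 (by omega) (by omega) (by omega) (by omega), hcolor]; rfl
    | 3 =>
      rw [f4 _ (by omega) (by omega), f3 _ (by omega) (by omega)]
      funext i
      exact (t2' i).trans (arrayOf_get H.candidates (fun x => (Product.source G x : ℕ)) i).symm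
    | 4 =>
      rw [f4 _ (by omega) (by omega), f3 _ (by omega) (by omega)]
      funext i
      exact (t2'' i).trans (arrayOf_get H.candidates (fun x => (H.target x : ℕ)) i).symm
    | a + 5 =>
      rw [hz _ (by omega) (by omega) (by omega) (by omega)]
      funext i
      rw [hs _ (by omega)]
      rfl

/-! ### The program: solving the product games -/

/-- Writing down a product game that is given by expressions with case distinctions. -/
def prepareGame (k o : ℕ) (kindC linkC incC colorC : Cases) : Prog :=
  Prog.seq (fill k (get 16 levelsE) kindC) <|
  Prog.seq (fill (k + 1) (get 16 levelsE) linkC) <|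
  Prog.seq (fill (k + 2) (get 16 (QE + 1)) incC) <|
  Prog.seq (fill (o + 4) (get 16 levelsE) colorC) (writeGame k o)

theorem linear_prepareGame {B n m k o : ℕ} {G : BndCostGame n m} {Λ : Leveling n}
    {out : Fin n → Fin m} {H : Product G Λ.levels} {s : Store} {kindC linkC incC colorC : Cases}
    (hB : (G.numColors + 2) * (n + m + 1) ≤ B) (hk : 30 < k) (hk' : k < 90) (ho : 99 < o)
    (h : Tables G Λ out s) (hout : H.out = out)
    (hkind : ∀ y, H.kind y ≤ Λ.Q + 1) (heps : ∀ q v, H.tgt EdgeCost.eps q v = Λ.main q v)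
    (hs : ∀ b, (k + 2 < b ∧ b < k + 5) ∨ (o ≤ b ∧ (b + o) % 2 = 0) → ∀ i, s b i = 0)
    (hkindC : ∀ st, Tables G Λ out st → ∀ y : Fin (Λ.levels * n), st 11 0 = y →
      kindC.eval st = H.kind y)
    (hlinkC : ∀ st, Tables G Λ out st → ∀ y : Fin (Λ.levels * n), st 11 0 = y →
      linkC.eval st = H.link y)
    (hincC : ∀ st, Tables G Λ out st → ∀ x : Fin ((Λ.Q + 1) * n), st 11 0 = x →
      incC.eval st = H.tgt EdgeCost.inc x.divNat x.modNat)
    (hcolorC : ∀ st, Tables G Λ out st → (∀ b, 99 < b → b ≠ o + 4 → st b = s b) →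
      ∀ y : Fin (Λ.levels * n), st 11 0 = y → colorC.eval st = H.color y) :
    Linear B (prepareGame k o kindC linkC incC colorC) s fun s' =>
      (∀ b, b < 11 ∨ (11 < b ∧ b < k) ∨ (k + 4 < b ∧ b < 100) ∨
        (99 < b ∧ (o + b) % 2 = 1) → s' b = s b) ∧
      ∀ a, s' (o + 2 * a) = H.game.input a := by
  have hl := h.levels_le
  have hQ := h.Q_le
  have hBln : Λ.levels * n ≤ B := le_trans (Nat.mul_le_mul (by omega) (by omega)) hB
  have hBQ : (Λ.Q + 1) * n ≤ B := le_trans (Nat.mul_le_mul (by omega) (by omega)) hB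
  refine (linear_fill_fin _ hBln H.kind (by omega) ?_ ?_).seq ?_
  · intro st hst
    exact (h.congr fun b hb => hst b (by omega) (by omega)).eval_mul_levels_n
  · intro y st hy hst
    exact hkindC st (h.congr fun b hb => hst b (by omega) (by omega)) y hy
  rintro s1 ⟨f1, t1, -⟩
  have h1 : Tables G Λ out s1 := h.congr fun b hb => f1 b (by omega) (by omega)
  refine (linear_fill_fin _ hBln (fun y => (H.link y : ℕ)) (by omega) ?_ ?_).seq ?_
  · intro st hst
    exact (h1.congr fun b hb => hst b (by omega) (by omega)).eval_mul_levels_n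
  · intro y st hy hst
    exact hlinkC st (h1.congr fun b hb => hst b (by omega) (by omega)) y hy
  rintro s2 ⟨f2, t2, -⟩
  have h2 : Tables G Λ out s2 := h1.congr fun b hb => f2 b (by omega) (by omega)
  refine (linear_fill_fin _ hBQ (fun x => (H.tgt EdgeCost.inc x.divNat x.modNat : ℕ))
    (by omega) ?_ ?_).seq ?_
  · intro st hst
    exact (h2.congr fun b hb => hst b (by omega) (by omega)).eval_mul_Q_n
  · intro x st hx hst
    exact hincC st (h2.congr fun b hb => hst b (by omega) (by omega)) x hx
  rintro s3 ⟨f3, t3, -⟩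
  have h3 : Tables G Λ out s3 := h2.congr fun b hb => f3 b (by omega) (by omega)
  refine (linear_fill_fin _ hBln H.color (by omega) ?_ ?_).seq ?_
  · intro st hst
    exact (h3.congr fun b hb => hst b (by omega) (by omega)).eval_mul_levels_n
  · intro y st hy hst
    refine hcolorC st (h3.congr fun b hb => hst b (by omega) (by omega)) ?_ y hy
    intro b hb hb'
    rw [hst b (by omega) (by omega), f3 b (by omega) (by omega), f2 b (by omega) (by omega),
      f1 b (by omega) (by omega)]
  rintro s4 ⟨f4, -, t4⟩
  have h4 : Tables G Λ out s4 := h3.congr fun b hb => f4 b (by omega) (by omega)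
  have f : ∀ b, b ≠ k → b ≠ k + 1 → b ≠ k + 2 → b ≠ o + 4 → b ≠ 11 → s4 b = s b := by
    intro b _ _ _ _ _
    rw [f4 b (by omega) (by omega), f3 b (by omega) (by omega), f2 b (by omega) (by omega),
      f1 b (by omega) (by omega)]
  refine (linear_writeGame hB hk hk' ho h4 ⟨?_, ?_, ?_⟩ hout hkind heps ?_ ?_).mono ?_
  · intro y
    rw [f4 _ (by omega) (by omega), f3 _ (by omega) (by omega), f2 _ (by omega) (by omega), t1]
  · intro y
    rw [f4 _ (by omega) (by omega), f3 _ (by omega) (by omega), t2]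
  · intro x
    rw [f4 _ (by omega) (by omega), t3]
  · intro b hb i
    rw [f b (by omega) (by omega) (by omega) (by omega) (by omega), hs b (by omega)]
  · refine t4 fun i => ?_
    rw [f3 _ (by omega) (by omega), f2 _ (by omega) (by omega), f1 _ (by omega) (by omega),
      hs _ (by omega)]
  · rintro s5 ⟨f5, t5⟩
    refine ⟨fun b hb => ?_, t5⟩
    rw [f5 b (by omega), f b (by omega) (by omega) (by omega) (by omega) (by omega)]

/-- The arrays `o + 12` and `o + 14` hold the winners `win` and a uniform positional winning
strategy `nxt`. -/
structure Solved {N M : ℕ} (G : ParityGame N M) (o : ℕ) (s : Store) (win : Fin N → Fin 2)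
    (nxt : Fin N → Fin N) : Prop where
  win_eq : ∀ y : Fin N, s (o + 12) y = win y
  nxt_eq : ∀ y : Fin N, s (o + 14) y = nxt y
  isWinningFrom : ∀ i, G.arena.IsWinningFrom (parity G.color) i (positional nxt) {y | win y = i}

theorem runs_rename {N M o : ℕ} {P : Prog} {T : ℕ → ℕ → ℕ → ℕ} (hP : SolvesParityGames P T)
    (G : ParityGame N M) {s : Store} (hs : ∀ a, s (o + 2 * a) = G.input a) :
    Runs (P.rename fun a => o + 2 * a) s (T N M G.numColors) fun s' =>
      (∀ b, b < o ∨ (o + b) % 2 = 1 → s' b = s b) ∧ ∃ win nxt, Solved G o s' win nxt := by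
  obtain ⟨t, s', he, ht, win, nxt, hw, hn, hi⟩ := hP N M G
  obtain ⟨S', hE, hS, hf⟩ := he.rename (f := fun a => o + 2 * a)
    (fun a b hab => by dsimp only at hab; omega) s hs
  refine ⟨t, S', hE, ht, ?_, win, nxt, fun y => ?_, fun y => ?_, fun i => ?_⟩
  · intro b hb
    refine hf b ?_
    rintro ⟨a, rfl⟩
    dsimp only at hb
    omega
  · rw [← hw y, ← hS 6]
  · rw [← hn y, ← hS 7]
  · rw [← (hi i).1]
    exact (hi i).2

/-- The work of the renamed program in the linear term is only slack. It lets the final bound be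
stated with the work of the composed program. -/
theorem Linear.solve {B N M o : ℕ} {p P : Prog} {T : ℕ → ℕ → ℕ → ℕ}
    (hP : SolvesParityGames P T) {G : ParityGame N M} {s : Store} {F : Store → Prop}
    (h : Linear B p s fun s' => F s' ∧ ∀ a, s' (o + 2 * a) = G.input a) :
    Runs (Prog.seq p (P.rename fun a => o + 2 * a)) s
      ((Prog.seq p (P.rename fun a => o + 2 * a)).work * (B + 1) + T N M G.numColors) fun s' =>
        ∃ s₁, F s₁ ∧ (∀ b, b < o ∨ (o + b) % 2 = 1 → s' b = s₁ b) ∧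
          ∃ win nxt, Solved G o s' win nxt := by
  refine Runs.mono (Runs.seq (R' := fun s' => ∃ s₁, F s₁ ∧
    (∀ b, b < o ∨ (o + b) % 2 = 1 → s' b = s₁ b) ∧ ∃ win nxt, Solved G o s' win nxt) h
    (b' := T N M G.numColors) ?_) ?_ fun _ h => h
  · rintro s₁ ⟨hF, h1⟩
    exact (runs_rename hP G h1).mono le_rfl fun s' h' => ⟨s₁, hF, h'⟩
  · simp only [Prog.work]
    exact Nat.add_le_add_right (Nat.mul_le_mul_right _ (Nat.le_add_right _ _)) _

section

variable {n m : ℕ} {G : BndCostGame n m} {Λ : Leveling n} {out : Fin n → Fin m} {s : Store}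

def levelE : Expr := get 18 loopVar + bE
def vertexE : Expr := get 17 loopVar
def badE : Expr := QE + QE + 1

theorem Tables.eval_levelE (h : Tables G Λ out s) {y : Fin (Λ.levels * n)} (hy : s 11 0 = y) :
    levelE.eval s = Λ.level y := by
  rw [levelE, Expr.eval_add, h.eval_level h.levels_le hy, h.eval_bE]
  rfl

theorem Tables.eval_badE (h : Tables G Λ out s) : badE.eval s = Λ.bad := by
  rw [badE, Expr.eval_add, Expr.eval_add, h.eval_QE, Expr.eval_one, Leveling.bad, two_mul]

theorem Tables.eval_mainE (h : Tables G Λ out s) {x : Fin ((Λ.Q + 1) * n)} (hx : s 11 0 = x) :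
    (get 30 loopVar).eval s = Λ.main x.divNat x.modNat := by
  rw [Expr.eval_get, Expr.eval_get, Expr.eval_const, hx, h.main]

theorem Tables.eval_updE (h : Tables G Λ out s) {x : Fin ((Λ.Q + 1) * n)} (hx : s 11 0 = x) :
    (get 10 loopVar).eval s = Λ.upd x.divNat x.modNat := by
  rw [Expr.eval_get, Expr.eval_get, Expr.eval_const, hx, h.upd]

theorem Cases.eval_node_ne (s : Store) (x y : Expr) (l r : Cases) :
    (Cases.node (Expr.ne x y) l r).eval s =
      if x.eval s = y.eval s then r.eval s else l.eval s := by
  rw [Cases.eval_node]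
  by_cases h : x.eval s = y.eval s
  · rw [if_pos h, if_neg (by rw [Expr.eval_ne]; exact not_not.2 h)]
  · rw [if_neg h, if_pos (by rw [Expr.eval_ne]; exact h)]

theorem Cases.eval_node_parity (s : Store) (x : Expr) (l r : Cases) :
    (Cases.node (Expr.parity x) l r).eval s = if Odd (x.eval s) then l.eval s else r.eval s := by
  rw [Cases.eval_node, Expr.eval_parity]
  by_cases h : Odd (x.eval s)
  · rw [if_pos h, if_pos (by rw [Nat.odd_iff] at h; omega)]
  · rw [if_neg h, if_neg (by rw [Nat.odd_iff] at h; omega)]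

/-- Writing down the first product game. -/
def prepare₁ : Prog :=
  -- Tables in arrays `31` to `35`, game in the even arrays from `100` on. The second game uses `36`
  -- to `40` and the odd arrays from `101` on, so the results of the first run survive.
  prepareGame 31 100
    (Cases.node (Expr.ne levelE DE) (Cases.leaf 0) (Cases.leaf (QE + 1)))
    (Cases.node (Expr.ne (levelE + 1) DE) (Cases.leaf (nodeE levelE vertexE))
      (Cases.leaf (nodeE DE vertexE)))
    (Cases.node (Expr.ne colorE DE) (Cases.leaf (nodeE (DE - 1) vertexE))
      (Cases.leaf (get 30 loopVar)))
    (Cases.node (Expr.ne levelE DE) (Cases.leaf badE)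
      (Cases.node (Expr.ne colorE DE) (Cases.leaf colorE) (Cases.leaf badE)))

theorem linear_prepare₁ {B : ℕ} (hB : (G.numColors + 2) * (n + m + 1) ≤ B)
    (h : Tables G Λ out s) (hout : ∀ v, (G.edge (out v)).1 = v)
    (hs : ∀ b, (33 < b ∧ b < 36) ∨ (99 < b ∧ b % 2 = 0) → ∀ i, s b i = 0) :
    Linear B prepare₁ s fun s' =>
      (∀ b, b < 11 ∨ (11 < b ∧ b < 31) ∨ (35 < b ∧ b < 100) ∨ (99 < b ∧ b % 2 = 1) →
        s' b = s b) ∧ ∀ a, s' (100 + 2 * a) = (Λ.product₁ G out hout).game.input a := by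
  have hQ := Nat.succ_le_succ h.Q_le
  refine (linear_prepareGame (H := Λ.product₁ G out hout) hB (by omega) (by omega) (by omega) h rfl
    ?_ (fun _ _ => rfl) ?_ ?_ ?_ ?_ ?_).mono fun s' h' => ⟨fun b hb => h'.1 b (by omega), h'.2⟩
  · intro y
    simp only [Leveling.product₁]
    split_ifs <;> omega
  · intro b hb
    exact hs b (by omega)
  · intro st h' y hy
    rw [Cases.eval_node_ne, Cases.eval_leaf, Cases.eval_leaf, h'.eval_levelE hy, h'.eval_DE,
      Expr.eval_add, h'.eval_QE]
    rfl
  · intro st h' y hy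
    have hv := h'.eval_vertex h.levels_le hy
    rw [Cases.eval_node_ne, Cases.eval_leaf, Cases.eval_leaf, vertexE, h'.eval_nodeE hv,
      h'.eval_nodeE hv, Expr.eval_add, h'.eval_levelE hy, h'.eval_DE, Expr.eval_one]
    simp only [Leveling.product₁]
    split_ifs <;> rfl
  · intro st h' x hx
    rw [Cases.eval_node_ne, Cases.eval_leaf, Cases.eval_leaf, vertexE,
      h'.eval_nodeE (h'.eval_vertex hQ hx), h'.eval_mainE hx, h'.eval_colorE hQ hx, Expr.eval_sub,
      h'.eval_DE, Expr.eval_one]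
    simp only [Leveling.product₁]
    split_ifs <;> rfl
  · intro st h' _ y hy
    rw [Cases.eval_node_ne, Cases.eval_node_ne, Cases.eval_leaf, Cases.eval_leaf,
      h'.eval_levelE hy, h'.eval_colorE h.levels_le hy, h'.eval_DE, h'.eval_badE]
    rfl

/-- Writing down the second product game. -/
def prepare₂ : Prog :=
  prepareGame 36 101
    (Cases.node (Expr.parity levelE) (Cases.leaf 0) (Cases.node (colorE - levelE) (Cases.leaf 0)
      (Cases.node (Expr.ne levelE colorE) (Cases.leaf (half levelE + 1)) (Cases.leaf 1))))
    (Cases.node (Expr.parity levelE) (Cases.leaf (nodeE (levelE + 1) vertexE))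
      (Cases.leaf (nodeE levelE vertexE)))
    (Cases.node (get 10 loopVar)
      (Cases.node (get 10 loopVar + get 10 loopVar - DE) (Cases.leaf (get 30 loopVar))
        (Cases.leaf (nodeE (get 10 loopVar + get 10 loopVar - 1) vertexE)))
      (Cases.leaf (get 30 loopVar)))
    (Cases.node (Expr.parity levelE)
      (Cases.node (Expr.ne levelE DE) (Cases.leaf badE)
        -- `112 = 100 + 2 * 6` is the array with the winners of the first game.
        (Cases.node (get 112 (nodeE DE vertexE)) (Cases.leaf badE) (Cases.leaf (badE + 1))))
      (Cases.node (Expr.ne levelE colorE) (Cases.leaf colorE) (Cases.leaf (badE + 1))))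

theorem linear_prepare₂ {B : ℕ} (hB : (G.numColors + 2) * (n + m + 1) ≤ B)
    (h : Tables G Λ out s) (hout : ∀ v, (G.edge (out v)).1 = v)
    (hs : ∀ b, (38 < b ∧ b < 41) ∨ (99 < b ∧ b % 2 = 1) → ∀ i, s b i = 0)
    {win₁ : Fin (Λ.levels * n) → Fin 2} (hw : ∀ y : Fin (Λ.levels * n), s 112 y = win₁ y) :
    Linear B prepare₂ s fun s' =>
      (∀ b, b < 11 ∨ (11 < b ∧ b < 31) ∨ (99 < b ∧ b % 2 = 0) → s' b = s b) ∧
        ∀ a, s' (101 + 2 * a) =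
          (Λ.product₂ G out hout fun v => win₁ (Λ.node Λ.D v)).game.input a := by
  have hQ := Nat.succ_le_succ h.Q_le
  refine (linear_prepareGame (H := Λ.product₂ G out hout fun v => win₁ (Λ.node Λ.D v)) hB
    (by omega) (by omega) (by omega) h rfl ?_ (fun _ _ => rfl) ?_ ?_ ?_ ?_ ?_).mono
    fun s' h' => ⟨fun b hb => h'.1 b (by omega), h'.2⟩
  · intro y
    have h1 : Λ.level y ≤ Λ.D := by
      have h1 := y.divNat.2
      have := Λ.b_le y.modNat
      have := Λ.le_D y.modNat
      have h2 : Λ.levels = Λ.D - Λ.b + 1 := rfl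
      unfold Leveling.level
      omega
    have h2 : (if Λ.level y = Λ.c y.modNat then 0 else Λ.level y / 2) ≤ Λ.Q := by
      unfold Leveling.Q
      split_ifs <;> omega
    exact (ite_le_sup _ _ _).trans (max_le (by omega) (by omega))
  · intro b hb
    exact hs b (by omega)
  · intro st h' y hy
    rw [Cases.eval_node_parity, Cases.eval_node, Cases.eval_node_ne, Cases.eval_leaf,
      Cases.eval_leaf, Cases.eval_leaf, Expr.eval_add, Expr.eval_half, Expr.eval_sub,
      h'.eval_levelE hy, h'.eval_colorE h.levels_le hy, Expr.eval_one, Expr.eval_zero]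
    simp only [Leveling.product₂]
    by_cases h1 : Odd (Λ.level y)
    · rw [if_pos h1, if_neg fun h2 => h2.1 h1]
    · rw [if_neg h1]
      by_cases h2 : Λ.c y.modNat ≤ Λ.level y
      · rw [if_neg (by omega), if_pos (show ¬ Odd (Λ.level y) ∧ _ from ⟨h1, h2⟩)]
        by_cases h3 : Λ.level y = Λ.c y.modNat
        · rw [if_pos h3, if_pos h3]
        · rw [if_neg h3, if_neg h3]
      · rw [if_pos (by omega), if_neg fun h3 => h2 h3.2]
  · intro st h' y hy
    have hv := h'.eval_vertex h.levels_le hy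
    rw [Cases.eval_node_parity, Cases.eval_leaf, Cases.eval_leaf, vertexE, h'.eval_nodeE hv,
      h'.eval_nodeE hv, Expr.eval_add, h'.eval_levelE hy, Expr.eval_one]
    simp only [Leveling.product₂]
    split_ifs <;> rfl
  · intro st h' x hx
    rw [Cases.eval_node, Cases.eval_node, Cases.eval_leaf, Cases.eval_leaf, vertexE,
      h'.eval_nodeE (h'.eval_vertex hQ hx), h'.eval_mainE hx, Expr.eval_sub, Expr.eval_sub,
      Expr.eval_add, h'.eval_updE hx, h'.eval_DE, Expr.eval_one, ← two_mul]
    simp only [Leveling.product₂]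
    by_cases h0 : Λ.upd x.divNat x.modNat = 0
    · rw [if_neg (not_not.2 h0), if_pos (Or.inl h0)]
    · rw [if_pos h0]
      by_cases h1 : Λ.D < 2 * Λ.upd x.divNat x.modNat
      · rw [if_pos (by omega), if_pos (Or.inr h1)]
      · rw [if_neg (by omega), if_neg (by omega)]
  · intro st h' hst y hy
    have hv := h'.eval_vertex h.levels_le hy
    have hW : (get 112 (nodeE DE vertexE)).eval st = win₁ (Λ.node Λ.D y.modNat) := by
      rw [Expr.eval_get, vertexE, h'.eval_nodeE hv, h'.eval_DE, hst 112 (by omega) (by omega), hw]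
    rw [Cases.eval_node_parity, Cases.eval_node_ne, Cases.eval_node_ne, Cases.eval_node,
      Cases.eval_leaf, Cases.eval_leaf, Cases.eval_leaf, hW, Expr.eval_add,
      h'.eval_levelE hy, h'.eval_colorE h.levels_le hy, h'.eval_DE, h'.eval_badE, Expr.eval_one]
    simp only [Leveling.product₂, Fin.ext_iff, Leveling.top, Leveling.bad, Fin.val_zero]
    split_ifs <;> first | rfl | omega

end

/-! ### The program -/

/-- The computation of the tables. -/
def preamble : Prog :=
  Prog.seq listColors (Prog.seq indexTables (Prog.seq compressColors memoryTables))

theorem BndCostGame.input_of_five_lt {n m : ℕ} (G : BndCostGame n m) {a : ℕ} (ha : 5 < a)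
    (i : ℕ) : G.input a i = 0 := by
  obtain ⟨a, rfl⟩ := Nat.exists_eq_add_of_le' ha
  rfl

theorem arrayOf_apply {n : ℕ} (f : Fin n → ℕ) (v : Fin n) : arrayOf f v = f v := dif_pos v.2

theorem linear_preamble {B n m : ℕ} (G : BndCostGame n m)
    (hB : (G.numColors + 2) * (n + m + 1) ≤ B) :
    Linear B preamble G.input fun s => (∀ b, 30 < b → ∀ i, s b i = 0) ∧
      ∃ p, ∃ hp : IsParity G p, ∃ out : Fin n → Fin m, (∀ v, (G.edge (out v)).1 = v) ∧
        Tables G hp.leveling out s := by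
  have hBn : n ≤ B := le_trans (by omega) (le_trans (Nat.le_mul_of_pos_left _ (by omega)) hB)
  refine (linear_listColors hBn G.color rfl (arrayOf_apply G.color)
    (G.input_of_five_lt (by omega)) (G.input_of_five_lt (by omega))
    (G.input_of_five_lt (by omega))).seq ?_
  rintro s1 ⟨f1, l, hl, hlS, h15, h13⟩
  have hd : s1 15 0 = G.numColors := by
    rw [h15, ParityGame.numColors, ← hlS, List.toFinset_card_of_nodup hl]
  refine (linear_indexTables hB (by rw [f1 0 (by omega)]; rfl) (by rw [f1 0 (by omega)]; rfl)
    hd).seq ?_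
  rintro s2 ⟨f2, h2⟩
  have f2' : ∀ b, b < 11 ∨ 21 < b → s2 b = G.input b := by
    intro b hb
    rw [f2 b (by omega), f1 b (by omega)]
  refine (linear_compressColors hB h2 (fun v => ?_) hl hlS (fun i => ?_) ?_ ?_).seq ?_
  · rw [f2' 2 (by omega)]; exact arrayOf_apply _ v
  · rw [f2 13 (by omega), h13]
  · intro i; rw [f2' 24 (by omega)]; exact G.input_of_five_lt (by omega) i
  · intro i; rw [f2' 25 (by omega)]; exact G.input_of_five_lt (by omega) i
  rintro s3 ⟨f3, p, hp, hc, hb, hD⟩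
  have f3' : ∀ b, b < 11 ∨ 26 < b → s3 b = G.input b := by
    intro b hb
    rw [f3 b (by omega), f2' b (by omega)]
  have h3 : ColorTables G hp.leveling s3 := by
    refine ⟨h2.congr fun b hb => f3 b (by omega), ?_, ?_, ?_, ?_, hc, hb, hD,
      hp.levels_le_succ, hp.Q_le⟩
    · rw [f3' 1 (by omega)]
      exact arrayOf_apply fun v => (G.owner v : ℕ)
    · rw [f3' 3 (by omega)]
      exact arrayOf_apply fun e => ((G.edge e).1 : ℕ)
    · rw [f3' 4 (by omega)]
      exact arrayOf_apply fun e => ((G.edge e).2 : ℕ)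
    · rw [f3' 5 (by omega)]
      exact arrayOf_apply fun e => (G.cost e).toNat
  refine (linear_memoryTables hB h3).mono ?_
  rintro s4 ⟨f4, out, hout, h4⟩
  refine ⟨fun b hb i => ?_, p, hp, out, hout, h4⟩
  rw [f4 b (by omega), f3' b (by omega)]
  exact G.input_of_five_lt (by omega) i

/-- The winners in array `6` and the next-move function in array `7`. -/
def writeSolution : Prog :=
  -- `113` holds the winners of the second game, `114` and `115` the strategies in the first and the
  -- second game. The first `n` cells of table `30` are the initial product vertices.
  Prog.seq (fill 6 nE (Cases.leaf (get 113 (get 30 loopVar))))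
    (fill 7 (get 16 (QE + 1)) (Cases.node (get 10 loopVar + get 10 loopVar - DE)
      (Cases.leaf (get 17 (get 114 (get 30 loopVar))))
      (Cases.leaf (get 17 (get 115 (get 30 loopVar))))))

theorem linear_writeSolution {B n m : ℕ} {G : BndCostGame n m} {Λ : Leveling n}
    {out : Fin n → Fin m} {s : Store} (hB : (G.numColors + 2) * (n + m + 1) ≤ B)
    (h : Tables G Λ out s) {win₂ : Fin (Λ.levels * n) → Fin 2}
    {nxt₁ nxt₂ : Fin (Λ.levels * n) → Fin (Λ.levels * n)}
    (hw₂ : ∀ y : Fin (Λ.levels * n), s 113 y = win₂ y)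
    (hn₁ : ∀ y : Fin (Λ.levels * n), s 114 y = nxt₁ y)
    (hn₂ : ∀ y : Fin (Λ.levels * n), s 115 y = nxt₂ y) :
    Linear B writeSolution s fun s' => Tables G Λ out s' ∧
      (∀ v : Fin n, s' 6 v = win₂ (Λ.main 0 v)) ∧
      ∀ (q : Fin (Λ.Q + 1)) (v : Fin n), s' 7 (q * n + v) = Λ.next nxt₁ nxt₂ v q := by
  have hQ := Nat.succ_le_succ h.Q_le
  have hBn : n ≤ B := le_trans (by omega) (le_trans (Nat.le_mul_of_pos_left _ (by omega)) hB)
  have hBQ : (Λ.Q + 1) * n ≤ B := le_trans (Nat.mul_le_mul (by omega) (by omega)) hB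
  refine (linear_fill_fin n hBn (fun v => (win₂ (Λ.main 0 v) : ℕ)) (by decide) ?_ ?_).seq ?_
  · intro st hst
    exact (h.congr fun b hb => hst b (by omega) (by omega)).eval_nE
  · intro v st hv hst
    have h' : Tables G Λ out st := h.congr fun b hb => hst b (by omega) (by omega)
    have h0 := h'.main_apply 0 v
    rw [Fin.val_zero, zero_mul, zero_add] at h0
    rw [Cases.eval_leaf, Expr.eval_get, Expr.eval_get, Expr.eval_get, Expr.eval_const, hv, h0,
      hst 113 (by omega) (by omega), hw₂]
  rintro s1 ⟨f1, t1, -⟩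
  have h1 : Tables G Λ out s1 := h.congr fun b hb => f1 b (by omega) (by omega)
  refine (linear_fill_fin _ hBQ (fun x => (Λ.next nxt₁ nxt₂ x.modNat x.divNat : ℕ)) (by decide)
    ?_ ?_).mono ?_
  · intro st hst
    exact (h1.congr fun b hb => hst b (by omega) (by omega)).eval_mul_Q_n
  · intro x st hx hst
    have h' : Tables G Λ out st := h1.congr fun b hb => hst b (by omega) (by omega)
    rw [Cases.eval_node, Cases.eval_leaf, Cases.eval_leaf, Expr.eval_get, Expr.eval_get _ 114,
      Expr.eval_get _ 17, Expr.eval_get _ 115, h'.eval_mainE hx, hst 114 (by omega) (by omega),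
      hst 115 (by omega) (by omega), f1 114 (by omega) (by omega), f1 115 (by omega) (by omega),
      hn₁, hn₂, h'.modNat_n h.levels_le, h'.modNat_n h.levels_le, Expr.eval_sub, Expr.eval_add,
      h'.eval_updE hx, h'.eval_DE, Leveling.next, ← two_mul]
    by_cases h2 : Λ.D < 2 * Λ.upd x.divNat x.modNat
    · rw [if_pos (by omega), if_pos h2]
    · rw [if_neg (by omega), if_neg h2]
  rintro s2 ⟨f2, t2, -⟩
  refine ⟨h1.congr fun b hb => f2 b (by omega) (by omega), ?_, ?_⟩
  · intro v; rw [f2 6 (by omega) (by omega), t1]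
  · intro q v
    have := t2 (finProdFinEquiv (q, v))
    rwa [Product.divNat_finProdFinEquiv, Product.modNat_finProdFinEquiv,
      finProdFinEquiv_apply_val, add_comm, mul_comm] at this

/-- Solving bounded parity games with costs by solving two parity games with the program `P`. -/
def solver (P : Prog) : Prog :=
  Prog.seq preamble <|
  Prog.seq (Prog.seq prepare₁ (P.rename fun a => 100 + 2 * a)) <|
  Prog.seq (Prog.seq prepare₂ (P.rename fun a => 101 + 2 * a)) writeSolution

theorem isSolution_of_tables {n m : ℕ} {G : BndCostGame n m} {p : ℕ → ℕ} (hp : IsParity G p)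
    {out : Fin n → Fin m} (hout : ∀ v, (G.edge (out v)).1 = v) {s : Store}
    (h : Tables G hp.leveling out s)
    {win₁ win₂ : Fin (hp.leveling.levels * n) → Fin 2}
    {nxt₁ nxt₂ : Fin (hp.leveling.levels * n) → Fin (hp.leveling.levels * n)}
    (h₁ : ∀ i, (hp.leveling.product₁ G out hout).game.arena.IsWinningFrom
      (parity (hp.leveling.product₁ G out hout).game.color) i (positional nxt₁) {y | win₁ y = i})
    (h₂ : ∀ i, (hp.leveling.product₂ G out hout fun v =>
      win₁ (hp.leveling.node hp.leveling.D v)).game.arena.IsWinningFrom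
        (parity (hp.leveling.product₂ G out hout fun v =>
          win₁ (hp.leveling.node hp.leveling.D v)).game.color) i (positional nxt₂)
            {y | win₂ y = i})
    (hs : ∀ v : Fin n, s 6 v = win₂ (hp.leveling.main 0 v))
    (hs' : ∀ (q : Fin (hp.leveling.Q + 1)) (v : Fin n),
      s 7 (q * n + v) = hp.leveling.next nxt₁ nxt₂ v q) : G.IsSolution s := by
  have hwin : ∀ i, G.arena.IsWinningFrom (bndCostParity G.color G.Cst) i
      (hp.leveling.memory.strategy (hp.leveling.next nxt₁ nxt₂))
      {v | win₂ (hp.leveling.main 0 v) = i} := by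
    intro i
    rw [hp.bndCostParity_eq]
    exact hp.leveling.isWinningFrom_next G out hout (h₁ i) (h₂ i)
  have hreg := Arena.winningRegion_eq G.arena _ _ _ hwin
  exact ⟨fun v => win₂ (hp.leveling.main 0 v), _, hp.leveling.memory,
    hp.leveling.next nxt₁ nxt₂, hs, h.size, h.init, h.upd_apply, hs',
    Nat.succ_le_succ hp.Q_le_numOddColors, fun i => ⟨hreg i, by rw [hreg i]; exact hwin i⟩⟩

theorem runs_solver {P : Prog} {T : ℕ → ℕ → ℕ → ℕ}
    (hmono : ∀ n n' m m' d d' : ℕ, n ≤ n' → m ≤ m' → d ≤ d' → T n m d ≤ T n' m' d')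
    (hP : SolvesParityGames P T) {n m : ℕ} (G : BndCostGame n m) :
    Runs (solver P) G.input
      ((solver P).work * ((G.numColors + 2) * (n + m + 1) + 1) +
        2 * T (G.numColors * n) (G.numColors * m) (G.numColors + 2)) G.IsSolution := by
  set t := T (G.numColors * n) (G.numColors * m) (G.numColors + 2)
  set B := (G.numColors + 2) * (n + m + 1) with hB
  have key : Runs (solver P) G.input (preamble.work * (B + 1) +
      ((Prog.seq prepare₁ (P.rename fun a => 100 + 2 * a)).work * (B + 1) + t +
        ((Prog.seq prepare₂ (P.rename fun a => 101 + 2 * a)).work * (B + 1) + t +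
          writeSolution.work * (B + 1)))) G.IsSolution := by
    refine Runs.seq (linear_preamble G hB.ge) ?_
    rintro s1 ⟨f1, p, hp, out, hout, h1⟩
    -- Each product has at most `d * n` vertices, `d * m` edges and `d + 2` colors, so monotonicity
    -- of `T` bounds both runs by `t`.
    have ht : ∀ H : Product G hp.leveling.levels, (∀ y, H.color y ∈
        Finset.Icc hp.leveling.b hp.leveling.D ∪ {hp.leveling.bad, hp.leveling.top}) →
        T (hp.leveling.levels * n) H.candidates.length H.game.numColors ≤ t := fun H hH =>
      hmono _ _ _ _ _ _ hp.levels_mul_le.1 (H.length_candidates_le.trans hp.levels_mul_le.2)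
        (hp.card_le (by rintro rfl; rfl) H.color hH)
    refine Runs.seq ((Linear.solve hP (linear_prepare₁ hB.ge h1 hout
      fun b hb => f1 b (by omega))).mono
        (Nat.add_le_add_left (ht _ (hp.leveling.product₁_color_mem G out hout)) _)
        fun _ h => h) ?_
    rintro s2 ⟨s2', f2, f2', win₁, nxt₁, hs2⟩
    have h2 : Tables G hp.leveling out s2 := h1.congr fun b hb => by
      rw [f2' b (by omega), f2 b (by omega)]
    refine Runs.seq ((Linear.solve hP (linear_prepare₂ hB.ge h2 hout (fun b hb => ?_)
      hs2.win_eq)).mono (Nat.add_le_add_left (ht _ (hp.leveling.product₂_color_mem G out hout _)) _)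
        fun _ h => h) ?_
    · rw [f2' b (by omega), f2 b (by omega)]
      exact f1 b (by omega)
    rintro s3 ⟨s3', f3, f3', win₂, nxt₂, hs3⟩
    have f : ∀ b, b < 11 ∨ (11 < b ∧ b < 31) ∨ (99 < b ∧ b % 2 = 0) → s3 b = s2 b := by
      intro b hb
      rw [f3' b (by omega), f3 b (by omega)]
    have h3 : Tables G hp.leveling out s3 := h2.congr fun b hb => f b (by omega)
    refine (linear_writeSolution (nxt₁ := nxt₁) hB.ge h3 hs3.win_eq (fun y => ?_) hs3.nxt_eq).mono ?_
    · rw [f 114 (by omega)]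
      exact hs2.nxt_eq y
    · rintro s4 ⟨h4, hs, hs'⟩
      exact isSolution_of_tables hp hout h4 hs2.isWinningFrom hs3.isWinningFrom hs hs'
  refine key.mono (le_of_eq ?_) fun _ h => h
  simp only [solver, Prog.work]
  ring

/-! ### The time bound -/

theorem one_le_time {P : Prog} {T : ℕ → ℕ → ℕ → ℕ} (hP : SolvesParityGames P T) :
    1 ≤ T 0 0 0 := by
  obtain ⟨t, s, he, ht, -⟩ := hP 0 0 ⟨fun v => v.elim0, fun v => v.elim0, fun e => e.elim0,
    fun e => e.elim0, fun v => v.elim0⟩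
  exact he.one_le.trans ht

end CostGames

theorem mainTheorem8 (T : ℕ → ℕ → ℕ → ℕ)
    (hmono : ∀ n n' m m' d d' : ℕ, n ≤ n' → m ≤ m' → d ≤ d' → T n m d ≤ T n' m' d')
    (hlin : ∃ c : ℕ, ∀ n m d : ℕ, n + m ≤ c * T n m d)
    (P : CostGames.Prog) (hP : CostGames.SolvesParityGames P T) :
    ∃ (Q : CostGames.Prog) (C : ℕ),
      CostGames.SolvesBndCostGames Q (fun n m d => C * T (d * n) (d * m) (d + 2)) := by
  obtain ⟨c, hc⟩ := hlin
  refine ⟨CostGames.solver P, (CostGames.solver P).work * (6 * c + 3) + 2, fun n m G => ?_⟩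
  obtain ⟨t, s, he, ht, hs⟩ := CostGames.runs_solver hmono hP G
  refine ⟨t, s, he, ht.trans ?_, hs⟩
  set d := G.numColors with hd
  set T' := T (d * n) (d * m) (d + 2)
  have h1 : 1 ≤ T' := (CostGames.one_le_time hP).trans
    (hmono _ _ _ _ _ _ (Nat.zero_le _) (Nat.zero_le _) (Nat.zero_le _))
  have h2 : d * n + d * m ≤ c * T' := hc _ _ _
  have h3 : (d + 2) * (n + m + 1) + 1 ≤ (6 * c + 3) * T' := by
    -- Without vertices the left side is `3`, which is covered by `1 ≤ T'`.
    rcases Nat.eq_zero_or_pos n with rfl | hn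
    · have hm : m = 0 := by
        by_contra hm
        exact (G.edge ⟨0, by omega⟩).1.elim0
      have hd0 : d = 0 := by simp [hd, CostGames.ParityGame.numColors]
      subst hm
      rw [hd0]
      nlinarith
    · have hd1 : 1 ≤ d := CostGames.numColors_pos (G := G) hn
      have h4 : (d + 2) * (n + m + 1) ≤ (3 * d) * (2 * (n + m)) :=
        Nat.mul_le_mul (by omega) (by omega)
      nlinarith
  calc _ ≤ (CostGames.solver P).work * ((6 * c + 3) * T') + 2 * T' :=
        Nat.add_le_add_right (Nat.mul_le_mul_left _ h3) _
    _ = _ := by ring
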